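/- Fix $n\ge 1$ and let $F_n$ be the free group on $x_1,\dots,x_n$. A \emph{marked metric graph} $A$ of rank $n$ is a finite connected metric graph (all edge lengths positive, no vertices of valence less than two; bivalent vertices are allowed) with a marking $\tau_A$ (a homotopy equivalence from the $n$-petalled rose $R_n$ to $A$); equivalently, it is given by its universal cover $T_A$, a simplicial $\mathbb R$-tree with a free minimal isometric action of $F_n$ and finite quotient $A=T_A/F_n$. For $w\in F_n$ let $l_A(w)=\inf_{p\in T_A}d_A(p,wp)$, the length of the shortest loop in the free homotopy class of $w$ in $A$, and let $$\Lambda_R(A,B)=\sup_{1\ne w\in F_n}\frac{l_B(w)}{l_A(w)}.$$ A \emph{PL-map} $f:A\to B$, $f\simeq\tau_B\tau_A^{-1}$, is a map with an $F_n$-equivariant lift $T_A\to T_B$ that maps every edge $e$ of $T_A$ linearly, with constant speed $S_{f,e}$, onto a (possibly degenerate) geodesic segment. Put $S_f=\max_e S_{f,e}$, and let $A_{\max}(f)$ be the subgraph of the edges with $S_{f,e}=S_f$. The map $f$ is \emph{optimal} if there is no vertex $v$ of $A_{\max}(f)$ such that the $f$-images (in the universal cover) of all edges of $A_{\max}(f)$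 terminating at $v$ have a common non-degenerate terminal segment. A \emph{candidate loop} in $A$ is a loop $\gamma$ of one of the following shapes: (O) $\gamma$ is a simple closed curve in $A$; ($\infty$) $\gamma=\gamma_1\gamma_2$, where $\gamma_1,\gamma_2$ are simple closed curves that meet in a single point only (an embedded figure-eight); (O--O) $\gamma=\gamma_1\gamma_3\gamma_2\overline{\gamma_3}$, where $\gamma_1,\gamma_2$ are disjoint simple closed curves and $\gamma_3$ is an embedded path that meets $\gamma_1$ and $\gamma_2$ at their initial points only (a barbell). \textbf{Proposition.} (1) Let $A,B$ be marked metric graphs of rank $n$ and let $f\simeq\tau_B\tau_A^{-1}$ be an optimal PL-map. Then there is a candidate loop $\gamma$ in $A$ with $l_B(\gamma)/l_A(\gamma)=S_f=\Lambda_R(A,B)$. (2) For every marked metric graph $A$ of rank $n$ there is a finite set $\Gamma$ of candidate loops in $A$, depending only on $A$, such that for every marked metric graph $B$ of rank $n$ some $\gamma\in\Gamma$ satisfies $l_B(\gamma)/l_A(\gamma)=\Lambda_R(A,B)$. (3) In particular, for a rose and its image under an automorphism, $\Lambda_R$ can be computed in linear time. Precisely: let $A$ be the rose $R_n$ with all petals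 of length $1$ and the identity marking and, for $\varphi\in\mathrm{Aut}(F_n)$, let $A\varphi$ be the same graph with marking $\tau_A\varphi$, so that $l_{A\varphi}(w)=l_A(\varphi(w))$. For each fixed $n$ there is a multi-stack Turing machine which, given the reduced words $\varphi(x_1),\dots,\varphi(x_n)$, outputs the integer $2\Lambda_R(A,A\varphi)$ in unary after a number of steps that is at most a constant (depending only on $n$) times one plus the length of the input. -/

import Mathlib

namespace OuterSpace

universe u v

section Trees

variable {T : Type u} [MetricSpace T]

/-- The geodesic segment between two points of a (uniquely) geodesic space. -/
def geodSeg (x y : T) : Set T := {z | dist x z + dist z y = dist x y}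

/-- A metric space is an `ℝ`-tree if it is geodesic and satisfies the four point condition
(that is, it is `0`-hyperbolic). -/
structure IsRTree (T : Type u) [MetricSpace T] : Prop where
  geodesic : ∀ x y : T, ∃ c : ℝ → T, c 0 = x ∧ c (dist x y) = y ∧
    ∀ s ∈ Set.Icc 0 (dist x y), ∀ t ∈ Set.Icc 0 (dist x y), dist (c s) (c t) = |s - t|
  four_point : ∀ x y z w : T,
    dist x y + dist z w ≤ max (dist x z + dist y w) (dist x w + dist y z)

/-- Given a set `V` of vertices in a tree, `[u, v]` is an edge if `u`, `v` are distinct vertices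
with no further vertex on the segment between them. -/
def IsEdgeOf (V : Set T) (u v : T) : Prop :=
  u ∈ V ∧ v ∈ V ∧ u ≠ v ∧ ∀ z ∈ V, z ∈ geodSeg u v → z = u ∨ z = v

end Trees

/-- A finite marked metric graph of rank `n` (a point of the unprojectivised Outer Space), given
by its universal cover: a simplicial `ℝ`-tree with a free isometric action of the free group
`F_n` whose quotient is a finite metric graph. The marking is the identification of `F_n` with
the group of deck transformations. Bivalent vertices are allowed; there are no vertices of
valence one, that is, the action is minimal. -/
structure MarkedMetricGraph (n : ℕ) where
  /-- the universal cover of the graph -/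
  Tree : Type u
  [metric : MetricSpace Tree]
  [action : MulAction (FreeGroup (Fin n)) Tree]
  [nonempty : Nonempty Tree]
  isRTree : IsRTree Tree
  dist_smul : ∀ (g : FreeGroup (Fin n)) (x y : Tree), dist (g • x) (g • y) = dist x y
  free : ∀ (g : FreeGroup (Fin n)) (x : Tree), g • x = x → g = 1
  /-- the vertices of the universal cover -/
  verts : Set Tree
  smul_mem : ∀ (g : FreeGroup (Fin n)), ∀ x ∈ verts, g • x ∈ verts
  /-- the vertex set is discrete, uniformly -/
  discrete : ∃ ε > 0, ∀ x ∈ verts, ∀ y ∈ verts, x ≠ y → ε ≤ dist x y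
  /-- the tree is the union of its edges -/
  covered : ∀ x : Tree, ∃ a b, IsEdgeOf verts a b ∧ x ∈ geodSeg a b
  /-- different edges meet at vertices only -/
  edges_meet : ∀ a b a' b' x, IsEdgeOf verts a b → IsEdgeOf verts a' b' →
    x ∈ geodSeg a b → x ∈ geodSeg a' b' → x ∉ verts → (a = a' ∧ b = b') ∨ (a = b' ∧ b = a')
  /-- the quotient has finitely many edges -/
  finite_edges : ∃ S : Set (Tree × Tree), S.Finite ∧
    ∀ a b, IsEdgeOf verts a b → ∃ g : FreeGroup (Fin n), (g • a, g • b) ∈ S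
  /-- every vertex has valence at least two -/
  valence : ∀ x ∈ verts, ∃ a b, a ≠ b ∧ IsEdgeOf verts x a ∧ IsEdgeOf verts x b

attribute [instance] MarkedMetricGraph.metric MarkedMetricGraph.action MarkedMetricGraph.nonempty

namespace MarkedMetricGraph

variable {n : ℕ}

/-- `[a, b]` is an edge of the universal cover. -/
def IsEdge (A : MarkedMetricGraph.{u} n) (a b : A.Tree) : Prop := IsEdgeOf A.verts a b

/-- The translation length `l_A(w)`, i.e. the length of the shortest loop in the free homotopy
class of loops of `A` given by the conjugacy class of `w`. -/
noncomputable def len (A : MarkedMetricGraph.{u} n) (w : FreeGroup (Fin n)) : ℝ :=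
  ⨅ p : A.Tree, dist p (w • p)

/-- The right stretching factor `Λ_R(A, B)`, the supremum of `l_B(w) / l_A(w)` over `w ≠ 1`,
a priori an extended real. -/
noncomputable def stretchR (A : MarkedMetricGraph.{u} n) (B : MarkedMetricGraph.{v} n) : EReal :=
  ⨆ w : {w : FreeGroup (Fin n) // w ≠ 1}, ((B.len w.1 / A.len w.1 : ℝ) : EReal)

/-- The points of the graph `A` itself: the quotient of the universal cover by `F_n`. -/
def Graph (A : MarkedMetricGraph.{u} n) : Type u :=
  MulAction.orbitRel.Quotient (FreeGroup (Fin n)) A.Tree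

/-- The universal covering map. -/
def proj (A : MarkedMetricGraph.{u} n) (x : A.Tree) : A.Graph :=
  Quotient.mk (MulAction.orbitRel (FreeGroup (Fin n)) A.Tree) x

/-- The image in the graph `A` of the path which lifts to the segment `[x, y]`. -/
def trace (A : MarkedMetricGraph.{u} n) (x y : A.Tree) : Set A.Graph :=
  A.proj '' geodSeg x y

/-- The loop of `A` based at `proj p` which lifts to the segment `[p, w • p]` is a simple closed
curve: it is not constant, and it has no self-intersection except that its endpoints agree. -/
def IsSimpleLoop (A : MarkedMetricGraph.{u} n) (p : A.Tree) (w : FreeGroup (Fin n)) : Prop :=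
  w ≠ 1 ∧ ∀ x ∈ geodSeg p (w • p), ∀ y ∈ geodSeg p (w • p), A.proj x = A.proj y →
    x = y ∨ (x = p ∧ y = w • p) ∨ (x = w • p ∧ y = p)

/-- The class of `w` is represented by a simple closed curve in `A`. -/
def IsCircle (A : MarkedMetricGraph.{u} n) (w : FreeGroup (Fin n)) : Prop :=
  ∃ p, A.IsSimpleLoop p w

/-- The class of `w` is represented by an embedded bouquet of two circles: `γ = γ₁ γ₂` where
`γ₁`, `γ₂` are simple closed curves which meet only in their common base point. -/
def IsFigureEight (A : MarkedMetricGraph.{u} n) (w : FreeGroup (Fin n)) : Prop :=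
  ∃ (p : A.Tree) (w₁ w₂ : FreeGroup (Fin n)), w = w₁ * w₂ ∧
    A.IsSimpleLoop p w₁ ∧ A.IsSimpleLoop p w₂ ∧
    A.trace p (w₁ • p) ∩ A.trace p (w₂ • p) = {A.proj p}

/-- The class of `w` is represented by `γ = γ₁ γ₃ γ₂ γ₃⁻¹` where `γ₁`, `γ₂` are disjoint simple
closed curves and `γ₃` is an embedded path from the initial point of `γ₁` to the initial point of
`γ₂`, which meets `γ₁` and `γ₂` at these points only. If `γ₁` lifts to `[p, w₁ p]`, `γ₃` to
`[p, q]` and `γ₂` to `[q, w₂ q]`, the lift of `γ` from `p` runs through `w₁ p`, `w₁ q`,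
`w₁ w₂ q` and ends at `w₁ w₂ p`. -/
def IsBarbell (A : MarkedMetricGraph.{u} n) (w : FreeGroup (Fin n)) : Prop :=
  ∃ (p q : A.Tree) (w₁ w₂ : FreeGroup (Fin n)), w = w₁ * w₂ ∧
    A.IsSimpleLoop p w₁ ∧ A.IsSimpleLoop q w₂ ∧
    Disjoint (A.trace p (w₁ • p)) (A.trace q (w₂ • q)) ∧
    Set.InjOn A.proj (geodSeg p q) ∧
    A.trace p q ∩ A.trace p (w₁ • p) = {A.proj p} ∧
    A.trace p q ∩ A.trace q (w₂ • q) = {A.proj q}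

/-- The class of `w` is represented by a loop in `A` of one of the three shapes. -/
def IsCandidate (A : MarkedMetricGraph.{u} n) (w : FreeGroup (Fin n)) : Prop :=
  A.IsCircle w ∨ A.IsFigureEight w ∨ A.IsBarbell w

/-- The image `(A, τ_A ∘ φ)` of `(A, τ_A)` under an automorphism `φ` of `F_n`: the element `w`
acts on the tree as `φ w` did. -/
def twist (A : MarkedMetricGraph.{u} n) (φ : FreeGroup (Fin n) ≃* FreeGroup (Fin n)) :
    MarkedMetricGraph.{u} n where
  Tree := A.Tree
  metric := A.metric
  action := MulAction.compHom A.Tree φ.toMonoidHom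
  nonempty := A.nonempty
  isRTree := A.isRTree
  dist_smul g x y := A.dist_smul (φ g) x y
  free g x h := by
    have h1 : φ g = 1 := A.free (φ g) x h
    simpa using h1
  verts := A.verts
  smul_mem g x hx := A.smul_mem (φ g) x hx
  discrete := A.discrete
  covered := A.covered
  edges_meet := A.edges_meet
  finite_edges := by
    obtain ⟨S, hS, h⟩ := A.finite_edges
    refine ⟨S, hS, fun a b hab => ?_⟩
    obtain ⟨g, hg⟩ := h a b hab
    refine ⟨φ.symm g, ?_⟩
    change (φ (φ.symm g) • a, φ (φ.symm g) • b) ∈ S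
    simpa using hg
  valence := A.valence

/-- `A` is the rose `R_n` with `n` petals of length one and the identity marking: the vertices of
the tree form a single orbit `F_n • o`, and the neighbours of `o` are the `x_i • o` and
`x_i⁻¹ • o`, at distance one, where the `x_i` are the free generators. -/
def IsUnitRose (A : MarkedMetricGraph.{u} n) : Prop :=
  ∃ o : A.Tree, A.verts = MulAction.orbit (FreeGroup (Fin n)) o ∧
    (∀ y, A.IsEdge o y ↔ ∃ i : Fin n, y = FreeGroup.of i • o ∨ y = (FreeGroup.of i)⁻¹ • o) ∧
    ∀ i : Fin n, dist o (FreeGroup.of i • o) = 1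

end MarkedMetricGraph

/-- A PL-map `f : A → B` in the homotopy class `τ_B ∘ τ_A⁻¹`, given by its `F_n`-equivariant lift
to the universal covers; on every edge it has constant speed. -/
structure PLMap {n : ℕ} (A : MarkedMetricGraph.{u} n) (B : MarkedMetricGraph.{v} n) where
  toFun : A.Tree → B.Tree
  map_smul : ∀ (g : FreeGroup (Fin n)) (x : A.Tree), toFun (g • x) = g • toFun x
  linear : ∀ a b, A.IsEdge a b → ∃ s : ℝ, ∀ x ∈ geodSeg a b, ∀ y ∈ geodSeg a b,
    dist (toFun x) (toFun y) = s * dist x y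

namespace PLMap

variable {n : ℕ} {A : MarkedMetricGraph.{u} n} {B : MarkedMetricGraph.{v} n}

/-- The speed `S_{f,e}` of `f` on the edge `e = [a, b]`. -/
noncomputable def speed (f : PLMap A B) (a b : A.Tree) : ℝ :=
  dist (f.toFun a) (f.toFun b) / dist a b

/-- The stretching factor `S_f`: the maximal speed of `f` on an edge (there are only finitely
many values). -/
noncomputable def stretch (f : PLMap A B) : ℝ :=
  sSup {s | ∃ a b, A.IsEdge a b ∧ s = f.speed a b}

/-- `[a, b]` is an edge of (the preimage in the universal cover of) the subgraph `A_max(f)` of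
maximally stretched edges. -/
def IsMaxEdge (f : PLMap A B) (a b : A.Tree) : Prop :=
  A.IsEdge a b ∧ f.speed a b = f.stretch

/-- `f` is optimal: there is no vertex `x` of `A_max(f)` such that the `f`-images of all edges of
`A_max(f)` terminating at `x` have a common nondegenerate terminal segment `[f x, z]`. -/
def IsOptimal (f : PLMap A B) : Prop :=
  ¬ ∃ x, (∃ y, f.IsMaxEdge x y) ∧
    ∃ z, z ≠ f.toFun x ∧ ∀ y, f.IsMaxEdge x y → z ∈ geodSeg (f.toFun x) (f.toFun y)

end PLMap

/-- An automorphism `φ` of `F_n`, written as a word over a finite alphabet: the reduced words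
`φ(x_1), …, φ(x_n)` in the letters `x_i^{±1}`, each followed by the separator `none`. -/
def encodeAut (n : ℕ) (φ : FreeGroup (Fin n) ≃* FreeGroup (Fin n)) :
    List (Option (Fin n × Bool)) :=
  (List.finRange n).flatMap fun i => (φ (FreeGroup.of i)).toWord.map some ++ [none]

/-- The function `F`, with encodings `ea` of its inputs and `eb` of its outputs, is computed in
linear time by a multi-stack Turing machine. -/
def LinearTime {α β αΓ βΓ : Type} (ea : α → List αΓ) (eb : β → List βΓ) (F : α → β) : Prop :=
  ∃ (M : Turing.TM2ComputableInTime ea eb F) (C : ℕ), ∀ m, M.time m ≤ C * (m + 1)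

end OuterSpace

/-! A PL-map `f` is Lipschitz with constant `S_f` (`PLMap.dist_le_stretch_mul`), so no word is
stretched by more than `S_f`. Equality requires a loop that runs through maximally stretched edges
only and whose image does not backtrack. Divide the directions of `A_max` at a vertex into gates:
two directions share a gate if their images have a common initial segment. A turn is legal if it
changes the gate. Optimality says that every vertex of `A_max` has at least two gates, hence that
every maximally stretched edge can be continued by a legal turn (`PLMap.IsOptimal.exists_legal`).

The image of a legal path is a local geodesic, hence a geodesic of the tree `T_B`, and its length is
`S_f` times the length of the path. If a closed path is legal across its base point too, the same
holds for all its powers, and comparing displacements gives `l_B = S_f * l_A` for its word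
(`PLMap.len_of_legal`).

It remains to find a legal loop of candidate shape, which is pure combinatorics
(`TurnGraph.exists_legal_candidate`). A legal walk closes up at its first repeated vertex. If the
closing turn is illegal, leave the loop there through another gate and walk on until the new path
meets itself or the loop. In each case the gate at the meeting point decides between an embedded
circle, a figure-eight and a barbell.

For the finite set one needs that optimal maps exist (`exists_isOptimal`). A PL-map is determined by
the images of finitely many vertices. Its stretching factor attains its minimum by cocompactness,
where translating by the centre of `F_n` takes care of rank one. Among the minimisers take one with
the fewest maximally stretched edges: at a vertex with a single gate, moving the image into the
common segment would reduce their number. The loops found above traverse at most `4 * |V|` edges, a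
bound that does not involve `B`.

The rose has one vertex, which leaves no room for barbells, so the candidates are words of length
one or two in the generators. Thus `2 Λ_R` is the maximum of the cyclically reduced lengths of
`φ(x_i) φ(x_j)^{±1}`, a single petal being counted through its square. The cyclically reduced length
of `w` is `|w w| - |w|`, so a fixed sequence of stack passes computes this maximum, and each pass
takes linear time. -/

namespace OuterSpace

/-! ### Geometry of `ℝ`-trees: segments, medians, local geodesics. -/

section RTree

variable {T : Type*} [MetricSpace T]

theorem mem_geodSeg {x y z : T} : z ∈ geodSeg x y ↔ dist x z + dist z y = dist x y := Iff.rfl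

theorem left_mem_geodSeg (x y : T) : x ∈ geodSeg x y := by simp [mem_geodSeg]

theorem right_mem_geodSeg (x y : T) : y ∈ geodSeg x y := by simp [mem_geodSeg]

theorem mem_geodSeg_symm {x y z : T} (h : z ∈ geodSeg x y) : z ∈ geodSeg y x := by
  rw [mem_geodSeg] at *
  rw [dist_comm y z, dist_comm z x, dist_comm y x]
  linarith

theorem geodSeg_self (x : T) : geodSeg x x = {x} := by
  ext z
  simp only [mem_geodSeg, dist_self, Set.mem_singleton_iff, dist_comm z x]
  constructor
  · intro h
    exact (dist_le_zero.1 (by linarith [dist_nonneg (x := x) (y := z)])).symm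
  · rintro rfl
    simp

theorem dist_left_le_of_mem {x y z : T} (h : z ∈ geodSeg x y) : dist x z ≤ dist x y := by
  rw [mem_geodSeg] at h
  linarith [dist_nonneg (x := z) (y := y)]

/-- A point of an initial subsegment lies on the segment. -/
theorem mem_geodSeg_of_left {x y z u : T} (hz : z ∈ geodSeg x y) (hu : u ∈ geodSeg x z) :
    u ∈ geodSeg x y := by
  rw [mem_geodSeg] at *
  linarith [dist_triangle u z y, dist_triangle x u y]

theorem mem_geodSeg_left_right {x y z u : T} (hz : z ∈ geodSeg x y) (hu : u ∈ geodSeg x z) :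
    z ∈ geodSeg u y := by
  rw [mem_geodSeg] at *
  linarith [dist_triangle u z y, dist_triangle x u y]

theorem mem_geodSeg_right_left {x y z u : T} (hz : z ∈ geodSeg x y) (hu : u ∈ geodSeg z y) :
    z ∈ geodSeg x u :=
  mem_geodSeg_symm (mem_geodSeg_left_right (mem_geodSeg_symm hz) (mem_geodSeg_symm hu))

theorem eq_of_mem_geodSeg_of_mem {x y z : T} (h : y ∈ geodSeg x z) (h' : z ∈ geodSeg x y) :
    y = z := by
  rw [mem_geodSeg] at *
  rw [dist_comm z y] at h'
  exact dist_le_zero.1 (by linarith)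

namespace IsRTree

variable (hT : IsRTree T)
include hT

/-- The four point condition for the endpoints and two points of a segment bounds the distance of
the two points by the difference of their distances to `x`; the triangle inequality is the converse.
Segments are therefore isometric to intervals, and their points are determined by the distance to
`x`. -/
theorem dist_eq_abs {x y z w : T} (hz : z ∈ geodSeg x y) (hw : w ∈ geodSeg x y) :
    dist z w = |dist x z - dist x w| := by
  apply le_antisymm
  · have h := hT.four_point x y z w
    rw [mem_geodSeg] at *
    rw [dist_comm y w, dist_comm y z] at h
    rcases le_max_iff.1 h with h | h
    · have := le_abs_self (dist x z - dist x w)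
      linarith
    · have := neg_abs_le (dist x z - dist x w)
      linarith
  · rw [dist_comm x z, dist_comm x w]
    exact abs_dist_sub_le z w x

theorem eq_of_dist_eq {x y z w : T} (hz : z ∈ geodSeg x y) (hw : w ∈ geodSeg x y)
    (h : dist x z = dist x w) : z = w := by
  have := hT.dist_eq_abs hz hw
  rw [h, sub_self, abs_zero] at this
  exact dist_eq_zero.1 this

theorem exists_mem_dist_eq (x y : T) {t : ℝ} (h0 : 0 ≤ t) (h1 : t ≤ dist x y) :
    ∃ z ∈ geodSeg x y, dist x z = t := by
  obtain ⟨c, hc0, hc1, hc⟩ := hT.geodesic x y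
  have hd : (0 : ℝ) ≤ dist x y := dist_nonneg
  refine ⟨c t, ?_, ?_⟩
  · rw [mem_geodSeg]
    have e1 := hc 0 ⟨le_rfl, hd⟩ t ⟨h0, h1⟩
    have e2 := hc t ⟨h0, h1⟩ _ ⟨hd, le_rfl⟩
    rw [hc0] at e1
    rw [hc1] at e2
    rw [e1, e2, abs_of_nonpos (by linarith), abs_of_nonpos (by linarith)]
    ring
  · have e1 := hc 0 ⟨le_rfl, hd⟩ t ⟨h0, h1⟩
    rw [hc0] at e1
    rw [e1, abs_of_nonpos (by linarith)]
    ring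

theorem exists_median (x y z : T) :
    ∃ m, m ∈ geodSeg x y ∧ m ∈ geodSeg x z ∧ m ∈ geodSeg y z := by
  have t1 := dist_triangle x y z
  have t2 := dist_triangle x z y
  have t3 := dist_triangle y x z
  rw [dist_comm z y] at t2
  rw [dist_comm y x] at t3
  -- The median lies on `[x, y]` at a distance from `x` equal to the Gromov product of `y` and `z`
  -- based at `x`.
  obtain ⟨m, hm, hd⟩ := hT.exists_mem_dist_eq x y (t := (dist x y + dist x z - dist y z) / 2)
    (by linarith) (by linarith)
  have hm' := mem_geodSeg.1 hm
  have h4 := hT.four_point x y m z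
  rw [dist_comm y m] at h4
  have hmz : dist m z ≤ (dist x z + dist y z - dist x y) / 2 := by
    rcases le_max_iff.1 h4 with h | h <;> linarith
  refine ⟨m, hm, ?_, ?_⟩
  · rw [mem_geodSeg]
    linarith [dist_triangle x m z]
  · rw [mem_geodSeg, dist_comm y m]
    have := dist_triangle y m z
    rw [dist_comm y m] at this
    linarith

/-- In an `ℝ`-tree, a path which is locally a geodesic is a geodesic. -/
theorem dist_eq_of_overlap {p q r s : T} (hq : q ∈ geodSeg p r) (hr : r ∈ geodSeg q s)
    (hqr : q ≠ r) : dist p s = dist p q + dist q r + dist r s := by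
  have h := hT.four_point p r q s
  have hpos := dist_pos.2 hqr
  rw [mem_geodSeg] at *
  rw [dist_comm r q] at h
  have := dist_triangle4 p q r s
  rcases le_max_iff.1 h with h | h <;> linarith

theorem mem_of_overlap {p q r s : T} (hq : q ∈ geodSeg p r) (hr : r ∈ geodSeg q s)
    (hqr : q ≠ r) : q ∈ geodSeg p s := by
  have := hT.dist_eq_of_overlap hq hr hqr
  rw [mem_geodSeg] at *
  linarith

theorem mem_of_overlap' {p q r s : T} (hq : q ∈ geodSeg p r) (hr : r ∈ geodSeg q s)
    (hqr : q ≠ r) : r ∈ geodSeg p s := by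
  have := hT.dist_eq_of_overlap hq hr hqr
  rw [mem_geodSeg] at *
  linarith

/-- Removing `z` separates `x` from `y`, so it separates `w` from at least one of them. The two
alternatives are those of the maximum in the four point condition. -/
theorem mem_or_mem {x y z : T} (hz : z ∈ geodSeg x y) (w : T) :
    z ∈ geodSeg w x ∨ z ∈ geodSeg w y := by
  have h := hT.four_point x y z w
  rw [mem_geodSeg] at *
  simp only [mem_geodSeg]
  rw [dist_comm x w, dist_comm y w, dist_comm y z, dist_comm z w] at h
  rw [dist_comm z x]
  rcases le_max_iff.1 h with h | h
  · right
    linarith [dist_triangle w z y]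
  · left
    have := dist_triangle w z x
    rw [dist_comm z x] at this
    linarith

theorem geodSeg_subset_union {x y z : T} (hz : z ∈ geodSeg x y) :
    geodSeg x y ⊆ geodSeg x z ∪ geodSeg z y := by
  intro u hu
  have h := hT.dist_eq_abs hu hz
  have hu' := mem_geodSeg.1 hu
  have hz' := mem_geodSeg.1 hz
  rcases le_total (dist x u) (dist x z) with hle | hle
  · left
    rw [abs_of_nonpos (by linarith)] at h
    rw [mem_geodSeg]
    linarith
  · right
    rw [abs_of_nonneg (by linarith)] at h
    rw [mem_geodSeg, dist_comm z u]
    linarith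

theorem mem_geodSeg_of_le {x y z w : T} (hz : z ∈ geodSeg x y) (hw : w ∈ geodSeg x y)
    (h : dist x z ≤ dist x w) : z ∈ geodSeg x w := by
  rcases hT.geodSeg_subset_union hw hz with h' | h'
  · exact h'
  · have h1 := mem_geodSeg.1 (mem_geodSeg_right_left hw h')
    have : w = z := dist_le_zero.1 (by linarith)
    rw [this]
    exact right_mem_geodSeg _ _

/-- If two segments issuing from `x` have only `x` in common, their union is a segment. -/
theorem mem_geodSeg_of_inter {x y z : T}
    (h : ∀ m, m ∈ geodSeg x y → m ∈ geodSeg x z → m = x) : x ∈ geodSeg y z := by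
  obtain ⟨m, h1, h2, h3⟩ := hT.exists_median x y z
  rwa [h m h1 h2] at h3

theorem isCompact_geodSeg (x y : T) : IsCompact (geodSeg x y) := by
  obtain ⟨c, hc0, hc1, hc⟩ := hT.geodesic x y
  have : geodSeg x y = c '' Set.Icc 0 (dist x y) := by
    ext z
    constructor
    · intro hz
      have hm : dist x z ∈ Set.Icc 0 (dist x y) := ⟨dist_nonneg, dist_left_le_of_mem hz⟩
      refine ⟨dist x z, hm, ?_⟩
      have e1 := hc 0 ⟨le_rfl, dist_nonneg⟩ _ hm
      have e2 := hc _ hm _ ⟨dist_nonneg, le_rfl⟩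
      rw [hc0, abs_of_nonpos (by linarith [hm.1])] at e1
      rw [hc1, abs_of_nonpos (by linarith [hm.2])] at e2
      refine hT.eq_of_dist_eq (x := x) (y := y) ?_ hz (by linarith)
      rw [mem_geodSeg]
      linarith
    · rintro ⟨t, ht, rfl⟩
      have e1 := hc 0 ⟨le_rfl, dist_nonneg⟩ _ ht
      have e2 := hc _ ht _ ⟨dist_nonneg, le_rfl⟩
      rw [hc0, abs_of_nonpos (by linarith [ht.1])] at e1
      rw [hc1, abs_of_nonpos (by linarith [ht.2])] at e2
      rw [mem_geodSeg]
      linarith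
  rw [this]
  apply isCompact_Icc.image_of_continuousOn
  refine LipschitzOnWith.continuousOn (K := 1) (LipschitzOnWith.of_dist_le_mul ?_)
  intro s hs t ht
  rw [hc s hs t ht, Real.dist_eq]
  simp

end IsRTree

end RTree

end OuterSpace

/-! ### The universal cover: edges, induction along segments, orbits of vertices, darts. -/

namespace OuterSpace

namespace MarkedMetricGraph

universe u v

variable {n : ℕ} (A : MarkedMetricGraph.{u} n)

theorem smul_mem_geodSeg (g : FreeGroup (Fin n)) {x y z : A.Tree} (h : z ∈ geodSeg x y) :
    g • z ∈ geodSeg (g • x) (g • y) := by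
  rw [mem_geodSeg] at *
  simpa only [A.dist_smul] using h

theorem smul_mem_geodSeg_iff (g : FreeGroup (Fin n)) {x y z : A.Tree} :
    g • z ∈ geodSeg (g • x) (g • y) ↔ z ∈ geodSeg x y := by
  simp only [mem_geodSeg, A.dist_smul]

theorem smul_mem_verts_iff (g : FreeGroup (Fin n)) {x : A.Tree} :
    g • x ∈ A.verts ↔ x ∈ A.verts := by
  refine ⟨fun h => ?_, A.smul_mem g x⟩
  simpa using A.smul_mem g⁻¹ _ h

theorem eq_of_smul_eq_smul {g h : FreeGroup (Fin n)} {x : A.Tree} (e : g • x = h • x) : g = h := by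
  have : (h⁻¹ * g) • x = x := by rw [mul_smul, e, inv_smul_smul]
  have := A.free _ _ this
  rwa [inv_mul_eq_one, eq_comm] at this

theorem proj_eq_iff {x y : A.Tree} :
    A.proj x = A.proj y ↔ ∃ g : FreeGroup (Fin n), g • x = y := by
  constructor
  · intro h
    have h' := Quotient.exact h.symm
    exact MulAction.mem_orbit_iff.1 (MulAction.orbitRel_apply.1 h')
  · intro h
    exact (Quotient.sound (MulAction.orbitRel_apply.2 (MulAction.mem_orbit_iff.2 h))).symm

theorem proj_smul (g : FreeGroup (Fin n)) (x : A.Tree) : A.proj (g • x) = A.proj x :=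
  (A.proj_eq_iff.2 ⟨g, rfl⟩).symm

variable {A}

theorem IsEdge.symm {a b : A.Tree} (h : A.IsEdge a b) : A.IsEdge b a :=
  ⟨h.2.1, h.1, h.2.2.1.symm, fun z hz hm => (h.2.2.2 z hz (mem_geodSeg_symm hm)).symm⟩

theorem IsEdge.ne {a b : A.Tree} (h : A.IsEdge a b) : a ≠ b := h.2.2.1

theorem IsEdge.left_mem {a b : A.Tree} (h : A.IsEdge a b) : a ∈ A.verts := h.1

theorem IsEdge.right_mem {a b : A.Tree} (h : A.IsEdge a b) : b ∈ A.verts := h.2.1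

theorem IsEdge.smul {a b : A.Tree} (h : A.IsEdge a b) (g : FreeGroup (Fin n)) :
    A.IsEdge (g • a) (g • b) := by
  refine ⟨A.smul_mem g _ h.1, A.smul_mem g _ h.2.1, fun e => h.ne (smul_left_cancel g e),
    fun z hz hm => ?_⟩
  have := h.2.2.2 (g⁻¹ • z) (A.smul_mem _ _ hz)
    ((A.smul_mem_geodSeg_iff g).1 (by rwa [smul_inv_smul]))
  rwa [inv_smul_eq_iff, inv_smul_eq_iff] at this

theorem IsEdge.dist_pos {a b : A.Tree} (h : A.IsEdge a b) : 0 < dist a b := _root_.dist_pos.2 h.ne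

variable (A)

theorem exists_isEdge : ∃ a b, A.IsEdge a b := by
  obtain ⟨a, b, h, -⟩ := A.covered A.nonempty.some
  exact ⟨a, b, h⟩

/-- Two edges at `y` form a geodesic. -/
theorem mem_geodSeg_of_isEdge {y a b : A.Tree} (ha : A.IsEdge y a) (hb : A.IsEdge y b)
    (hab : a ≠ b) : y ∈ geodSeg a b := by
  refine A.isRTree.mem_geodSeg_of_inter fun m h1 h2 => ?_
  by_contra hm
  by_cases hv : m ∈ A.verts
  · have e1 := (ha.2.2.2 m hv h1).resolve_left hm
    have e2 := (hb.2.2.2 m hv h2).resolve_left hm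
    exact hab (e1.symm.trans e2)
  · rcases A.edges_meet _ _ _ _ m ha hb h1 h2 hv with h | h
    · exact hab h.2
    · exact hb.ne h.1

/-- Prolong the segment from `y` to `x` beyond `x` up to the first vertex. If `x` is interior to an
edge, one endpoint of this edge lies on the far side of `x` by `mem_or_mem`. -/
theorem exists_vertex_beyond {x y : A.Tree} :
    ∃ u ∈ A.verts, x ∈ geodSeg u y ∧ ∀ z ∈ A.verts, z ∈ geodSeg u x → z = u := by
  by_cases hx : x ∈ A.verts
  · refine ⟨x, hx, left_mem_geodSeg _ _, fun z _ hz => ?_⟩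
    rwa [geodSeg_self] at hz
  · have key : ∀ a b, A.IsEdge a b → x ∈ geodSeg a b → x ∈ geodSeg y a →
        ∃ u ∈ A.verts, x ∈ geodSeg u y ∧ ∀ z ∈ A.verts, z ∈ geodSeg u x → z = u := by
      intro a b hab hxab h
      refine ⟨a, hab.1, mem_geodSeg_symm h, fun z hz hzm => ?_⟩
      rcases hab.2.2.2 z hz (mem_geodSeg_of_left hxab hzm) with h' | h'
      · exact h'
      · subst h'
        exact absurd (eq_of_mem_geodSeg_of_mem hxab hzm ▸ hz) hx
    obtain ⟨a, b, hab, hxab⟩ := A.covered x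
    rcases A.isRTree.mem_or_mem hxab y with h | h
    · exact key a b hab hxab h
    · exact key b a (IsEdge.symm hab) (mem_geodSeg_symm hxab) h

/-- Two points with no vertex strictly between them lie on a common edge. -/
theorem exists_isEdge_of_no_vertex {x y : A.Tree}
    (h : ∀ z ∈ A.verts, z ∈ geodSeg x y → z = x ∨ z = y) :
    ∃ u v, A.IsEdge u v ∧ x ∈ geodSeg u v ∧ y ∈ geodSeg u v := by
  by_cases hxy : x = y
  · subst hxy
    obtain ⟨a, b, hab, hx⟩ := A.covered x
    exact ⟨a, b, hab, hx, hx⟩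
  obtain ⟨u, hu, hxu, hu'⟩ := A.exists_vertex_beyond (x := x) (y := y)
  obtain ⟨v, hv, hyv, hv'⟩ := A.exists_vertex_beyond (x := y) (y := x)
  have hyv := mem_geodSeg_symm hyv
  have hd := A.isRTree.dist_eq_of_overlap hxu hyv hxy
  have h1 := A.isRTree.mem_of_overlap hxu hyv hxy
  have h2 := A.isRTree.mem_of_overlap' hxu hyv hxy
  refine ⟨u, v, ⟨hu, hv, ?_, ?_⟩, h1, h2⟩
  · rintro rfl
    rw [dist_self] at hd
    have : 0 < dist x y := _root_.dist_pos.2 hxy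
    linarith [dist_nonneg (x := u) (y := x), dist_nonneg (x := y) (y := u)]
  · intro z hz hzuv
    rcases A.isRTree.geodSeg_subset_union h1 hzuv with hz1 | hz1
    · exact Or.inl (hu' z hz hz1)
    rcases A.isRTree.geodSeg_subset_union hyv hz1 with hz2 | hz2
    · rcases h z hz hz2 with rfl | rfl
      · exact Or.inl (hu' z hz (right_mem_geodSeg _ _))
      · exact Or.inr (hv' z hz (right_mem_geodSeg _ _))
    · exact Or.inr (hv' z hz (mem_geodSeg_symm hz2))

/-- Induction along segments with vertices as endpoints. -/
theorem segment_induction_verts {P : A.Tree → A.Tree → Prop} (refl : ∀ x ∈ A.verts, P x x)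
    (edge : ∀ x y, A.IsEdge x y → P x y)
    (split : ∀ x y, ∀ z ∈ A.verts, z ∈ geodSeg x y → z ≠ x → z ≠ y → P x z → P z y → P x y) :
    ∀ x ∈ A.verts, ∀ y ∈ A.verts, P x y := by
  obtain ⟨ε, hε, hdisc⟩ := A.discrete
  -- Distances are measured in units of the discreteness constant `ε`: cutting a segment at an inner
  -- vertex shortens both halves by at least one unit.
  have key : ∀ k : ℕ, ∀ x ∈ A.verts, ∀ y ∈ A.verts, dist x y ≤ k * ε → P x y := by
    intro k
    induction k with
    | zero =>
      intro x hx y hy hd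
      have : x = y := dist_le_zero.1 (by simpa using hd)
      subst this
      exact refl x hx
    | succ k ih =>
      intro x hx y hy hd
      by_cases hxy : x = y
      · subst hxy
        exact refl x hx
      by_cases h : ∀ z ∈ A.verts, z ∈ geodSeg x y → z = x ∨ z = y
      · exact edge x y ⟨hx, hy, hxy, h⟩
      · push Not at h
        obtain ⟨z, hz, hzm, hzx, hzy⟩ := h
        have h1 := hdisc x hx z hz hzx.symm
        have h2 := hdisc z hz y hy hzy
        have h3 := mem_geodSeg.1 hzm
        push_cast at hd
        exact split x y z hz hzm hzx hzy (ih x hx z hz (by linarith)) (ih z hz y hy (by linarith))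
  intro x hx y hy
  obtain ⟨k, hk⟩ := exists_nat_ge (dist x y / ε)
  exact key k x hx y hy (by rwa [div_le_iff₀ hε] at hk)

/-- Induction along segments. -/
theorem segment_induction {P : A.Tree → A.Tree → Prop} (symm : ∀ x y, P x y → P y x)
    (edge : ∀ a b x y, A.IsEdge a b → x ∈ geodSeg a b → y ∈ geodSeg a b → P x y)
    (split : ∀ x y z, z ∈ geodSeg x y → P x z → P z y → P x y) : ∀ x y, P x y := by
  have base : ∀ x y, (∀ z ∈ A.verts, z ∈ geodSeg x y → z = x ∨ z = y) → P x y := by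
    intro x y h
    obtain ⟨u, v, huv, hx, hy⟩ := A.exists_isEdge_of_no_vertex h
    exact edge u v x y huv hx hy
  have hV : ∀ x ∈ A.verts, ∀ y ∈ A.verts, P x y := by
    refine A.segment_induction_verts (P := P) ?_ ?_ ?_
    · intro x _
      obtain ⟨a, b, hab, hx⟩ := A.covered x
      exact edge a b x x hab hx hx
    · exact fun x y h => edge x y x y h (left_mem_geodSeg _ _) (right_mem_geodSeg _ _)
    · exact fun x y z _ hz _ _ => split x y z hz
  obtain ⟨ε, hε, hdisc⟩ := A.discrete
  -- As `y` need not be a vertex, only the half beyond the cut is known to be shorter by `ε`; the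
  -- other half joins two vertices and is covered by `hV`.
  have hV' : ∀ k : ℕ, ∀ x ∈ A.verts, ∀ y, dist x y ≤ k * ε → P x y := by
    intro k
    induction k with
    | zero =>
      intro x hx y hd
      have : x = y := dist_le_zero.1 (by simpa using hd)
      subst this
      exact hV x hx x hx
    | succ k ih =>
      intro x hx y hd
      by_cases h : ∀ z ∈ A.verts, z ∈ geodSeg x y → z = x ∨ z = y
      · exact base x y h
      · push Not at h
        obtain ⟨z, hz, hzm, hzx, hzy⟩ := h
        have h1 := hdisc x hx z hz hzx.symm
        have h3 := mem_geodSeg.1 hzm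
        push_cast at hd
        exact split x y z hzm (hV x hx z hz) (ih z hz y (by linarith))
  have hV'' : ∀ x ∈ A.verts, ∀ y, P x y := by
    intro x hx y
    obtain ⟨k, hk⟩ := exists_nat_ge (dist x y / ε)
    exact hV' k x hx y (by rwa [div_le_iff₀ hε] at hk)
  intro x y
  by_cases h : ∀ z ∈ A.verts, z ∈ geodSeg x y → z = x ∨ z = y
  · exact base x y h
  · push Not at h
    obtain ⟨z, hz, hzm, -, -⟩ := h
    exact split x y z hzm (symm _ _ (hV'' z hz x)) (hV'' z hz y)

theorem exists_isEdge_mem_geodSeg {x y : A.Tree} (hx : x ∈ A.verts) (hy : y ∈ A.verts)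
    (hxy : x ≠ y) : ∃ z, A.IsEdge x z ∧ z ∈ geodSeg x y := by
  have := A.segment_induction_verts (P := fun x y => x ≠ y → ∃ z, A.IsEdge x z ∧ z ∈ geodSeg x y)
    (fun x _ h => absurd rfl h) (fun x y h _ => ⟨y, h, right_mem_geodSeg _ _⟩)
    (fun x y z _ hz hzx _ h _ _ => by
      obtain ⟨u, hu, hum⟩ := h hzx.symm
      exact ⟨u, hu, mem_geodSeg_of_left hz hum⟩)
  exact this x hx y hy hxy

/-- Moving each edge at `x` into the finite set of representatives is injective: if two edges at `x`
have the same image, the translates of `x` agree, and by freeness the same group element was used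
for both. -/
theorem finite_neighbours (x : A.Tree) : {b | A.IsEdge x b}.Finite := by
  obtain ⟨S, hS, h⟩ := A.finite_edges
  choose! g hg using h x
  refine Set.Finite.of_injOn (f := fun b => (g b • x, g b • b)) (t := S) (fun b hb => hg b hb) ?_ hS
  intro b _ c _ hbc
  simp only [Prod.mk.injEq] at hbc
  have := A.eq_of_smul_eq_smul hbc.1
  rw [this] at hbc
  exact smul_left_cancel _ hbc.2

/-- Induction on the radius in units of `ε`: the first edge towards a vertex uses up at least one
unit, and there are finitely many such edges. -/
theorem finite_verts_closedBall {x : A.Tree} (hx : x ∈ A.verts) (R : ℝ) :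
    {y | y ∈ A.verts ∧ dist x y ≤ R}.Finite := by
  obtain ⟨ε, hε, hdisc⟩ := A.discrete
  have key : ∀ k : ℕ, ∀ x ∈ A.verts, {y | y ∈ A.verts ∧ dist x y ≤ k * ε}.Finite := by
    intro k
    induction k with
    | zero =>
      intro x hx
      refine (Set.finite_singleton x).subset fun y hy => ?_
      have : dist x y ≤ 0 := by simpa using hy.2
      exact (dist_le_zero.1 this).symm
    | succ k ih =>
      intro x hx
      have : (⋃ z ∈ {b | A.IsEdge x b}, {y | y ∈ A.verts ∧ dist z y ≤ k * ε}).Finite :=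
        (A.finite_neighbours x).biUnion fun z hz => ih z hz.2.1
      refine ((Set.finite_singleton x).union this).subset fun y hy => ?_
      by_cases hxy : x = y
      · exact Or.inl hxy.symm
      · right
        obtain ⟨z, hz, hzm⟩ := A.exists_isEdge_mem_geodSeg hx hy.1 hxy
        have h1 := hdisc x hx z hz.2.1 hz.ne
        have h2 := mem_geodSeg.1 hzm
        have h3 := hy.2
        push_cast at h3
        simp only [Set.mem_iUnion]
        exact ⟨z, hz, hy.1, by linarith⟩
  obtain ⟨k, hk⟩ := exists_nat_ge (R / ε)
  refine (key k x hx).subset fun y hy => ⟨hy.1, hy.2.trans (by rwa [div_le_iff₀ hε] at hk)⟩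

/-- A system of representatives for the orbits of vertices. -/
structure IsTransversal {ι : Type*} (rep : ι → A.Tree) : Prop where
  mem_verts : ∀ i, rep i ∈ A.verts
  exists_smul : ∀ x ∈ A.verts, ∃ (g : FreeGroup (Fin n)) (i : ι), x = g • rep i
  inj : ∀ (g : FreeGroup (Fin n)) (i j : ι), rep i = g • rep j → i = j

theorem exists_isTransversal : ∃ (ι : Type u) (rep : ι → A.Tree), A.IsTransversal rep := by
  refine ⟨{q : A.Graph // ∃ x ∈ A.verts, A.proj x = q}, fun q => Quotient.out q.1, ?_, ?_, ?_⟩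
  · rintro ⟨q, x, hx, rfl⟩
    have : A.proj (Quotient.out (A.proj x)) = A.proj x := Quotient.out_eq _
    obtain ⟨g, hg⟩ := A.proj_eq_iff.1 this
    rw [← hg] at hx
    exact (A.smul_mem_verts_iff g).1 hx
  · intro x hx
    have : A.proj (Quotient.out (A.proj x)) = A.proj x := Quotient.out_eq _
    obtain ⟨g, hg⟩ := A.proj_eq_iff.1 this
    exact ⟨g, ⟨A.proj x, x, hx, rfl⟩, hg.symm⟩
  · rintro g ⟨q, x, hx, rfl⟩ ⟨q', y, hy, rfl⟩ h
    have e1 : A.proj (Quotient.out (A.proj x)) = A.proj x := Quotient.out_eq _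
    have e2 : A.proj (Quotient.out (A.proj y)) = A.proj y := Quotient.out_eq _
    ext
    change A.proj x = A.proj y
    rw [← e1, ← e2, ← A.proj_smul g (Quotient.out (A.proj y))]
    exact congrArg A.proj h

variable {A} {ι : Type*} {rep : ι → A.Tree}

theorem IsTransversal.eq_of_proj (hrep : A.IsTransversal rep) {i j : ι}
    (h : A.proj (rep i) = A.proj (rep j)) : i = j := by
  obtain ⟨g, hg⟩ := A.proj_eq_iff.1 h
  exact (hrep.inj g j i hg.symm).symm

theorem IsTransversal.finite (hrep : A.IsTransversal rep) : Finite ι := by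
  obtain ⟨S, hS, h⟩ := A.finite_edges
  have : ∀ i, ∃ p ∈ S, ∃ g : FreeGroup (Fin n), p.1 = g • rep i := by
    intro i
    obtain ⟨a, b, -, ha, -⟩ := A.valence _ (hrep.mem_verts i)
    obtain ⟨g, hg⟩ := h _ _ ha
    exact ⟨_, hg, g, rfl⟩
  choose p hp g hg using this
  have : Finite S := hS
  refine Finite.of_injective (fun i => (⟨p i, hp i⟩ : S)) fun i j hij => ?_
  have e : p i = p j := congrArg Subtype.val hij
  apply hrep.inj ((g i)⁻¹ * g j)
  rw [mul_smul, ← hg j, ← e, hg i, inv_smul_smul]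

/-- For `n = 0` the group is trivial, so the tree has finitely many vertices. A vertex farthest from
a given one has two edges, and at least one of them leads still farther away. -/
theorem rank_pos (A : MarkedMetricGraph.{u} n) : 0 < n := by
  rcases Nat.eq_zero_or_pos n with rfl | h
  swap
  · exact h
  exfalso
  obtain ⟨ι, rep, hrep⟩ := A.exists_isTransversal
  have := hrep.finite
  have hfin : A.verts.Finite := by
    refine (Set.finite_range rep).subset fun x hx => ?_
    obtain ⟨g, i, rfl⟩ := hrep.exists_smul x hx
    rw [Subsingleton.elim g 1, one_smul]
    exact ⟨i, rfl⟩
  obtain ⟨a, b, hab⟩ := A.exists_isEdge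
  obtain ⟨y, hy, hmax⟩ := hfin.exists_maximalFor (fun y => dist a y) _ ⟨a, hab.1⟩
  obtain ⟨c, d, hcd, hc, hd⟩ := A.valence y hy
  have key : ∀ c, A.IsEdge y c → y ∈ geodSeg a c → False := by
    intro c hc h
    have h1 := mem_geodSeg.1 h
    have h2 := hc.dist_pos
    have := hmax hc.right_mem (by simp only; linarith)
    simp only at this
    linarith
  rcases A.isRTree.mem_or_mem (A.mem_geodSeg_of_isEdge hc hd hcd) a with h | h
  · exact key c hc h
  · exact key d hd h

/-- An oriented edge of the quotient graph, given by its initial and terminal vertex and by the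
deck transformation leading from the chosen lift of the terminal vertex to the endpoint of the lift
of the edge which starts at the chosen lift of the initial vertex. -/
@[ext]
structure Dart (rep : ι → A.Tree) where
  /-- the initial vertex -/
  src : ι
  /-- the terminal vertex -/
  tgt : ι
  /-- the deck transformation -/
  lab : FreeGroup (Fin n)
  isEdge : A.IsEdge (rep src) (lab • rep tgt)

namespace Dart

/-- The endpoint of the lift of a dart. -/
def head (d : Dart rep) : A.Tree := d.lab • rep d.tgt

/-- The dart with the opposite orientation. -/
def rev (d : Dart rep) : Dart rep where
  src := d.tgt
  tgt := d.src
  lab := d.lab⁻¹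
  isEdge := by simpa using (d.isEdge.smul d.lab⁻¹).symm

@[simp] theorem rev_src (d : Dart rep) : d.rev.src = d.tgt := rfl
@[simp] theorem rev_tgt (d : Dart rep) : d.rev.tgt = d.src := rfl
@[simp] theorem rev_lab (d : Dart rep) : d.rev.lab = d.lab⁻¹ := rfl
@[simp] theorem rev_rev (d : Dart rep) : d.rev.rev = d := by ext <;> simp

theorem isEdge_head (d : Dart rep) : A.IsEdge (rep d.src) d.head := d.isEdge

theorem rev_head (d : Dart rep) : d.rev.head = d.lab⁻¹ • rep d.src := rfl

theorem ext_of_head (hrep : A.IsTransversal rep) {d e : Dart rep} (h : d.src = e.src)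
    (h' : d.head = e.head) : d = e := by
  have : d.tgt = e.tgt := by
    apply hrep.inj (d.lab⁻¹ * e.lab)
    rw [mul_smul, eq_inv_smul_iff]
    exact h'
  refine Dart.ext h this ?_
  unfold head at h'
  rw [this] at h'
  exact A.eq_of_smul_eq_smul h'

theorem finite (hrep : A.IsTransversal rep) : Finite (Dart rep) := by
  have := hrep.finite
  have hfin : (⋃ i, (fun b => (i, b)) '' {b | A.IsEdge (rep i) b}).Finite :=
    Set.finite_iUnion fun i => (A.finite_neighbours _).image _
  have := hfin.to_subtype
  refine Finite.of_injective (fun d : Dart rep => (⟨(d.src, d.head), by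
    simp only [Set.mem_iUnion]
    exact ⟨d.src, d.head, d.isEdge, rfl⟩⟩ :
      (⋃ i, (fun b => (i, b)) '' {b | A.IsEdge (rep i) b} : Set (ι × A.Tree)))) fun d e h => ?_
  simp only [Subtype.mk.injEq, Prod.mk.injEq] at h
  exact ext_of_head hrep h.1 h.2

end Dart

theorem IsTransversal.exists_dart (hrep : A.IsTransversal rep) {i : ι} {b : A.Tree}
    (h : A.IsEdge (rep i) b) : ∃ d : Dart rep, d.src = i ∧ d.head = b := by
  obtain ⟨g, j, rfl⟩ := hrep.exists_smul b h.right_mem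
  exact ⟨⟨i, j, g, h⟩, rfl, rfl⟩

theorem IsTransversal.exists_dart' (hrep : A.IsTransversal rep) {a b : A.Tree}
    (h : A.IsEdge a b) : ∃ (g : FreeGroup (Fin n)) (d : Dart rep),
      a = g • rep d.src ∧ b = g • d.head := by
  obtain ⟨g, i, rfl⟩ := hrep.exists_smul a h.left_mem
  obtain ⟨d, rfl, hd⟩ := hrep.exists_dart (i := i) (b := g⁻¹ • b) (by simpa using h.smul g⁻¹)
  exact ⟨g, d, rfl, by rw [hd, smul_inv_smul]⟩

end MarkedMetricGraph

end OuterSpace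

/-! ### Combinatorics of legal turns: legal circles, figure-eights and barbells. -/

namespace OuterSpace

/-- A graph given by its oriented edges, each of which has a gate at its initial vertex. -/
structure TurnGraph (V D G : Type*) where
  /-- the initial vertex -/
  src : D → V
  /-- the terminal vertex -/
  tgt : D → V
  /-- the opposite orientation -/
  rev : D → D
  /-- the gate at the initial vertex -/
  gate : D → G
  rev_src : ∀ d, src (rev d) = tgt d
  rev_tgt : ∀ d, tgt (rev d) = src d
  rev_rev : ∀ d, rev (rev d) = d

namespace TurnGraph

variable {V D G : Type*} (X : TurnGraph V D G)

/-- The edge `e` can follow `d` on a path which makes legal turns only. -/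
def Legal (d e : D) : Prop := X.tgt d = X.src e ∧ X.gate (X.rev d) ≠ X.gate e

/-- The list of edges forms a path from `P` to `Q`. -/
def IsPath (P Q : V) : List D → Prop
  | [] => P = Q
  | d :: l => X.src d = P ∧ IsPath (X.tgt d) Q l

/-- The path backwards. -/
def revPath (l : List D) : List D := (l.map X.rev).reverse

/-- A closed path which traverses its vertices once. -/
structure IsSimpleClosed (P : V) (l : List D) : Prop where
  ne_nil : l ≠ []
  isPath : X.IsPath P P l
  nodup : (l.map X.src).Nodup

/-- An embedded circle all of whose turns are legal. -/
def HasCircle : Prop :=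
  ∃ P l, X.IsSimpleClosed P l ∧ List.IsChain X.Legal (l ++ l)

/-- An embedded figure-eight all of whose turns are legal. -/
def HasFigureEight : Prop :=
  ∃ P l₁ l₂, X.IsSimpleClosed P l₁ ∧ X.IsSimpleClosed P l₂ ∧
    (∀ v ∈ l₁.map X.src, v ∈ l₂.map X.src → v = P) ∧
    (∀ d ∈ l₁, d ∉ l₂ ∧ X.rev d ∉ l₂) ∧
    List.IsChain X.Legal ((l₁ ++ l₂) ++ (l₁ ++ l₂))

/-- An embedded barbell all of whose turns are legal. -/
def HasBarbell : Prop :=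
  ∃ P Q l₁ l₃ l₂, X.IsSimpleClosed P l₁ ∧ X.IsSimpleClosed Q l₂ ∧ l₃ ≠ [] ∧ X.IsPath P Q l₃ ∧
    (l₃.map X.src).Nodup ∧ (∀ v ∈ l₃.map X.src, v ∈ l₁.map X.src → v = P) ∧
    (∀ v ∈ l₃.map X.src, v ∉ l₂.map X.src) ∧ (∀ v ∈ l₁.map X.src, v ∉ l₂.map X.src) ∧
    List.IsChain X.Legal ((l₁ ++ l₃ ++ l₂ ++ X.revPath l₃) ++ (l₁ ++ l₃ ++ l₂ ++ X.revPath l₃))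

variable {X}

theorem Legal.rev {d e : D} (h : X.Legal d e) : X.Legal (X.rev e) (X.rev d) := by
  refine ⟨by rw [X.rev_tgt, X.rev_src, h.1], ?_⟩
  rw [X.rev_rev]
  exact h.2.symm

theorem isChain_revPath {l : List D} (h : List.IsChain X.Legal l) :
    List.IsChain X.Legal (X.revPath l) := by
  unfold revPath
  rw [List.isChain_reverse, List.isChain_map]
  exact h.imp fun _ _ h => h.rev

theorem isChain_append {l₁ l₂ : List D} {a b : D} (h₁ : List.IsChain X.Legal l₁)
    (h₂ : List.IsChain X.Legal l₂) (ha : l₁.getLast? = some a) (hb : l₂.head? = some b)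
    (h : X.Legal a b) : List.IsChain X.Legal (l₁ ++ l₂) := by
  rw [List.isChain_append]
  refine ⟨h₁, h₂, ?_⟩
  simp [ha, hb, h]

theorem getLast?_append_of_ne_nil {α : Type*} (l₁ : List α) {l₂ : List α} (h : l₂ ≠ []) :
    (l₁ ++ l₂).getLast? = l₂.getLast? := by
  rw [List.getLast?_append, List.getLast?_eq_some_getLast h]
  rfl

theorem isPath_of_isChain {d e : D} {l : List D} (h : List.IsChain X.Legal l)
    (hd : l.head? = some d) (he : l.getLast? = some e) : X.IsPath (X.src d) (X.tgt e) l := by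
  induction l generalizing d with
  | nil => simp at hd
  | cons a l ih =>
    simp only [List.head?_cons, Option.some.injEq] at hd
    subst hd
    refine ⟨rfl, ?_⟩
    cases l with
    | nil =>
      simp only [List.getLast?_singleton, Option.some.injEq] at he
      subst he
      rfl
    | cons b l =>
      rw [List.isChain_cons_cons] at h
      rw [h.1.1]
      exact ih h.2 rfl (by simpa using he)

/-- The terminal vertices are the initial ones shifted by one place, with the end `Q` in the last
place. On a closed path distinct initial vertices therefore give distinct terminal ones. -/
theorem IsPath.map_tgt {P Q : V} {d : D} {l : List D} (h : X.IsPath P Q (d :: l)) :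
    (d :: l).map X.tgt = l.map X.src ++ [Q] := by
  induction l generalizing P d with
  | nil => simpa [IsPath] using h.2
  | cons e l ih =>
    have h2 := h.2
    rw [List.map_cons, ih h2, h2.1.symm]
    simp

theorem IsSimpleClosed.nodup_tgt {P : V} {l : List D} (h : X.IsSimpleClosed P l) :
    (l.map X.tgt).Nodup := by
  cases l with
  | nil => exact absurd rfl h.ne_nil
  | cons d l =>
    rw [h.isPath.map_tgt]
    have h1 := h.nodup
    rw [List.map_cons, h.isPath.1, List.nodup_cons] at h1
    rw [List.nodup_append]
    refine ⟨h1.2, by simp, ?_⟩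
    intro a ha b hb
    simp only [List.mem_singleton] at hb
    rintro rfl
    exact h1.1 (hb ▸ ha)

theorem IsSimpleClosed.tgt_mem {P : V} {l : List D} (h : X.IsSimpleClosed P l) {d : D}
    (hd : d ∈ l) : X.tgt d ∈ l.map X.src := by
  cases l with
  | nil => exact absurd rfl h.ne_nil
  | cons e l =>
    have h1 : X.tgt d ∈ (e :: l).map X.tgt := List.mem_map_of_mem hd
    rw [h.isPath.map_tgt] at h1
    simp only [List.mem_append, List.mem_singleton] at h1
    rw [List.map_cons, h.isPath.1]
    simp only [List.mem_cons]
    tauto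

variable [Finite V] (hX : ∀ d, ∃ e, X.Legal d e)
include hX

/-- Walking from the edge `d₀` along legal turns until the first vertex which lies in `F` or has
been visited before. -/
theorem exists_walk (F : Set V) (d₀ : D) :
    ∃ l e, l.head? = some d₀ ∧ l.getLast? = some e ∧ List.IsChain X.Legal l ∧
      (l.map X.src).Nodup ∧ (∀ d ∈ l, d = d₀ ∨ X.src d ∉ F) ∧
      (X.tgt e ∈ F ∨ X.tgt e ∈ l.map X.src) := by
  have := Fintype.ofFinite V
  -- The number `k` bounds the steps that are still possible: the visited vertices are distinct, so
  -- the walk has at most `card V` edges.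
  have key : ∀ k : ℕ, ∀ l e, l.head? = some d₀ → l.getLast? = some e →
      List.IsChain X.Legal l → (l.map X.src).Nodup → (∀ d ∈ l, d = d₀ ∨ X.src d ∉ F) →
      Fintype.card V ≤ l.length + k →
      ∃ l e, l.head? = some d₀ ∧ l.getLast? = some e ∧ List.IsChain X.Legal l ∧
      (l.map X.src).Nodup ∧ (∀ d ∈ l, d = d₀ ∨ X.src d ∉ F) ∧
      (X.tgt e ∈ F ∨ X.tgt e ∈ l.map X.src) := by
    intro k
    induction k with
    | zero =>
      intro l e h1 h2 h3 h4 h5 h6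
      refine ⟨l, e, h1, h2, h3, h4, h5, ?_⟩
      by_contra hcon
      push Not at hcon
      have h7 : (X.tgt e :: l.map X.src).Nodup := List.nodup_cons.2 ⟨hcon.2, h4⟩
      have := h7.length_le_card
      simp at this
      omega
    | succ k ih =>
      intro l e h1 h2 h3 h4 h5 h6
      by_cases hcon : X.tgt e ∈ F ∨ X.tgt e ∈ l.map X.src
      · exact ⟨l, e, h1, h2, h3, h4, h5, hcon⟩
      push Not at hcon
      obtain ⟨e', he'⟩ := hX e
      refine ih (l ++ [e']) e' (by simp [h1]) (by simp)
        (isChain_append h3 (List.isChain_singleton _) h2 rfl he') ?_ ?_ (by simp; omega)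
      · rw [List.map_append, List.nodup_append]
        refine ⟨h4, by simp, ?_⟩
        intro a ha b hb
        simp only [List.map_cons, List.map_nil, List.mem_singleton] at hb
        rintro rfl
        rw [hb, ← he'.1] at ha
        exact hcon.2 ha
      · intro d hd
        rcases List.mem_append.1 hd with hd | hd
        · exact h5 d hd
        · right
          rw [List.mem_singleton.1 hd, ← he'.1]
          exact hcon.1
  exact key (Fintype.card V) [d₀] d₀ rfl rfl (List.isChain_singleton _) (by simp) (by simp)
    (by simp)

/-- If every edge can be continued by a legal turn, there is an embedded circle, figure-eight or
barbell all of whose turns are legal. -/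
theorem exists_legal_candidate [Nonempty D] :
    X.HasCircle ∨ X.HasFigureEight ∨ X.HasBarbell := by
  obtain ⟨d₀⟩ := ‹Nonempty D›
  -- With no forbidden set the walk ends at its first repeated vertex. Discarding the part `s`
  -- before that vertex leaves the closed path `x :: t`, whose last edge is `e`.
  obtain ⟨l, e, -, hle, hl, hnd, -, he⟩ := exists_walk hX ∅ d₀
  simp only [Set.mem_empty_iff_false, false_or] at he
  obtain ⟨x, hx, hxe⟩ := List.mem_map.1 he
  obtain ⟨s, t, rfl⟩ := List.append_of_mem hx
  have hc₁ : List.IsChain X.Legal (x :: t) := (List.isChain_append.1 hl).2.1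
  have hn₁ : ((x :: t).map X.src).Nodup := by
    rw [List.map_append] at hnd
    exact (List.nodup_append.1 hnd).2.1
  have hl₁ : (x :: t).getLast? = some e := by simpa using hle
  have hp₁ : X.IsSimpleClosed (X.src x) (x :: t) := by
    refine ⟨by simp, ?_, hn₁⟩
    have := isPath_of_isChain hc₁ rfl hl₁
    rwa [← hxe] at this
  -- If the turn from `e` to `x` is legal, the loop is a legal circle. From here on, both directions
  -- of the loop at its base point lie in one gate.
  by_cases hg : X.gate (X.rev e) = X.gate x
  swap
  · exact Or.inl ⟨_, _, hp₁, isChain_append hc₁ hc₁ hl₁ rfl ⟨hxe.symm, hg⟩⟩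
  -- The edge `f₀` leaves through another gate, so it may follow the loop traversed in either
  -- direction: after `e` and after the reverse of `x`. The second walk `δ` stops on the loop or on
  -- itself.
  obtain ⟨f₀, hef₀⟩ := hX e
  have hf₀P : X.src f₀ = X.src x := by rw [← hef₀.1, hxe]
  obtain ⟨δ, f, hδ0, hδf, hδ, hδn, hδF, hf⟩ := exists_walk hX {v | v ∈ (x :: t).map X.src} f₀
  simp only [Set.mem_ofPred_eq] at hδF hf
  have hxF : X.src x ∈ (x :: t).map X.src := by simp
  have hδmem : ∀ v ∈ δ.map X.src, v ∈ (x :: t).map X.src → v = X.src x := by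
    intro v hv hvF
    obtain ⟨d, hd, rfl⟩ := List.mem_map.1 hv
    rcases hδF d hd with rfl | h
    · exact hf₀P
    · exact absurd hvF h
  have hδpath := isPath_of_isChain hδ hδ0 hδf
  have hδne : δ ≠ [] := by
    rintro rfl
    simp at hδ0
  by_cases hfP : X.tgt f = X.src x
  · rw [hf₀P, hfP] at hδpath
    have hp₂ : X.IsSimpleClosed (X.src x) δ := ⟨hδne, hδpath, hδn⟩
    -- `δ` returns to the base point. If it arrives through the gate of the first loop, its own
    -- closing turn to `f₀` changes the gate and `δ` is a legal circle. Otherwise the turn from `f`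
    -- to `x` is legal and the two loops form a figure-eight.
    by_cases hgf : X.gate (X.rev f) = X.gate x
    · refine Or.inl ⟨_, _, hp₂, isChain_append hδ hδ hδf hδ0 ⟨by rw [hfP, hf₀P], ?_⟩⟩
      rw [hgf, ← hg]
      exact hef₀.2
    · refine Or.inr (Or.inl ⟨_, _, _, hp₁, hp₂, fun v h1 h2 => hδmem v h2 h1, ?_, ?_⟩)
      · intro d hd
        constructor
        · intro hdδ
          rcases hδF d hdδ with rfl | h
          · have : d = x := List.inj_on_of_nodup_map hn₁ hd (by simp) hf₀P
            rw [this] at hef₀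
            exact hef₀.2 hg
          · exact h (List.mem_map_of_mem hd)
        · intro hdδ
          rcases hδF _ hdδ with h | h
          · have h1 : X.tgt d = X.src x := by rw [← X.rev_src, h, hf₀P]
            have h2 : d = e := List.inj_on_of_nodup_map hp₁.nodup_tgt hd
              (List.mem_of_getLast? hl₁) (by rw [h1, hxe])
            rw [← h, h2] at hef₀
            exact hef₀.2 rfl
          · rw [X.rev_src] at h
            exact h (hp₁.tgt_mem hd)
      · have h12 : List.IsChain X.Legal (x :: t ++ δ) := isChain_append hc₁ hδ hl₁ hδ0 hef₀
        exact isChain_append h12 h12 (a := f) (b := x)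
          (by rw [getLast?_append_of_ne_nil _ hδne, hδf]) rfl ⟨hfP, hgf⟩
  by_cases hfF : X.tgt f ∈ (x :: t).map X.src
  · left
    obtain ⟨y, hy, hyf⟩ := List.mem_map.1 hfF
    have hyx : y ≠ x := by
      rintro rfl
      exact hfP hyf.symm
    obtain ⟨α, β, hαβ⟩ := List.append_of_mem hy
    obtain ⟨α', rfl⟩ : ∃ α', α = x :: α' := by
      cases α with
      | nil =>
        simp only [List.nil_append, List.cons.injEq] at hαβ
        exact absurd hαβ.1.symm hyx
      | cons a α =>
        simp only [List.cons_append, List.cons.injEq] at hαβ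
        exact ⟨α, by rw [hαβ.1]⟩
    rw [hαβ] at hc₁ hn₁ hl₁ hδmem hp₁
    obtain ⟨hcα, hcβ, hαβL⟩ := List.isChain_append.1 hc₁
    rw [List.map_append, List.nodup_append] at hn₁
    obtain ⟨hnα, hnβ, hαβd⟩ := hn₁
    obtain ⟨z, hz⟩ : ∃ z, (x :: α').getLast? = some z :=
      ⟨_, List.getLast?_eq_some_getLast (by simp)⟩
    have hzy : X.Legal z y := hαβL z hz y rfl
    have hlβ : (y :: β).getLast? = some e := by
      rwa [getLast?_append_of_ne_nil _ (by simp)] at hl₁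
    -- `δ` meets the loop at a vertex other than its base, which cuts the loop into `x :: α'` and `y
    -- :: β`. Its directions `rev z` and `y` at this vertex lie in different gates, so `δ` can turn
    -- legally onto one of the two arcs and follow it back to the base, the first arc being
    -- traversed backwards.
    by_cases hgy : X.gate (X.rev f) = X.gate y
    · have hch : List.IsChain X.Legal (δ ++ X.revPath (x :: α')) := by
        refine isChain_append hδ (isChain_revPath hcα) hδf (b := X.rev z) ?_ ⟨?_, ?_⟩
        · simp [revPath, List.head?_reverse, hz, -List.map_cons]
        · rw [X.rev_src, hzy.1, hyf]
        · rw [hgy]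
          exact hzy.2.symm
      have hlast : (δ ++ X.revPath (x :: α')).getLast? = some (X.rev x) := by
        rw [getLast?_append_of_ne_nil _ (by simp [revPath])]
        simp [revPath]
      have hhead : (δ ++ X.revPath (x :: α')).head? = some f₀ := by simp [hδ0]
      have hend : X.Legal (X.rev x) f₀ := by
        refine ⟨by rw [X.rev_tgt, hf₀P], ?_⟩
        rw [X.rev_rev, ← hg]
        exact hef₀.2
      refine ⟨X.src x, _, ⟨by simp [hδne], ?_, ?_⟩, isChain_append hch hch hlast hhead hend⟩
      · have := isPath_of_isChain hch hhead hlast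
        rwa [X.rev_tgt, hf₀P] at this
      · have hpα := isPath_of_isChain hcα rfl hz
        have hmap : (X.revPath (x :: α')).map X.src = (α'.map X.src ++ [X.src y]).reverse := by
          rw [← hzy.1, ← hpα.map_tgt]
          simp [revPath, X.rev_src, List.map_reverse, Function.comp_def]
        rw [List.map_cons, List.nodup_cons] at hnα
        rw [List.map_append, hmap, List.nodup_append]
        refine ⟨hδn, ?_, ?_⟩
        · rw [List.nodup_reverse, List.nodup_append]
          refine ⟨hnα.2, by simp, fun a ha b hb => ?_⟩
          simp only [List.mem_singleton] at hb
          rw [hb]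
          exact hαβd a (by simp only [List.map_cons, List.mem_cons]; exact Or.inr ha) _ (by simp)
        · rintro a ha b hb rfl
          simp only [List.mem_reverse, List.mem_append, List.mem_singleton] at hb
          have hax := hδmem a ha (by
            rw [List.map_append, List.mem_append]
            rcases hb with hb | hb
            · left
              exact List.mem_cons_of_mem _ hb
            · right
              simp [hb])
          rcases hb with hb | hb
          · exact hnα.1 (hax ▸ hb)
          · exact hαβd (X.src x) (by simp) (X.src y) (by simp) (by rw [← hax, hb])
    · have hch : List.IsChain X.Legal (δ ++ y :: β) :=
        isChain_append hδ hcβ hδf rfl ⟨hyf.symm, hgy⟩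
      have hlast : (δ ++ y :: β).getLast? = some e := by simpa using hlβ
      have hhead : (δ ++ y :: β).head? = some f₀ := by simp [hδ0]
      refine ⟨X.src x, _, ⟨by simp, ?_, ?_⟩, isChain_append hch hch hlast hhead hef₀⟩
      · have := isPath_of_isChain hch hhead hlast
        rwa [← hxe, hf₀P] at this
      · rw [List.map_append, List.nodup_append]
        refine ⟨hδn, hnβ, ?_⟩
        rintro a ha b hb rfl
        have := hδmem a ha (by
          rw [List.map_append, List.mem_append]
          exact Or.inr hb)
        exact hαβd (X.src x) (by simp) a hb this.symm
  · have hf := hf.resolve_left hfF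
    -- `δ` meets itself off the first loop: it consists of a stem `f₀ :: α'` and a second loop `y ::
    -- β`.
    obtain ⟨y, hy, hyf⟩ := List.mem_map.1 hf
    have hyf₀ : y ≠ f₀ := by
      rintro rfl
      exact hfP (by rw [← hyf, hf₀P])
    obtain ⟨α, β, rfl⟩ := List.append_of_mem hy
    obtain ⟨α', rfl⟩ : ∃ α', α = f₀ :: α' := by
      cases α with
      | nil =>
        simp only [List.nil_append, List.head?_cons, Option.some.injEq] at hδ0
        exact absurd hδ0 hyf₀
      | cons a α =>
        simp only [List.cons_append, List.head?_cons, Option.some.injEq] at hδ0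
        exact ⟨α, by rw [hδ0]⟩
    obtain ⟨hcα, hcβ, hαβL⟩ := List.isChain_append.1 hδ
    have hnδ := hδn
    rw [List.map_append, List.nodup_append] at hnδ
    obtain ⟨hnα, hnβ, hαβd⟩ := hnδ
    obtain ⟨z, hz⟩ : ∃ z, (f₀ :: α').getLast? = some z :=
      ⟨_, List.getLast?_eq_some_getLast (by simp)⟩
    have hzy : X.Legal z y := hαβL z hz y rfl
    have hlβ : (y :: β).getLast? = some f := by
      rwa [getLast?_append_of_ne_nil _ (by simp)] at hδf
    have hp₂ : X.IsSimpleClosed (X.src y) (y :: β) := by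
      refine ⟨by simp, ?_, hnβ⟩
      have := isPath_of_isChain hcβ rfl hlβ
      rwa [← hyf] at this
    -- If the second loop closes legally it is a circle. Otherwise both its ends lie in one gate,
    -- different from that of the stem, and the same holds for the first loop at the other end of
    -- the stem. So all turns of the barbell are legal.
    by_cases hgy : X.gate (X.rev f) = X.gate y
    swap
    · exact Or.inl ⟨_, _, hp₂, isChain_append hcβ hcβ hlβ rfl ⟨hyf.symm, hgy⟩⟩
    refine Or.inr (Or.inr ⟨_, _, x :: t, f₀ :: α', y :: β, hp₁, hp₂, by simp, ?_, hnα, ?_, ?_, ?_,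
      ?_⟩)
    · have := isPath_of_isChain hcα rfl hz
      rwa [hf₀P, hzy.1] at this
    · intro v hv
      exact hδmem v (by
        rw [List.map_append, List.mem_append]
        exact Or.inl hv)
    · exact fun v hv hv' => hαβd v hv v hv' rfl
    · intro v hv hv'
      have := hδmem v (by
        rw [List.map_append, List.mem_append]
        exact Or.inr hv') hv
      exact hαβd (X.src x) (by simp [hf₀P]) v hv' this.symm
    · have h1 : List.IsChain X.Legal (x :: t ++ f₀ :: α') := isChain_append hc₁ hcα hl₁ rfl hef₀
      have h2 : List.IsChain X.Legal (x :: t ++ f₀ :: α' ++ y :: β) :=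
        isChain_append h1 hcβ (a := z) (by rwa [getLast?_append_of_ne_nil _ (by simp)]) rfl hzy
      have h3 : List.IsChain X.Legal (x :: t ++ f₀ :: α' ++ y :: β ++ X.revPath (f₀ :: α')) := by
        refine isChain_append h2 (isChain_revPath hcα) (a := f) (b := X.rev z)
          (by rwa [getLast?_append_of_ne_nil _ (by simp)]) ?_ ⟨?_, ?_⟩
        · simp [revPath, List.head?_reverse, hz, -List.map_cons]
        · rw [X.rev_src, hzy.1, hyf]
        · rw [hgy]
          exact hzy.2.symm
      refine isChain_append h3 h3 (a := X.rev f₀) (b := x) ?_ rfl ⟨by rw [X.rev_tgt, hf₀P], ?_⟩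
      · rw [getLast?_append_of_ne_nil _ (by simp [revPath])]
        simp [revPath]
      · rw [X.rev_rev, ← hg]
        exact hef₀.2.symm

end TurnGraph

end OuterSpace

/-! ### Translation lengths and the Lipschitz bound for PL-maps. -/

namespace OuterSpace

universe u v

open MarkedMetricGraph

variable {n : ℕ} {A : MarkedMetricGraph.{u} n} {B : MarkedMetricGraph.{v} n}

namespace MarkedMetricGraph

theorem len_le_dist (A : MarkedMetricGraph.{u} n) (w : FreeGroup (Fin n)) (p : A.Tree) :
    A.len w ≤ dist p (w • p) :=
  ciInf_le ⟨0, by rintro _ ⟨x, rfl⟩; exact dist_nonneg⟩ p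

theorem len_nonneg (A : MarkedMetricGraph.{u} n) (w : FreeGroup (Fin n)) : 0 ≤ A.len w :=
  le_ciInf fun _ => dist_nonneg

theorem dist_pow_le (A : MarkedMetricGraph.{u} n) (w : FreeGroup (Fin n)) (p : A.Tree) (m : ℕ) :
    dist p (w ^ m • p) ≤ m * dist p (w • p) := by
  induction m with
  | zero => simp
  | succ m ih =>
    have h1 := dist_triangle p (w ^ m • p) (w ^ (m + 1) • p)
    rw [pow_succ, mul_smul, A.dist_smul, ← mul_smul, ← pow_succ] at h1
    push_cast
    linarith

/-- If the displacement of `q` by the powers of `w` grows at the rate `L`, then `L ≤ l_A(w)`. -/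
theorem le_len_of_le_dist_pow (A : MarkedMetricGraph.{u} n) {w : FreeGroup (Fin n)} (q : A.Tree)
    {L : ℝ} (h : ∀ m : ℕ, m * L ≤ dist q (w ^ m • q)) : L ≤ A.len w := by
  refine le_ciInf fun p => ?_
  -- Replacing the base point `q` by `p` changes the displacement of every power by at most `2 *
  -- dist p q`, which is negligible compared with `m`.
  have key : ∀ m : ℕ, m * (L - dist p (w • p)) ≤ 2 * dist p q := by
    intro m
    have h1 := h m
    have h2 := A.dist_pow_le w p m
    have h3 := dist_triangle4 q p (w ^ m • p) (w ^ m • q)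
    rw [A.dist_smul, dist_comm q p] at h3
    linarith
  by_contra hcon
  push Not at hcon
  have hpos : 0 < L - dist p (w • p) := by linarith
  obtain ⟨m, hm⟩ := exists_nat_gt (2 * dist p q / (L - dist p (w • p)))
  rw [div_lt_iff₀ hpos] at hm
  linarith [key m]

end MarkedMetricGraph

namespace PLMap

variable (f : PLMap A B)

theorem speed_smul (g : FreeGroup (Fin n)) (a b : A.Tree) :
    f.speed (g • a) (g • b) = f.speed a b := by
  simp only [speed, f.map_smul, A.dist_smul, B.dist_smul]

theorem speed_comm (a b : A.Tree) : f.speed a b = f.speed b a := by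
  simp only [speed, dist_comm]

theorem dist_eq_speed_mul {a b x y : A.Tree} (h : A.IsEdge a b) (hx : x ∈ geodSeg a b)
    (hy : y ∈ geodSeg a b) : dist (f.toFun x) (f.toFun y) = f.speed a b * dist x y := by
  obtain ⟨s, hs⟩ := f.linear a b h
  rw [hs x hx y hy, speed, hs a (left_mem_geodSeg _ _) b (right_mem_geodSeg _ _),
    mul_div_assoc, div_self h.dist_pos.ne', mul_one]

theorem dist_eq_speed_mul_of_isEdge {a b : A.Tree} (h : A.IsEdge a b) :
    dist (f.toFun a) (f.toFun b) = f.speed a b * dist a b :=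
  f.dist_eq_speed_mul h (left_mem_geodSeg _ _) (right_mem_geodSeg _ _)

theorem finite_speeds : {s | ∃ a b, A.IsEdge a b ∧ s = f.speed a b}.Finite := by
  obtain ⟨S, hS, h⟩ := A.finite_edges
  refine (hS.image fun p => f.speed p.1 p.2).subset ?_
  rintro s ⟨a, b, hab, rfl⟩
  obtain ⟨g, hg⟩ := h a b hab
  exact ⟨_, hg, f.speed_smul g a b⟩

theorem speed_le_stretch {a b : A.Tree} (h : A.IsEdge a b) : f.speed a b ≤ f.stretch :=
  le_csSup f.finite_speeds.bddAbove ⟨a, b, h, rfl⟩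

theorem exists_isMaxEdge : ∃ a b, f.IsMaxEdge a b := by
  obtain ⟨a, b, h⟩ := A.exists_isEdge
  have hne : {s | ∃ a b, A.IsEdge a b ∧ s = f.speed a b}.Nonempty := ⟨_, a, b, h, rfl⟩
  obtain ⟨a, b, h, hs⟩ := hne.csSup_mem f.finite_speeds
  exact ⟨a, b, h, hs.symm⟩

variable {f} in
theorem IsMaxEdge.smul {a b : A.Tree} (h : f.IsMaxEdge a b) (g : FreeGroup (Fin n)) :
    f.IsMaxEdge (g • a) (g • b) := ⟨h.1.smul g, by rw [f.speed_smul, h.2]⟩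

variable {f} in
theorem IsMaxEdge.symm {a b : A.Tree} (h : f.IsMaxEdge a b) : f.IsMaxEdge b a :=
  ⟨h.1.symm, by rw [f.speed_comm, h.2]⟩

theorem dist_le_stretch_mul (x y : A.Tree) :
    dist (f.toFun x) (f.toFun y) ≤ f.stretch * dist x y := by
  refine A.segment_induction (P := fun x y => dist (f.toFun x) (f.toFun y) ≤ f.stretch * dist x y)
    ?_ ?_ ?_ x y
  · intro x y h
    rwa [dist_comm, dist_comm y]
  · intro a b x y h hx hy
    rw [f.dist_eq_speed_mul h hx hy]
    exact mul_le_mul_of_nonneg_right (f.speed_le_stretch h) dist_nonneg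
  · intro x y z hz h1 h2
    rw [← mem_geodSeg.1 hz, mul_add]
    exact (dist_triangle _ _ _).trans (add_le_add h1 h2)

/-- Otherwise the Lipschitz bound would give `x` and its translate by a free generator the same
image, and the generator would fix a point of the tree of `B`. -/
theorem stretch_pos : 0 < f.stretch := by
  have hn := A.rank_pos
  let g : FreeGroup (Fin n) := FreeGroup.of ⟨0, hn⟩
  have hg : g ≠ 1 := FreeGroup.of_ne_one _
  obtain ⟨x⟩ := A.nonempty
  by_contra hcon
  push Not at hcon
  have h := f.dist_le_stretch_mul x (g • x)
  have h' : dist (f.toFun x) (f.toFun (g • x)) ≤ 0 :=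
    h.trans (mul_nonpos_of_nonpos_of_nonneg hcon dist_nonneg)
  have := dist_le_zero.1 h'
  rw [f.map_smul] at this
  exact hg (B.free g _ this.symm)

theorem len_le (w : FreeGroup (Fin n)) : B.len w ≤ f.stretch * A.len w := by
  unfold len
  rw [Real.mul_iInf_of_nonneg f.stretch_pos.le]
  refine le_ciInf fun p => ?_
  refine (B.len_le_dist w (f.toFun p)).trans ?_
  rw [← f.map_smul]
  exact f.dist_le_stretch_mul _ _

theorem len_div_le (w : FreeGroup (Fin n)) : B.len w / A.len w ≤ f.stretch :=
  div_le_of_le_mul₀ (A.len_nonneg w) f.stretch_pos.le (f.len_le w)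

theorem stretchR_eq {w : FreeGroup (Fin n)} (hw : w ≠ 1) (h : B.len w / A.len w = f.stretch) :
    A.stretchR B = (f.stretch : EReal) := by
  unfold stretchR
  apply le_antisymm
  · exact iSup_le fun w => EReal.coe_le_coe_iff.2 (f.len_div_le w.1)
  · rw [← h]
    exact le_iSup (fun w : {w : FreeGroup (Fin n) // w ≠ 1} =>
      ((B.len w.1 / A.len w.1 : ℝ) : EReal)) ⟨w, hw⟩

theorem IsMaxEdge.ne {f : PLMap A B} {a b : A.Tree} (h : f.IsMaxEdge a b) :
    f.toFun a ≠ f.toFun b := by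
  have := f.dist_eq_speed_mul_of_isEdge h.1
  rw [h.2] at this
  apply dist_pos.1
  rw [this]
  exact mul_pos f.stretch_pos h.1.dist_pos

end PLMap

end OuterSpace

/-! ### Edge paths in the quotient graph, their lifts and embeddedness. -/

namespace OuterSpace

universe u v

theorem prefix_eq_of_nodup {α : Type*} {l l₁ l₂ m₁ m₂ : List α} {d : α} (hl : l.Nodup)
    (h : l = l₁ ++ d :: l₂) (h' : l = m₁ ++ d :: m₂) : l₁ = m₁ := by
  subst h'
  have h1 := List.nodup_middle.1 hl
  rw [List.nodup_cons, List.mem_append, not_or] at h1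
  exact ((List.append_cons_inj_of_notMem h1.1.1 h1.1.2).1 h).1.symm

namespace TurnGraph

variable {V D G : Type*} {X : TurnGraph V D G}

theorem isPath_append {P Q : V} {l₁ l₂ : List D} :
    X.IsPath P Q (l₁ ++ l₂) ↔ ∃ R, X.IsPath P R l₁ ∧ X.IsPath R Q l₂ := by
  induction l₁ generalizing P with
  | nil => simp [IsPath]
  | cons d l₁ ih => simp [IsPath, ih, and_assoc]

theorem IsPath.revPath {P Q : V} {l : List D} (h : X.IsPath P Q l) :
    X.IsPath Q P (X.revPath l) := by
  induction l generalizing P with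
  | nil => exact Eq.symm h
  | cons d l ih =>
    have : X.revPath (d :: l) = X.revPath l ++ [X.rev d] := by simp [TurnGraph.revPath]
    rw [this, isPath_append]
    exact ⟨_, ih h.2, X.rev_src d, (X.rev_tgt d).trans h.1⟩

theorem IsPath.tgt_mem {P Q : V} {l : List D} (h : X.IsPath P Q l) {d : D} (hd : d ∈ l) :
    X.tgt d ∈ l.map X.src ∨ X.tgt d = Q := by
  cases l with
  | nil => simp at hd
  | cons e l =>
    have h1 : X.tgt d ∈ (e :: l).map X.tgt := List.mem_map_of_mem hd
    rw [h.map_tgt] at h1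
    simp only [List.mem_append, List.mem_singleton] at h1
    rcases h1 with h1 | h1
    · exact Or.inl (List.mem_cons_of_mem _ h1)
    · exact Or.inr h1

theorem IsPath.src_ne_tgt {P Q : V} {l : List D} (h : X.IsPath P Q l)
    (hn : (l.map X.src ++ [Q]).Nodup) {d : D} (hd : d ∈ l) : X.src d ≠ X.tgt d := by
  obtain ⟨l₁, l₂, rfl⟩ := List.append_of_mem hd
  obtain ⟨R, -, h1, h2⟩ := isPath_append.1 h
  intro he
  rw [List.map_append, List.append_assoc] at hn
  have hn := (List.nodup_append.1 hn).2.1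
  rw [List.map_cons, List.cons_append, List.nodup_cons] at hn
  apply hn.1
  cases l₂ with
  | nil =>
    have : X.tgt d = Q := h2
    simp [he, this]
  | cons e l₂ =>
    rw [he, ← h2.1]
    simp

/-- A legal path with distinct vertices does not traverse an edge in both directions. -/
theorem rev_notMem {l : List D} (hX : ∀ d, X.rev d ≠ d) (h : List.IsChain X.Legal l)
    (hn : (l.map X.src).Nodup) : ∀ d ∈ l, X.rev d ∉ l := by
  have key : ∀ d, ∀ l₁ l₂ l₃, l = l₁ ++ d :: (l₂ ++ X.rev d :: l₃) → False := by
    rintro d l₁ l₂ l₃ rfl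
    have h1 := (List.isChain_append.1 h).2.1
    rw [List.map_append] at hn
    have hn := (List.nodup_append.1 hn).2.1
    cases l₂ with
    | nil => exact (List.isChain_cons_cons.1 h1).1.2 rfl
    | cons e l₂ =>
      have h2 : X.tgt d = X.src e := (List.isChain_cons_cons.1 h1).1.1
      simp [← h2, X.rev_src] at hn
  intro d hd hrd
  obtain ⟨l₁, l₂, rfl⟩ := List.append_of_mem hd
  rcases List.mem_append.1 hrd with h' | h'
  · obtain ⟨m₁, m₂, rfl⟩ := List.append_of_mem h'
    exact key (X.rev d) m₁ m₂ l₂ (by rw [X.rev_rev]; simp)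
  · rcases List.mem_cons.1 h' with h' | h'
    · exact hX d h'
    · obtain ⟨m₁, m₂, rfl⟩ := List.append_of_mem h'
      exact key d l₁ m₁ m₂ rfl

end TurnGraph

namespace MarkedMetricGraph

open TurnGraph

variable {n : ℕ} {A : MarkedMetricGraph.{u} n} {ι : Type*} {rep : ι → A.Tree}

/-- No edge is inverted: the label of such a dart would have order at most two, hence be trivial
since free groups are torsion free, and the edge would be degenerate. -/
theorem Dart.rev_ne (d : Dart rep) : d.rev ≠ d := by
  intro h
  have h1 : d.lab⁻¹ = d.lab := congrArg Dart.lab h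
  have h2 : d.lab ^ 2 = 1 := by
    rw [pow_two]
    nth_rewrite 1 [← h1]
    exact inv_mul_cancel _
  have h3 : d.lab = 1 := by
    apply IsMulTorsionFree.pow_left_injective (M := FreeGroup (Fin n)) two_ne_zero
    simpa using h2
  have h4 : d.tgt = d.src := congrArg Dart.src h
  have h5 := d.isEdge.ne
  rw [h3, h4, one_smul] at h5
  exact h5 rfl

variable (rep) in
/-- The quotient graph, all of whose turns are in a single gate. -/
def dartGraph : TurnGraph ι (Dart rep) Unit where
  src := Dart.src
  tgt := Dart.tgt
  rev := Dart.rev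
  gate _ := ()
  rev_src _ := rfl
  rev_tgt _ := rfl
  rev_rev := Dart.rev_rev

/-- The deck transformation along a path. -/
def label (l : List (Dart rep)) : FreeGroup (Fin n) := (l.map Dart.lab).prod

/-- The length of a path. -/
noncomputable def pathLen (l : List (Dart rep)) : ℝ :=
  (l.map fun d => dist (rep d.src) d.head).sum

@[simp] theorem label_nil : label ([] : List (Dart rep)) = 1 := rfl

@[simp] theorem label_cons (d : Dart rep) (l : List (Dart rep)) :
    label (d :: l) = d.lab * label l := by simp [label]

@[simp] theorem label_append (l m : List (Dart rep)) : label (l ++ m) = label l * label m := by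
  simp [label]

theorem label_revPath (l : List (Dart rep)) :
    label ((dartGraph rep).revPath l) = (label l)⁻¹ := by
  induction l with
  | nil => simp [revPath]
  | cons d l ih =>
    have : (dartGraph rep).revPath (d :: l) = (dartGraph rep).revPath l ++ [d.rev] := by
      simp [revPath, dartGraph]
    rw [this, label_append, ih]
    simp

@[simp] theorem pathLen_nil : pathLen ([] : List (Dart rep)) = 0 := rfl

@[simp] theorem pathLen_cons (d : Dart rep) (l : List (Dart rep)) :
    pathLen (d :: l) = dist (rep d.src) d.head + pathLen l := by simp [pathLen]

@[simp] theorem pathLen_append (l m : List (Dart rep)) :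
    pathLen (l ++ m) = pathLen l + pathLen m := by
  simp [pathLen]

theorem pathLen_pos {l : List (Dart rep)} (h : l ≠ []) : 0 < pathLen l := by
  have h0 : ∀ l : List (Dart rep), 0 ≤ pathLen l := by
    intro l
    refine List.sum_nonneg fun x hx => ?_
    obtain ⟨d, -, rfl⟩ := List.mem_map.1 hx
    exact dist_nonneg
  cases l with
  | nil => exact absurd rfl h
  | cons d l =>
    rw [pathLen_cons]
    linarith [h0 l, d.isEdge_head.dist_pos]

theorem dist_le_pathLen {P Q : ι} {l : List (Dart rep)} (h : (dartGraph rep).IsPath P Q l) :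
    dist (rep P) (label l • rep Q) ≤ pathLen l := by
  induction l generalizing P with
  | nil =>
    rw [show P = Q from h]
    simp
  | cons d l ih =>
    have h1 : d.src = P := h.1
    have h2 := ih h.2
    rw [label_cons, pathLen_cons, mul_smul, ← h1]
    refine (dist_triangle _ d.head _).trans ?_
    unfold Dart.head
    rw [A.dist_smul]
    exact add_le_add_right h2 _

variable (rep) in
/-- A path whose lift is a geodesic. -/
def IsGeodesicPath (P Q : ι) (l : List (Dart rep)) : Prop :=
  (dartGraph rep).IsPath P Q l ∧ dist (rep P) (label l • rep Q) = pathLen l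

theorem IsGeodesicPath.head_mem {P Q : ι} {d : Dart rep} {l : List (Dart rep)}
    (h : IsGeodesicPath rep P Q (d :: l)) :
    d.src = P ∧ IsGeodesicPath rep d.tgt Q l ∧
      d.head ∈ geodSeg (rep P) (label (d :: l) • rep Q) := by
  obtain ⟨⟨h1, h2⟩, h3⟩ := h
  have h1 : d.src = P := h1
  subst h1
  have h4 := dist_le_pathLen h2
  rw [pathLen_cons, label_cons, mul_smul] at h3
  have h5 := dist_triangle (rep d.src) d.head (d.lab • label l • rep Q)
  have h6 : dist d.head (d.lab • label l • rep Q) = dist (rep d.tgt) (label l • rep Q) :=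
    A.dist_smul _ _ _
  have h4 : dist (rep d.tgt) (label l • rep Q) ≤ pathLen l := h4
  refine ⟨rfl, ⟨h2, ?_⟩, ?_⟩
  · linarith
  · rw [mem_geodSeg, label_cons, mul_smul]
    linarith

/-- A point of the lift of a geodesic path is a vertex or an interior point of one of the edges. -/
theorem IsGeodesicPath.exists_split {P Q : ι} {l : List (Dart rep)}
    (h : IsGeodesicPath rep P Q l) {x : A.Tree} (hx : x ∈ geodSeg (rep P) (label l • rep Q)) :
    (∃ l₁ l₂ R, l = l₁ ++ l₂ ∧ (dartGraph rep).IsPath P R l₁ ∧ (dartGraph rep).IsPath R Q l₂ ∧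
      x = label l₁ • rep R) ∨
    ∃ l₁ d l₂ y, l = l₁ ++ d :: l₂ ∧ y ∈ geodSeg (rep d.src) d.head ∧ y ∉ A.verts ∧
      x = label l₁ • y := by
  induction l generalizing P x with
  | nil =>
    left
    have hPQ : P = Q := h.1
    subst hPQ
    rw [label_nil, one_smul, geodSeg_self] at hx
    exact ⟨[], [], P, rfl, rfl, rfl, by rw [label_nil, one_smul]; exact hx⟩
  | cons d l ih =>
    obtain ⟨h1, h2, h3⟩ := h.head_mem
    subst h1
    rcases A.isRTree.geodSeg_subset_union h3 hx with hx' | hx'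
    · by_cases hv : x ∈ A.verts
      · left
        rcases d.isEdge_head.2.2.2 x hv hx' with rfl | rfl
        · exact ⟨[], _, _, rfl, rfl, h.1, by simp⟩
        · exact ⟨[d], l, d.tgt, rfl, ⟨rfl, rfl⟩, h2.1, by simp [Dart.head]⟩
      · right
        exact ⟨[], d, l, x, rfl, hx', hv, by simp⟩
    · have hx2 : d.lab⁻¹ • x ∈ geodSeg (rep d.tgt) (label l • rep Q) := by
        rw [← A.smul_mem_geodSeg_iff d.lab, smul_inv_smul, ← mul_smul, ← label_cons]
        exact hx'
      rcases ih h2 hx2 with ⟨l₁, l₂, R, rfl, hp1, hp2, hx3⟩ | ⟨l₁, e, l₂, y, rfl, hy, hv, hx3⟩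
      · left
        refine ⟨d :: l₁, l₂, R, rfl, ⟨rfl, hp1⟩, hp2, ?_⟩
        rw [label_cons, mul_smul, ← hx3, smul_inv_smul]
      · right
        refine ⟨d :: l₁, e, l₂, y, rfl, hy, hv, ?_⟩
        rw [label_cons, mul_smul, ← hx3, smul_inv_smul]

theorem mem_verts_of_proj_eq {x y : A.Tree} (h : A.proj x = A.proj y) (hx : x ∈ A.verts) :
    y ∈ A.verts := by
  obtain ⟨g, rfl⟩ := A.proj_eq_iff.1 h
  exact A.smul_mem g x hx

/-- A translate of the first edge meets the second one in a point that is not a vertex, so the two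
coincide up to orientation. By freeness the translation is trivial if the orientations agree, and is
the inverse of the label of `d` if they do not. -/
theorem interior_eq_of_proj_eq (hrep : A.IsTransversal rep) {d e : Dart rep} {x y : A.Tree}
    (hx : x ∈ geodSeg (rep d.src) d.head) (hy : y ∈ geodSeg (rep e.src) e.head)
    (hv : x ∉ A.verts) (h : A.proj x = A.proj y) : (d = e ∧ x = y) ∨ e = d.rev := by
  obtain ⟨g, rfl⟩ := A.proj_eq_iff.1 h
  have hv' : g • x ∉ A.verts := fun h => hv ((A.smul_mem_verts_iff g).1 h)
  rcases A.edges_meet _ _ _ _ _ (d.isEdge_head.smul g) e.isEdge_head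
    (A.smul_mem_geodSeg g hx) hy hv' with ⟨h1, h2⟩ | ⟨h1, h2⟩
  · left
    have hs : d.src = e.src := (hrep.inj g e.src d.src h1.symm).symm
    have hg : g = 1 := by
      apply A.free g (rep d.src)
      rw [h1, hs]
    subst hg
    rw [one_smul] at h2
    exact ⟨Dart.ext_of_head hrep hs h2, by simp⟩
  · right
    have hs : e.src = d.tgt := by
      apply hrep.inj (g * d.lab)
      rw [mul_smul]
      exact h2.symm
    have hg : g = d.lab⁻¹ := by
      have : (g * d.lab) • rep d.tgt = (1 : FreeGroup (Fin n)) • rep d.tgt := by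
        rw [one_smul, mul_smul]
        exact h2.trans (by rw [hs])
      exact eq_inv_of_mul_eq_one_left (A.eq_of_smul_eq_smul this)
    refine Dart.ext_of_head hrep hs ?_
    rw [← h1, hg, Dart.rev_head]

theorem proj_smul_rep {g : FreeGroup (Fin n)} {i : ι} : A.proj (g • rep i) = A.proj (rep i) :=
  A.proj_smul _ _

/-- Injectivity of the projection on the lift of a path with distinct vertices. -/
theorem IsGeodesicPath.eq_of_proj_eq (hrep : A.IsTransversal rep) {P Q : ι} {l : List (Dart rep)}
    (h : IsGeodesicPath rep P Q l) (hn : (l.map Dart.src).Nodup)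
    (hrev : ∀ d ∈ l, d.rev ∉ l) {x y : A.Tree}
    (hx : x ∈ geodSeg (rep P) (label l • rep Q)) (hy : y ∈ geodSeg (rep P) (label l • rep Q))
    (hxy : A.proj x = A.proj y) :
    x = y ∨ (Q ∈ l.map Dart.src ∧ ((x = label l • rep Q ∧ ∃ l₁ d l₂, l = l₁ ++ d :: l₂ ∧
      d.src = Q ∧ y = label l₁ • rep Q) ∨ (y = label l • rep Q ∧ ∃ l₁ d l₂, l = l₁ ++ d :: l₂ ∧
      d.src = Q ∧ x = label l₁ • rep Q))) := by
  have hnl : l.Nodup := hn.of_map _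
  rcases h.exists_split hx with ⟨l₁, l₂, R, hl, hp1, hp2, rfl⟩ | ⟨l₁, d, l₂, x', hl, hx', hv, rfl⟩
  · rcases h.exists_split hy with ⟨m₁, m₂, R', hm, hq1, hq2, rfl⟩ |
      ⟨m₁, e, m₂, y', hm, hy', hv', rfl⟩
    · rw [proj_smul_rep, proj_smul_rep] at hxy
      have hR := hrep.eq_of_proj hxy
      subst hR
      cases l₂ with
      | nil =>
        have hRQ : R = Q := hp2
        subst hRQ
        rw [List.append_nil] at hl
        subst hl
        cases m₂ with
        | nil =>
          rw [List.append_nil] at hm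
          subst hm
          exact Or.inl rfl
        | cons e m₂ =>
          have he : e.src = R := hq2.1
          refine Or.inr ⟨?_, Or.inl ⟨rfl, m₁, e, m₂, hm, he, rfl⟩⟩
          rw [← he]
          exact List.mem_map_of_mem (by simp [hm])
      | cons d l₂ =>
        have hd : d.src = R := hp2.1
        cases m₂ with
        | nil =>
          have hRQ : R = Q := hq2
          subst hRQ
          rw [List.append_nil] at hm
          subst hm
          refine Or.inr ⟨?_, Or.inr ⟨rfl, l₁, d, l₂, hl, hd, rfl⟩⟩
          rw [← hd]
          exact List.mem_map_of_mem (by simp [hl])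
        | cons e m₂ =>
          have he : e.src = R := hq2.1
          have hde : d = e := List.inj_on_of_nodup_map hn (by simp [hl]) (by simp [hm])
            (hd.trans he.symm)
          subst hde
          rw [prefix_eq_of_nodup hnl hl hm]
          exact Or.inl rfl
    · rw [A.proj_smul, A.proj_smul] at hxy
      exact absurd (mem_verts_of_proj_eq hxy (hrep.mem_verts _)) hv'
  · rcases h.exists_split hy with ⟨m₁, m₂, R', hm, hq1, hq2, rfl⟩ |
      ⟨m₁, e, m₂, y', hm, hy', hv', rfl⟩
    · rw [A.proj_smul, A.proj_smul] at hxy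
      exact absurd (mem_verts_of_proj_eq hxy.symm (hrep.mem_verts _)) hv
    · rw [A.proj_smul, A.proj_smul] at hxy
      rcases interior_eq_of_proj_eq hrep hx' hy' hv hxy with ⟨rfl, rfl⟩ | rfl
      · rw [prefix_eq_of_nodup hnl hl hm]
        exact Or.inl rfl
      · exact absurd (by simp [hm] : d.rev ∈ l) (hrev d (by simp [hl]))

theorem IsGeodesicPath.injOn_proj (hrep : A.IsTransversal rep) {P Q : ι} {l : List (Dart rep)}
    (h : IsGeodesicPath rep P Q l) (hn : (l.map Dart.src).Nodup) (hQ : Q ∉ l.map Dart.src)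
    (hrev : ∀ d ∈ l, d.rev ∉ l) : Set.InjOn A.proj (geodSeg (rep P) (label l • rep Q)) := by
  intro x hx y hy hxy
  rcases h.eq_of_proj_eq hrep hn hrev hx hy hxy with h | h
  · exact h
  · exact absurd h.1 hQ

theorem IsGeodesicPath.isSimpleLoop (hrep : A.IsTransversal rep) {P : ι} {l : List (Dart rep)}
    (h : IsGeodesicPath rep P P l) (hl : l ≠ []) (hn : (l.map Dart.src).Nodup)
    (hrev : ∀ d ∈ l, d.rev ∉ l) : A.IsSimpleLoop (rep P) (label l) := by
  refine ⟨?_, fun x hx y hy hxy => ?_⟩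
  · intro h1
    have := h.2
    rw [h1, one_smul, dist_self] at this
    exact (pathLen_pos hl).ne this
  · have first : ∀ l₁ d l₂, l = l₁ ++ d :: l₂ → d.src = P → l₁ = [] := by
      intro l₁ d l₂ hl' hd
      cases l with
      | nil => exact absurd rfl hl
      | cons e l =>
        have he : e.src = P := h.1.1
        have hde : d = e := List.inj_on_of_nodup_map hn (by rw [hl']; simp) (by simp)
          (hd.trans he.symm)
        subst hde
        exact prefix_eq_of_nodup (hn.of_map _) hl' (m₁ := []) rfl
    rcases h.eq_of_proj_eq hrep hn hrev hx hy hxy with h' |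
      ⟨-, ⟨h1, l₁, d, l₂, h2, h3, h4⟩ | ⟨h1, l₁, d, l₂, h2, h3, h4⟩⟩
    · exact Or.inl h'
    · rw [first l₁ d l₂ h2 h3, label_nil, one_smul] at h4
      exact Or.inr (Or.inr ⟨h1, h4⟩)
    · rw [first l₁ d l₂ h2 h3, label_nil, one_smul] at h4
      exact Or.inr (Or.inl ⟨h4, h1⟩)

/-- A common point of the traces of two paths is a common vertex, or the paths have a common
edge. -/
theorem IsGeodesicPath.trace_inter (hrep : A.IsTransversal rep) {P Q P' Q' : ι}
    {l m : List (Dart rep)} (h : IsGeodesicPath rep P Q l) (h' : IsGeodesicPath rep P' Q' m)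
    {q : A.Graph} (hq : q ∈ A.trace (rep P) (label l • rep Q))
    (hq' : q ∈ A.trace (rep P') (label m • rep Q')) :
    (∃ R, (R ∈ l.map Dart.src ∨ R = Q) ∧ (R ∈ m.map Dart.src ∨ R = Q') ∧ q = A.proj (rep R)) ∨
      ∃ d ∈ l, d ∈ m ∨ d.rev ∈ m := by
  have vertex : ∀ {P Q R : ι} {l l₁ l₂ : List (Dart rep)}, l = l₁ ++ l₂ →
      (dartGraph rep).IsPath R Q l₂ → R ∈ l.map Dart.src ∨ R = Q := by
    intro P Q R l l₁ l₂ hl hp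
    cases l₂ with
    | nil => exact Or.inr hp
    | cons d l₂ =>
      have hd : d.src = R := hp.1
      left
      rw [← hd]
      exact List.mem_map_of_mem (by simp [hl])
  obtain ⟨x, hx, rfl⟩ := hq
  obtain ⟨y, hy, hxy⟩ := hq'
  rcases h.exists_split hx with ⟨l₁, l₂, R, hl, -, hp2, rfl⟩ | ⟨l₁, d, l₂, x', hl, hx', hv, rfl⟩
  · rcases h'.exists_split hy with ⟨m₁, m₂, R', hm, -, hq2, rfl⟩ |
      ⟨m₁, e, m₂, y', hm, hy', hv', rfl⟩
    · rw [proj_smul_rep, proj_smul_rep] at hxy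
      have hR := hrep.eq_of_proj hxy
      subst hR
      exact Or.inl ⟨R', vertex (P := P) hl hp2, vertex (P := P) hm hq2, proj_smul_rep⟩
    · rw [A.proj_smul, A.proj_smul] at hxy
      exact absurd (mem_verts_of_proj_eq hxy.symm (hrep.mem_verts _)) hv'
  · rcases h'.exists_split hy with ⟨m₁, m₂, R', hm, hq1, hq2, rfl⟩ |
      ⟨m₁, e, m₂, y', hm, hy', hv', rfl⟩
    · rw [A.proj_smul, A.proj_smul] at hxy
      exact absurd (mem_verts_of_proj_eq hxy (hrep.mem_verts _)) hv
    · rw [A.proj_smul, A.proj_smul] at hxy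
      right
      refine ⟨d, by simp [hl], ?_⟩
      rcases interior_eq_of_proj_eq hrep hx' hy' hv hxy.symm with ⟨rfl, -⟩ | rfl
      · exact Or.inl (by simp [hm])
      · exact Or.inr (by simp [hm])

end MarkedMetricGraph

end OuterSpace

/-! ### Gates of maximally stretched edges; images of legal paths. -/

namespace OuterSpace

universe u v

open MarkedMetricGraph TurnGraph

variable {n : ℕ} {A : MarkedMetricGraph.{u} n} {B : MarkedMetricGraph.{v} n}
  {ι : Type*} {rep : ι → A.Tree}

namespace PLMap

variable (f : PLMap A B)

variable (rep) in
/-- The maximally stretched oriented edges. -/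
abbrev MaxDart : Type _ := {d : Dart rep // f.IsMaxEdge (rep d.src) d.head}

/-- Two maximally stretched oriented edges are in the same gate if they have the same initial
vertex and their images have a common nondegenerate initial segment. -/
def SameGate (d e : f.MaxDart rep) : Prop :=
  d.1.src = e.1.src ∧ ∃ z, z ≠ f.toFun (rep d.1.src) ∧
    z ∈ geodSeg (f.toFun (rep d.1.src)) (f.toFun d.1.head) ∧
    z ∈ geodSeg (f.toFun (rep e.1.src)) (f.toFun e.1.head)

variable (rep) in
/-- The gates of maximally stretched oriented edges. -/
def gateSetoid : Setoid (f.MaxDart rep) where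
  r := f.SameGate
  iseqv := by
    refine ⟨fun d => ⟨rfl, _, d.2.ne.symm, right_mem_geodSeg _ _, right_mem_geodSeg _ _⟩, ?_, ?_⟩
    · rintro d e ⟨h, z, hz, h1, h2⟩
      exact ⟨h.symm, z, by rwa [← h], h2, h1⟩
    · rintro d e c ⟨h, z, hz, h1, h2⟩ ⟨h', z', hz', h1', h2'⟩
      refine ⟨h.trans h', ?_⟩
      -- Both common segments are initial segments of the image of `e`, so the shorter one is
      -- contained in the longer and is common to all three images.
      rcases le_total (dist (f.toFun (rep e.1.src)) z) (dist (f.toFun (rep e.1.src)) z') with hle | hle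
      · refine ⟨z, hz, h1, ?_⟩
        have := B.isRTree.mem_geodSeg_of_le h2 h1' hle
        rw [h'] at this
        exact mem_geodSeg_of_left h2' this
      · refine ⟨z', by rwa [h], ?_, h2'⟩
        have := B.isRTree.mem_geodSeg_of_le h1' h2 hle
        rw [← h] at this
        exact mem_geodSeg_of_left h1 this

variable (rep) in
/-- The graph of maximally stretched edges with its gates. -/
def turnGraph : TurnGraph ι (f.MaxDart rep) (Quotient (f.gateSetoid rep)) where
  src d := d.1.src
  tgt d := d.1.tgt
  rev d := ⟨d.1.rev, by
    have := (d.2.smul d.1.lab⁻¹).symm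
    simpa [Dart.head, Dart.rev] using this⟩
  gate d := Quotient.mk _ d
  rev_src _ := rfl
  rev_tgt _ := rfl
  rev_rev d := Subtype.ext d.1.rev_rev

variable {f}

theorem turnGraph_rev_ne (d : f.MaxDart rep) : (f.turnGraph rep).rev d ≠ d :=
  fun h => d.1.rev_ne (congrArg Subtype.val h)

/-- The image of a path which makes a legal turn is a geodesic. -/
theorem mem_geodSeg_of_legal {d e : f.MaxDart rep} (h : (f.turnGraph rep).Legal d e) :
    d.1.tgt = e.1.src ∧
      f.toFun d.1.head ∈ geodSeg (f.toFun (rep d.1.src)) (d.1.lab • f.toFun e.1.head) := by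
  obtain ⟨h1, h2⟩ := h
  have h1 : d.1.tgt = e.1.src := h1
  refine ⟨h1, ?_⟩
  have key : f.toFun (rep d.1.tgt) ∈ geodSeg (f.toFun d.1.rev.head) (f.toFun e.1.head) := by
    refine B.isRTree.mem_geodSeg_of_inter fun m hm hm' => ?_
    by_contra hne
    refine h2 (Quotient.sound (s := f.gateSetoid rep) ⟨h1, m, hne, hm, ?_⟩)
    rwa [← h1]
  have := B.smul_mem_geodSeg d.1.lab key
  rw [Dart.rev_head, f.map_smul, smul_inv_smul] at this
  have e1 : f.toFun d.1.head = d.1.lab • f.toFun (rep d.1.tgt) := f.map_smul _ _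
  rwa [e1]

/-- If `d` had no legal continuation, all maximally stretched edges at its end would lie in the gate
of its reverse. Gates compare edges in pairs only, whereas optimality excludes a segment common to
all edges; finiteness bridges the gap. -/
theorem IsOptimal.exists_legal (hf : f.IsOptimal) (hrep : A.IsTransversal rep)
    (d : f.MaxDart rep) : ∃ e, (f.turnGraph rep).Legal d e := by
  by_contra hcon
  push Not at hcon
  set d' : f.MaxDart rep := (f.turnGraph rep).rev d with hd'
  have hsame : ∀ e : f.MaxDart rep, e.1.src = d.1.tgt → ∃ z, z ≠ f.toFun (rep d.1.tgt) ∧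
      z ∈ geodSeg (f.toFun (rep d.1.tgt)) (f.toFun d'.1.head) ∧
      z ∈ geodSeg (f.toFun (rep d.1.tgt)) (f.toFun e.1.head) := by
    intro e he
    by_contra h2
    refine hcon e ⟨he.symm, fun h => h2 ?_⟩
    obtain ⟨-, z, h3, h4, h5⟩ := Quotient.exact (s := f.gateSetoid rep) h
    rw [he] at h5
    exact ⟨z, h3, h4, h5⟩
  choose! z hz using hsame
  have := Dart.finite hrep
  -- All the points `z e` lie on the image of `d'`, so the one nearest to the image of the vertex
  -- spans a segment contained in all the images.
  obtain ⟨e, he, hmin⟩ := (Set.toFinite {e : f.MaxDart rep | e.1.src = d.1.tgt}).exists_minimalFor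
    (fun e => dist (f.toFun (rep d.1.tgt)) (z e)) _ ⟨d', rfl⟩
  refine hf ⟨rep d.1.tgt, ⟨_, d'.2⟩, z e, (hz e he).1, fun y hy => ?_⟩
  obtain ⟨c, hc, hcy⟩ := hrep.exists_dart hy.1
  let c' : f.MaxDart rep := ⟨c, by rw [hc, hcy]; exact hy⟩
  have hc' : c'.1.src = d.1.tgt := hc
  have h1 := (hz e he).2.1
  have h2 := (hz c' hc').2
  have hle : dist (f.toFun (rep d.1.tgt)) (z e) ≤ dist (f.toFun (rep d.1.tgt)) (z c') := by
    rcases le_total (dist (f.toFun (rep d.1.tgt)) (z e)) (dist (f.toFun (rep d.1.tgt)) (z c'))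
      with h | h
    · exact h
    · exact hmin hc' h
  have h3 := B.isRTree.mem_geodSeg_of_le h1 h2.1 hle
  have h5 := mem_geodSeg_of_left h2.2 h3
  change z e ∈ geodSeg (f.toFun (rep d.1.tgt)) (f.toFun c.head) at h5
  rwa [hcy] at h5

/-- The underlying list of oriented edges. -/
def toDarts (l : List (f.MaxDart rep)) : List (Dart rep) := l.map Subtype.val

theorem map_src_toDarts (l : List (f.MaxDart rep)) :
    (toDarts l).map Dart.src = l.map (f.turnGraph rep).src := by
  simp [toDarts, turnGraph]

theorem toDarts_revPath (l : List (f.MaxDart rep)) :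
    toDarts ((f.turnGraph rep).revPath l) = (dartGraph rep).revPath (toDarts l) := by
  simp [toDarts, revPath, turnGraph, dartGraph]

theorem isPath_toDarts {P Q : ι} {l : List (f.MaxDart rep)} (h : (f.turnGraph rep).IsPath P Q l) :
    (dartGraph rep).IsPath P Q (toDarts l) := by
  induction l generalizing P with
  | nil => exact h
  | cons d l ih => exact ⟨h.1, ih h.2⟩

/-- The image of a legal path is a geodesic. -/
theorem dist_image_of_legal {P Q : ι} {l : List (f.MaxDart rep)}
    (h : List.IsChain (f.turnGraph rep).Legal l) (hp : (f.turnGraph rep).IsPath P Q l) :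
    dist (f.toFun (rep P)) (f.toFun (label (toDarts l) • rep Q)) =
      f.stretch * pathLen (toDarts l) ∧
    ∀ d ∈ l.head?, f.toFun d.1.head ∈
      geodSeg (f.toFun (rep P)) (f.toFun (label (toDarts l) • rep Q)) := by
  induction l generalizing P with
  | nil =>
    have hPQ : P = Q := hp
    subst hPQ
    simp [toDarts]
  | cons d l ih =>
    have hd : d.1.src = P := hp.1
    subst hd
    have hdist : dist (f.toFun (rep d.1.src)) (f.toFun d.1.head) =
        f.stretch * dist (rep d.1.src) d.1.head := by
      rw [f.dist_eq_speed_mul_of_isEdge d.2.1, d.2.2]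
    cases l with
    | nil =>
      have hQ : d.1.tgt = Q := hp.2
      subst hQ
      simp only [toDarts, List.map_cons, List.map_nil, label_cons, label_nil, mul_one, pathLen_cons,
        pathLen_nil, add_zero, List.head?_cons, Option.mem_some_iff]
      refine ⟨hdist, ?_⟩
      rintro _ rfl
      exact right_mem_geodSeg _ _
    | cons e l =>
      rw [List.isChain_cons_cons] at h
      obtain ⟨h1, h2⟩ := ih h.2 hp.2
      obtain ⟨h3, h4⟩ := mem_geodSeg_of_legal h.1
      have h5 := B.smul_mem_geodSeg d.1.lab (h2 e rfl)
      change d.1.lab • f.toFun e.1.head ∈ geodSeg (d.1.lab • f.toFun (rep d.1.tgt)) _ at h5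
      change dist (f.toFun (rep d.1.tgt)) _ = _ at h1
      have hhead : f.toFun d.1.head = d.1.lab • f.toFun (rep d.1.tgt) := by
        rw [← f.map_smul]
        rfl
      have hlab : f.toFun (label (toDarts (d :: e :: l)) • rep Q) =
          d.1.lab • f.toFun (label (toDarts (e :: l)) • rep Q) := by
        rw [← f.map_smul, ← mul_smul]
        simp [toDarts]
      have hne : f.toFun d.1.head ≠ d.1.lab • f.toFun e.1.head := by
        rw [hhead, h3]
        exact fun h => e.2.ne (smul_left_cancel _ h)
      rw [← hhead] at h5
      -- The image of the first two edges and the image of the tail are geodesics that overlap in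
      -- the nondegenerate image of `e`, so they combine to a geodesic. The second conjunct of the
      -- statement is carried along to provide this overlap.
      have h6 := B.isRTree.mem_of_overlap h4 h5 hne
      rw [← hlab] at h6
      constructor
      · rw [← mem_geodSeg.1 h6, hdist, hlab, hhead, B.dist_smul, h1]
        simp [toDarts]
        ring
      · simp only [List.head?_cons, Option.mem_some_iff]
        rintro _ rfl
        exact h6

/-- The image has distance `S_f` times the length of the path between its ends, and `f` stretches
distances at most by `S_f > 0`, so the path cannot be shortened in `A` either. -/
theorem isGeodesicPath_of_legal {P Q : ι} {l : List (f.MaxDart rep)}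
    (h : List.IsChain (f.turnGraph rep).Legal l) (hp : (f.turnGraph rep).IsPath P Q l) :
    IsGeodesicPath rep P Q (toDarts l) := by
  have hp' := isPath_toDarts hp
  refine ⟨hp', le_antisymm (dist_le_pathLen hp') ?_⟩
  have h1 := (dist_image_of_legal h hp).1
  have h2 := f.dist_le_stretch_mul (rep P) (label (toDarts l) • rep Q)
  rw [h1] at h2
  exact le_of_mul_le_mul_left h2 f.stretch_pos

/-- The word of a closed legal path is stretched by the maximal factor. -/
theorem len_of_legal {P : ι} {l : List (f.MaxDart rep)} (hl : l ≠ [])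
    (h : List.IsChain (f.turnGraph rep).Legal (l ++ l)) (hp : (f.turnGraph rep).IsPath P P l) :
    A.len (label (toDarts l)) = pathLen (toDarts l) ∧
      B.len (label (toDarts l)) = f.stretch * pathLen (toDarts l) := by
  -- Legality of `l ++ l` includes the turn at the base point, which makes all concatenated powers
  -- of `l` legal.
  have hpow : ∀ m : ℕ, List.IsChain (f.turnGraph rep).Legal (List.replicate m l).flatten ∧
      (f.turnGraph rep).IsPath P P (List.replicate m l).flatten ∧
      label (toDarts (List.replicate m l).flatten) = label (toDarts l) ^ m ∧
      pathLen (toDarts (List.replicate m l).flatten) = m * pathLen (toDarts l) := by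
    intro m
    induction m with
    | zero => simp [IsPath, toDarts]
    | succ m ih =>
      obtain ⟨h1, h2, h3, h4⟩ := ih
      rw [List.replicate_succ, List.flatten_cons]
      refine ⟨?_, isPath_append.2 ⟨P, hp, h2⟩, ?_, ?_⟩
      · rw [List.isChain_append]
        rw [List.isChain_append] at h
        refine ⟨h.1, h1, fun x hx y hy => h.2.2 x hx y ?_⟩
        cases m with
        | zero => simp at hy
        | succ m =>
          rw [List.replicate_succ, List.flatten_cons, List.head?_append_of_ne_nil _ hl] at hy
          exact hy
      · rw [toDarts, List.map_append, label_append]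
        change label (toDarts l) * label (toDarts _) = _
        rw [h3, pow_succ']
      · rw [toDarts, List.map_append, pathLen_append]
        change pathLen (toDarts l) + pathLen (toDarts _) = _
        rw [h4]
        push_cast
        ring
  have hB : f.stretch * pathLen (toDarts l) ≤ B.len (label (toDarts l)) := by
    refine B.le_len_of_le_dist_pow (f.toFun (rep P)) fun m => ?_
    obtain ⟨h1, h2, h3, h4⟩ := hpow m
    have := (dist_image_of_legal h1 h2).1
    rw [h3, h4, f.map_smul] at this
    rw [this]
    apply le_of_eq
    ring
  have hA : A.len (label (toDarts l)) ≤ pathLen (toDarts l) :=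
    (A.len_le_dist _ (rep P)).trans (dist_le_pathLen (isPath_toDarts hp))
  -- The inequalities `S_f * pathLen ≤ l_B ≤ S_f * l_A ≤ S_f * pathLen` are forced to be equalities.
  have hAB := f.len_le (label (toDarts l))
  have hA' : pathLen (toDarts l) ≤ A.len (label (toDarts l)) :=
    le_of_mul_le_mul_left (hB.trans hAB) f.stretch_pos
  have hA'' := le_antisymm hA hA'
  exact ⟨hA'', le_antisymm (by rwa [hA''] at hAB) hB⟩

end PLMap

namespace MarkedMetricGraph

theorem left_mem_trace (x y : A.Tree) : A.proj x ∈ A.trace x y := ⟨x, left_mem_geodSeg _ _, rfl⟩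

theorem right_mem_trace (x y : A.Tree) : A.proj y ∈ A.trace x y := ⟨y, right_mem_geodSeg _ _, rfl⟩

theorem trace_smul (g : FreeGroup (Fin n)) (x y : A.Tree) :
    A.trace (g • x) (g • y) = A.trace x y := by
  ext q
  constructor
  · rintro ⟨z, hz, rfl⟩
    refine ⟨g⁻¹ • z, ?_, A.proj_smul _ _⟩
    rwa [← A.smul_mem_geodSeg_iff g, smul_inv_smul]
  · rintro ⟨z, hz, rfl⟩
    exact ⟨g • z, A.smul_mem_geodSeg g hz, A.proj_smul _ _⟩

theorem IsSimpleLoop.smul {p : A.Tree} {w : FreeGroup (Fin n)} (h : A.IsSimpleLoop p w)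
    (g : FreeGroup (Fin n)) : A.IsSimpleLoop (g • p) (g * w * g⁻¹) := by
  refine ⟨fun h1 => h.1 ?_, ?_⟩
  · rwa [conj_eq_one_iff] at h1
  · have e : (g * w * g⁻¹) • g • p = g • w • p := by simp [mul_smul]
    rw [e]
    intro x hx y hy hxy
    have hx' : g⁻¹ • x ∈ geodSeg p (w • p) := by rwa [← A.smul_mem_geodSeg_iff g, smul_inv_smul]
    have hy' : g⁻¹ • y ∈ geodSeg p (w • p) := by rwa [← A.smul_mem_geodSeg_iff g, smul_inv_smul]
    have := h.2 _ hx' _ hy' (by rwa [A.proj_smul, A.proj_smul])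
    simpa only [inv_smul_eq_iff, smul_inv_smul] using this

end MarkedMetricGraph

end OuterSpace

/-! ### Legal configurations give candidate loops. -/

namespace OuterSpace

universe u v

open MarkedMetricGraph TurnGraph

variable {n : ℕ} {A : MarkedMetricGraph.{u} n} {B : MarkedMetricGraph.{v} n}
  {ι : Type*} {rep : ι → A.Tree}

namespace PLMap

variable {f : PLMap A B}

theorem rev_notMem_toDarts {l : List (f.MaxDart rep)}
    (h : List.IsChain (f.turnGraph rep).Legal l) (hn : (l.map (f.turnGraph rep).src).Nodup) :
    ∀ d ∈ toDarts l, d.rev ∉ toDarts l := by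
  have := rev_notMem turnGraph_rev_ne h hn
  intro d hd hd'
  obtain ⟨e, he, rfl⟩ := List.mem_map.1 hd
  obtain ⟨e', he', hee'⟩ := List.mem_map.1 hd'
  have : e' = (f.turnGraph rep).rev e := Subtype.ext hee'
  subst this
  exact rev_notMem turnGraph_rev_ne h hn e he he'

theorem isSimpleLoop_of_legal (hrep : A.IsTransversal rep) {P : ι} {l : List (f.MaxDart rep)}
    (h : List.IsChain (f.turnGraph rep).Legal l) (hl : (f.turnGraph rep).IsSimpleClosed P l) :
    A.IsSimpleLoop (rep P) (label (toDarts l)) :=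
  (isGeodesicPath_of_legal h hl.isPath).isSimpleLoop hrep (fun h0 => hl.ne_nil (List.map_eq_nil_iff.1 h0))
    (by rw [map_src_toDarts]; exact hl.nodup) (rev_notMem_toDarts h hl.nodup)

theorem trace_inter_of_legal (hrep : A.IsTransversal rep) {P Q P' Q' : ι}
    {l m : List (f.MaxDart rep)} (hl : List.IsChain (f.turnGraph rep).Legal l)
    (hlp : (f.turnGraph rep).IsPath P Q l) (hm : List.IsChain (f.turnGraph rep).Legal m)
    (hmp : (f.turnGraph rep).IsPath P' Q' m) {q : A.Graph}
    (hq : q ∈ A.trace (rep P) (label (toDarts l) • rep Q))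
    (hq' : q ∈ A.trace (rep P') (label (toDarts m) • rep Q')) :
    (∃ R, (R ∈ l.map (f.turnGraph rep).src ∨ R = Q) ∧
      (R ∈ m.map (f.turnGraph rep).src ∨ R = Q') ∧ q = A.proj (rep R)) ∨
      ∃ d ∈ l, d ∈ m ∨ (f.turnGraph rep).rev d ∈ m := by
  rcases (isGeodesicPath_of_legal hl hlp).trace_inter hrep (isGeodesicPath_of_legal hm hmp) hq hq'
    with h | ⟨d, hd, hd'⟩
  · rw [map_src_toDarts, map_src_toDarts] at h
    exact Or.inl h
  · right
    obtain ⟨d, hdl, rfl⟩ := List.mem_map.1 hd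
    refine ⟨d, hdl, ?_⟩
    rcases hd' with hd' | hd'
    · obtain ⟨e, he, hee⟩ := List.mem_map.1 hd'
      rw [Subtype.ext hee] at he
      exact Or.inl he
    · obtain ⟨e, he, hee⟩ := List.mem_map.1 hd'
      have : e = (f.turnGraph rep).rev d := Subtype.ext hee
      exact Or.inr (this ▸ he)

theorem mem_src_of_closed {P : ι} {l : List (f.MaxDart rep)}
    (hl : (f.turnGraph rep).IsSimpleClosed P l) : P ∈ l.map (f.turnGraph rep).src := by
  cases l with
  | nil => exact absurd rfl hl.ne_nil
  | cons d l =>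
    rw [List.map_cons, hl.isPath.1]
    simp

theorem isFigureEight_of_legal (hrep : A.IsTransversal rep) {P : ι}
    {l₁ l₂ : List (f.MaxDart rep)} (h₁ : (f.turnGraph rep).IsSimpleClosed P l₁)
    (h₂ : (f.turnGraph rep).IsSimpleClosed P l₂)
    (hv : ∀ v ∈ l₁.map (f.turnGraph rep).src, v ∈ l₂.map (f.turnGraph rep).src → v = P)
    (hd : ∀ d ∈ l₁, d ∉ l₂ ∧ (f.turnGraph rep).rev d ∉ l₂)
    (hc₁ : List.IsChain (f.turnGraph rep).Legal l₁)
    (hc₂ : List.IsChain (f.turnGraph rep).Legal l₂) :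
    A.IsFigureEight (label (toDarts (l₁ ++ l₂))) := by
  refine ⟨rep P, label (toDarts l₁), label (toDarts l₂), by simp [toDarts],
    isSimpleLoop_of_legal hrep hc₁ h₁, isSimpleLoop_of_legal hrep hc₂ h₂, ?_⟩
  ext q
  constructor
  · rintro ⟨hq1, hq2⟩
    rcases trace_inter_of_legal hrep hc₁ h₁.isPath hc₂ h₂.isPath hq1 hq2 with
      ⟨R, hR1, hR2, rfl⟩ | ⟨d, hd1, hd2⟩
    · have hR : R = P := by
        rcases hR1 with h | h
        · rcases hR2 with h' | h'
          · exact hv R h h'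
          · exact h'
        · exact h
      rw [hR]
      rfl
    · have := hd d hd1
      tauto
  · rintro rfl
    exact ⟨left_mem_trace _ _, left_mem_trace _ _⟩

/-- The second circle is based at the far end of the lift of `l₃`, which conjugates its deck
transformation by the label of `l₃`; this conjugation accounts for running back along `l₃`. A common
point of two of the paths is a common vertex or lies on a common edge, and the vertex conditions
exclude common edges. -/
theorem isBarbell_of_legal (hrep : A.IsTransversal rep) {P Q : ι}
    {l₁ l₃ l₂ : List (f.MaxDart rep)} (h₁ : (f.turnGraph rep).IsSimpleClosed P l₁)
    (h₂ : (f.turnGraph rep).IsSimpleClosed Q l₂) (h₃ : (f.turnGraph rep).IsPath P Q l₃)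
    (hn : (l₃.map (f.turnGraph rep).src).Nodup)
    (h31 : ∀ v ∈ l₃.map (f.turnGraph rep).src, v ∈ l₁.map (f.turnGraph rep).src → v = P)
    (h32 : ∀ v ∈ l₃.map (f.turnGraph rep).src, v ∉ l₂.map (f.turnGraph rep).src)
    (h12 : ∀ v ∈ l₁.map (f.turnGraph rep).src, v ∉ l₂.map (f.turnGraph rep).src)
    (hc₁ : List.IsChain (f.turnGraph rep).Legal l₁)
    (hc₂ : List.IsChain (f.turnGraph rep).Legal l₂)
    (hc₃ : List.IsChain (f.turnGraph rep).Legal l₃) :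
    A.IsBarbell (label (toDarts (l₁ ++ l₃ ++ l₂ ++ (f.turnGraph rep).revPath l₃))) := by
  have hP := mem_src_of_closed h₁
  have hQ := mem_src_of_closed h₂
  have hQ3 : Q ∉ l₃.map (f.turnGraph rep).src := fun h => h32 Q h hQ
  have hn' : (l₃.map (f.turnGraph rep).src ++ [Q]).Nodup := by
    rw [List.nodup_append]
    refine ⟨hn, by simp, fun a ha b hb => ?_⟩
    rintro rfl
    rw [List.mem_singleton.1 hb] at ha
    exact hQ3 ha
  have hw2 : (label (toDarts l₃) * label (toDarts l₂) * (label (toDarts l₃))⁻¹) •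
      label (toDarts l₃) • rep Q = label (toDarts l₃) • label (toDarts l₂) • rep Q := by
    simp [mul_smul]
  refine ⟨rep P, label (toDarts l₃) • rep Q, label (toDarts l₁),
    label (toDarts l₃) * label (toDarts l₂) * (label (toDarts l₃))⁻¹, ?_,
    isSimpleLoop_of_legal hrep hc₁ h₁, (isSimpleLoop_of_legal hrep hc₂ h₂).smul _, ?_, ?_, ?_, ?_⟩
  · rw [toDarts, List.map_append, List.map_append, List.map_append, label_append, label_append,
      label_append]
    change _ * label (toDarts ((f.turnGraph rep).revPath l₃)) = _
    rw [toDarts_revPath, label_revPath]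
    simp only [toDarts, mul_assoc]
  · rw [hw2, trace_smul, Set.disjoint_left]
    intro q hq1 hq2
    rcases trace_inter_of_legal hrep hc₁ h₁.isPath hc₂ h₂.isPath hq1 hq2 with
      ⟨R, hR1, hR2, rfl⟩ | ⟨d, hd1, hd2⟩
    · have hR1' : R ∈ l₁.map (f.turnGraph rep).src := by
        rcases hR1 with h | rfl <;> assumption
      have hR2' : R ∈ l₂.map (f.turnGraph rep).src := by
        rcases hR2 with h | rfl <;> assumption
      exact h12 R hR1' hR2'
    · refine h12 _ (List.mem_map_of_mem hd1) ?_
      rcases hd2 with hd2 | hd2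
      · exact List.mem_map_of_mem hd2
      · exact h₂.tgt_mem hd2
  · exact (isGeodesicPath_of_legal hc₃ h₃).injOn_proj hrep (by rwa [map_src_toDarts])
      (by rwa [map_src_toDarts]) (rev_notMem_toDarts hc₃ hn)
  · ext q
    constructor
    · rintro ⟨hq1, hq2⟩
      rcases trace_inter_of_legal hrep hc₃ h₃ hc₁ h₁.isPath hq1 hq2 with
        ⟨R, hR1, hR2, rfl⟩ | ⟨d, hd1, hd2⟩
      · have hR2' : R ∈ l₁.map (f.turnGraph rep).src := by
          rcases hR2 with h | rfl <;> assumption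
        rcases hR1 with hR1 | rfl
        · rw [h31 R hR1 hR2']
          rfl
        · exact absurd hQ (h12 _ hR2')
      -- An edge shared by `l₃` and `l₁` has both endpoints on `l₁`. Its initial vertex is `P`; its
      -- terminal vertex is either `P` as well, although `l₃` repeats no vertex, or `Q`, which is
      -- not on `l₁`.
      · exfalso
        have hs : (f.turnGraph rep).src d ∈ l₁.map (f.turnGraph rep).src := by
          rcases hd2 with hd2 | hd2
          · exact List.mem_map_of_mem hd2
          · exact h₁.tgt_mem hd2
        have ht : (f.turnGraph rep).tgt d ∈ l₁.map (f.turnGraph rep).src := by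
          rcases hd2 with hd2 | hd2
          · exact h₁.tgt_mem hd2
          · exact List.mem_map_of_mem hd2
        have hsP := h31 _ (List.mem_map_of_mem hd1) hs
        rcases h₃.tgt_mem hd1 with h | h
        · exact h₃.src_ne_tgt hn' hd1 (hsP.trans (h31 _ h ht).symm)
        · rw [h] at ht
          exact h12 _ ht hQ
    · rintro rfl
      exact ⟨left_mem_trace _ _, left_mem_trace _ _⟩
  · rw [hw2, trace_smul]
    ext q
    constructor
    · rintro ⟨hq1, hq2⟩
      rcases trace_inter_of_legal hrep hc₃ h₃ hc₂ h₂.isPath hq1 hq2 with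
        ⟨R, hR1, hR2, rfl⟩ | ⟨d, hd1, hd2⟩
      · have hR2' : R ∈ l₂.map (f.turnGraph rep).src := by
          rcases hR2 with h | rfl <;> assumption
        rcases hR1 with hR1 | rfl
        · exact absurd hR2' (h32 R hR1)
        · exact (A.proj_smul _ _).symm
      · refine absurd ?_ (h32 _ (List.mem_map_of_mem hd1))
        rcases hd2 with hd2 | hd2
        · exact List.mem_map_of_mem hd2
        · exact h₂.tgt_mem hd2
    · rintro rfl
      refine ⟨right_mem_trace _ _, ?_⟩
      rw [A.proj_smul]
      exact left_mem_trace _ _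

/-- For an optimal map, a candidate loop of bounded combinatorial length is stretched by the
maximal factor. -/
theorem IsOptimal.exists_candidate (hf : f.IsOptimal) (hrep : A.IsTransversal rep) :
    ∃ l : List (Dart rep), l.length ≤ 4 * Nat.card ι ∧ (Subsingleton ι → l.length ≤ 2) ∧
      label l ≠ 1 ∧ A.IsCandidate (label l) ∧ 0 < pathLen l ∧ A.len (label l) = pathLen l ∧
      B.len (label l) = f.stretch * pathLen l := by
  have hfin := hrep.finite
  have := Fintype.ofFinite ι
  have hne : Nonempty (f.MaxDart rep) := by
    obtain ⟨a, b, hab⟩ := f.exists_isMaxEdge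
    obtain ⟨g, d, rfl, rfl⟩ := hrep.exists_dart' hab.1
    exact ⟨d, by simpa using hab.smul g⁻¹⟩
  have key : ∀ {P : ι} {l : List (f.MaxDart rep)}, l ≠ [] →
      List.IsChain (f.turnGraph rep).Legal (l ++ l) → (f.turnGraph rep).IsPath P P l →
      A.IsCandidate (label (toDarts l)) → l.length ≤ 4 * Nat.card ι →
      (Subsingleton ι → l.length ≤ 2) → ∃ l : List (Dart rep), l.length ≤ 4 * Nat.card ι ∧
        (Subsingleton ι → l.length ≤ 2) ∧ label l ≠ 1 ∧ A.IsCandidate (label l) ∧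
        0 < pathLen l ∧ A.len (label l) = pathLen l ∧
        B.len (label l) = f.stretch * pathLen l := by
    intro P l hl hc hp hcand hlen hlen'
    obtain ⟨h1, h2⟩ := len_of_legal hl hc hp
    have hpos : 0 < pathLen (toDarts l) := pathLen_pos fun h0 => hl (List.map_eq_nil_iff.1 h0)
    refine ⟨toDarts l, by simpa [toDarts] using hlen, by simpa [toDarts] using hlen', ?_, hcand,
      hpos, h1, h2⟩
    intro hw
    have h3 := A.len_le_dist (label (toDarts l)) (rep P)
    rw [h1, hw, one_smul, dist_self] at h3
    linarith
  have hlen : ∀ {l : List (f.MaxDart rep)}, (l.map (f.turnGraph rep).src).Nodup →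
      l.length ≤ Nat.card ι := by
    intro l hn
    rw [Nat.card_eq_fintype_card]
    simpa using hn.length_le_card
  have hsub : Subsingleton ι → Nat.card ι ≤ 1 := fun h => Finite.card_le_one_iff_subsingleton.2 h
  rcases exists_legal_candidate (hf.exists_legal hrep) with ⟨P, l, hl, hc⟩ |
    ⟨P, l₁, l₂, h1, h2, h3, h4, hc⟩ | ⟨P, Q, l₁, l₃, l₂, h1, h2, h3, h4, h5, h6, h7, h8, hc⟩
  · have hc' := (List.isChain_append.1 hc).1
    have := hlen hl.nodup
    refine key hl.ne_nil hc hl.isPath (Or.inl ⟨_, isSimpleLoop_of_legal hrep hc' hl⟩)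
      (by omega) fun h => ?_
    have := hsub h
    omega
  · have hc' := List.isChain_append.1 (List.isChain_append.1 hc).1
    have hl1 := hlen h1.nodup
    have hl2 := hlen h2.nodup
    refine key (by simp [h1.ne_nil]) hc (isPath_append.2 ⟨P, h1.isPath, h2.isPath⟩)
      (Or.inr (Or.inl (isFigureEight_of_legal hrep h1 h2 h3 h4 hc'.1 hc'.2.1)))
      (by rw [List.length_append]; omega) fun h => ?_
    have := hsub h
    rw [List.length_append]
    omega
  · have hc' := List.isChain_append.1 (List.isChain_append.1 hc).1
    have hc'' := List.isChain_append.1 hc'.1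
    have hc3 := List.isChain_append.1 hc''.1
    have hl1 := hlen h1.nodup
    have hl2 := hlen h2.nodup
    have hl3 := hlen h5
    refine key (by simp [h1.ne_nil]) hc (isPath_append.2 ⟨Q, isPath_append.2 ⟨Q, isPath_append.2
      ⟨P, h1.isPath, h4⟩, h2.isPath⟩, h4.revPath⟩)
      (Or.inr (Or.inr (isBarbell_of_legal hrep h1 h2 h4 h5 h6 h7 h8 hc3.1 hc''.2.1 hc3.2.1)))
      (by
        simp only [revPath, List.length_append, List.length_reverse, List.length_map]
        omega) fun h => ?_
    -- With a single vertex the two circles of a barbell cannot be disjoint.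
    exfalso
    have hP := mem_src_of_closed h1
    rw [Subsingleton.elim P Q] at hP
    exact h8 _ hP (mem_src_of_closed h2)

end PLMap

end OuterSpace

/-! ### Construction of PL-maps; cocompactness and local finiteness. -/

namespace OuterSpace

universe u v

open MarkedMetricGraph

variable {n : ℕ} {A : MarkedMetricGraph.{u} n} {B : MarkedMetricGraph.{v} n}
  {ι : Type*} {rep : ι → A.Tree}

namespace IsRTree

theorem exists_dist_eq_mul {T : Type*} [MetricSpace T] (hT : IsRTree T) (p q : T) {t : ℝ}
    (h0 : 0 ≤ t) (h1 : t ≤ 1) : ∃ z ∈ geodSeg p q, dist p z = t * dist p q :=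
  hT.exists_mem_dist_eq p q (mul_nonneg h0 dist_nonneg) (mul_le_of_le_one_left dist_nonneg h1)

end IsRTree

namespace MarkedMetricGraph

/-- Well defined because each vertex is `g • rep i` for a unique pair, by transversality and
freeness. The values off the vertices are irrelevant. -/
theorem exists_equivariant (hrep : A.IsTransversal rep) (p : ι → B.Tree) :
    ∃ φ : A.Tree → B.Tree, ∀ (g : FreeGroup (Fin n)) (i : ι), φ (g • rep i) = g • p i := by
  have : ∀ x : A.Tree, ∃ y : B.Tree, ∀ (g : FreeGroup (Fin n)) (i : ι), x = g • rep i →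
      y = g • p i := by
    intro x
    by_cases h : ∃ (g : FreeGroup (Fin n)) (i : ι), x = g • rep i
    · obtain ⟨g, i, rfl⟩ := h
      refine ⟨g • p i, fun k j hkj => ?_⟩
      have hi : i = j := by
        apply hrep.inj (g⁻¹ * k)
        rw [mul_smul, ← hkj, inv_smul_smul]
      subst hi
      rw [A.eq_of_smul_eq_smul hkj]
    · push Not at h
      exact ⟨B.nonempty.some, fun g i hx => absurd hx (h g i)⟩
  choose φ hφ using this
  exact ⟨φ, fun g i => hφ _ g i rfl⟩

/-- Every equivariant choice of the images of the vertices extends to a PL-map. -/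
theorem exists_plMap (hrep : A.IsTransversal rep) (p : ι → B.Tree) :
    ∃ f : PLMap A B, ∀ i, f.toFun (rep i) = p i := by
  obtain ⟨φ, hφ⟩ := exists_equivariant hrep p
  have hφg : ∀ (g : FreeGroup (Fin n)), ∀ x ∈ A.verts, φ (g • x) = g • φ x := by
    intro g x hx
    obtain ⟨k, i, rfl⟩ := hrep.exists_smul x hx
    rw [← mul_smul, hφ, hφ, mul_smul]
  -- The point `z` divides `[φ a, φ b]` in the ratio in which `x` divides `[a, b]`. This determines
  -- `z` and is invariant under reversing the edge, so the image of `x` does not depend on the edge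
  -- chosen to contain it.
  let Rel : A.Tree → A.Tree → A.Tree → B.Tree → Prop := fun a b x z =>
    z ∈ geodSeg (φ a) (φ b) ∧ dist (φ a) z = dist a x / dist a b * dist (φ a) (φ b)
  have huniq : ∀ a b x z z', Rel a b x z → Rel a b x z' → z = z' := fun a b x z z' h h' =>
    B.isRTree.eq_of_dist_eq h.1 h'.1 (h.2.trans h'.2.symm)
  have hleft : ∀ a b, Rel a b a (φ a) := fun a b => ⟨left_mem_geodSeg _ _, by simp⟩
  have hright : ∀ a b, A.IsEdge a b → Rel a b b (φ b) := fun a b h =>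
    ⟨right_mem_geodSeg _ _, by rw [div_self h.dist_pos.ne', one_mul]⟩
  have hswap : ∀ a b x z, A.IsEdge a b → x ∈ geodSeg a b → Rel a b x z → Rel b a x z := by
    intro a b x z h hx hz
    refine ⟨mem_geodSeg_symm hz.1, ?_⟩
    have h1 := mem_geodSeg.1 hz.1
    have h2 := mem_geodSeg.1 hx
    have h3 := h.dist_pos
    have h4 : dist b x / dist b a = 1 - dist a x / dist a b := by
      rw [dist_comm b x, dist_comm b a, ← h2]
      rw [← h2] at h3
      field_simp
      ring
    rw [h4, dist_comm (φ b) z, dist_comm (φ b) (φ a), sub_mul, ← hz.2]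
    linarith
  have hex : ∀ x, ∃ z, ∀ a b, A.IsEdge a b → x ∈ geodSeg a b → Rel a b x z := by
    intro x
    by_cases hx : x ∈ A.verts
    · refine ⟨φ x, fun a b hab hxab => ?_⟩
      rcases hab.2.2.2 x hx hxab with rfl | rfl
      · exact hleft _ _
      · exact hright _ _ hab
    · obtain ⟨a, b, hab, hxab⟩ := A.covered x
      have hd := IsEdge.dist_pos hab
      obtain ⟨z, hz, hz'⟩ := B.isRTree.exists_dist_eq_mul (φ a) (φ b) (t := dist a x / dist a b)
        (by positivity) ((div_le_one hd).2 (dist_left_le_of_mem hxab))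
      refine ⟨z, fun a' b' hab' hxab' => ?_⟩
      rcases A.edges_meet _ _ _ _ x hab hab' hxab hxab' hx with ⟨rfl, rfl⟩ | ⟨rfl, rfl⟩
      · exact ⟨hz, hz'⟩
      · exact hswap _ _ _ _ hab hxab ⟨hz, hz'⟩
  choose F hF using hex
  refine ⟨⟨F, fun g x => ?_, fun a b hab => ⟨dist (φ a) (φ b) / dist a b, fun x hx y hy => ?_⟩⟩,
    fun i => ?_⟩
  · obtain ⟨a, b, hab, hx⟩ := A.covered x
    have h1 := hF x a b hab hx
    have h2 := hF (g • x) (g • a) (g • b) (IsEdge.smul hab g) (A.smul_mem_geodSeg g hx)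
    refine huniq _ _ _ _ _ h2 ?_
    refine ⟨?_, ?_⟩
    · rw [hφg g a hab.1, hφg g b hab.2.1]
      exact B.smul_mem_geodSeg g h1.1
    · rw [hφg g a hab.1, hφg g b hab.2.1, B.dist_smul, B.dist_smul, A.dist_smul, A.dist_smul]
      exact h1.2
  · have h1 := hF x a b hab hx
    have h2 := hF y a b hab hy
    have hd := hab.dist_pos
    rw [B.isRTree.dist_eq_abs h1.1 h2.1, A.isRTree.dist_eq_abs hx hy, h1.2, h2.2, ← sub_mul,
      ← sub_div, div_mul_eq_mul_div, abs_div, abs_mul, abs_of_pos hd,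
      abs_of_nonneg (dist_nonneg (x := φ a) (y := φ b))]
    ring
  · obtain ⟨a, b, -, ha, -⟩ := A.valence _ (hrep.mem_verts i)
    have h1 := hF (rep i) (rep i) a ha (left_mem_geodSeg _ _)
    have h2 := huniq _ _ _ _ _ h1 (hleft _ _)
    change F (rep i) = p i
    rw [h2]
    simpa using hφ 1 i

/-- The edges have bounded length. -/
theorem exists_dist_le_of_isEdge (A : MarkedMetricGraph.{u} n) :
    ∃ l : ℝ, 0 ≤ l ∧ ∀ a b, A.IsEdge a b → dist a b ≤ l := by
  obtain ⟨S, hS, h⟩ := A.finite_edges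
  obtain ⟨l, hl⟩ := (hS.image fun p => dist p.1 p.2).bddAbove
  refine ⟨max l 0, le_max_right _ _, fun a b hab => ?_⟩
  obtain ⟨g, hg⟩ := h a b hab
  rw [← A.dist_smul g]
  exact (hl ⟨_, hg, rfl⟩).trans (le_max_left _ _)

/-- A ball is covered by finitely many edges, namely those starting at one of the finitely many
vertices in the ball enlarged by the maximal edge length. -/
theorem isCompact_closedBall (A : MarkedMetricGraph.{u} n) {o : A.Tree} (ho : o ∈ A.verts)
    (R : ℝ) : IsCompact (Metric.closedBall o R) := by
  obtain ⟨l, -, hl⟩ := A.exists_dist_le_of_isEdge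
  have hK : IsCompact (⋃ a ∈ {y | y ∈ A.verts ∧ dist o y ≤ R + l}, ⋃ b ∈ {b | A.IsEdge a b},
      geodSeg a b) :=
    (A.finite_verts_closedBall ho (R + l)).isCompact_biUnion fun a _ =>
      (A.finite_neighbours a).isCompact_biUnion fun b _ => A.isRTree.isCompact_geodSeg a b
  refine hK.of_isClosed_subset Metric.isClosed_closedBall fun x hx => ?_
  obtain ⟨a, b, hab, hxab⟩ := A.covered x
  simp only [Set.mem_iUnion]
  refine ⟨a, ⟨hab.1, ?_⟩, b, hab, hxab⟩
  have h1 := dist_triangle o x a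
  have h2 := dist_left_le_of_mem hxab
  have h3 := hl a b hab
  rw [Metric.mem_closedBall, dist_comm] at hx
  rw [dist_comm x a] at h1
  linarith

theorem finite_setOf_dist_smul_le (A : MarkedMetricGraph.{u} n) {o : A.Tree} (ho : o ∈ A.verts)
    (R : ℝ) : {g : FreeGroup (Fin n) | dist o (g • o) ≤ R}.Finite :=
  Set.Finite.of_injOn (f := fun g => g • o) (t := {y | y ∈ A.verts ∧ dist o y ≤ R}) (fun g hg => ⟨A.smul_mem g _ ho, hg⟩)
    (fun _ _ _ _ h => A.eq_of_smul_eq_smul h) (A.finite_verts_closedBall ho R)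

/-- The quotient is bounded. -/
theorem exists_dist_smul_le (A : MarkedMetricGraph.{u} n) (o : A.Tree) :
    ∃ ρ : ℝ, ∀ y : A.Tree, ∃ g : FreeGroup (Fin n), dist o (g • y) ≤ ρ := by
  obtain ⟨ι, rep, hrep⟩ := A.exists_isTransversal
  have := hrep.finite
  obtain ⟨l, -, hl⟩ := A.exists_dist_le_of_isEdge
  obtain ⟨r, hr⟩ := (Set.finite_range fun i => dist o (rep i)).bddAbove
  refine ⟨r + l, fun y => ?_⟩
  obtain ⟨a, b, hab, hy⟩ := A.covered y
  obtain ⟨g, i, rfl⟩ := hrep.exists_smul a hab.1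
  refine ⟨g⁻¹, ?_⟩
  have h1 := dist_triangle o (rep i) (g⁻¹ • y)
  have h2 : dist (rep i) (g⁻¹ • y) = dist (g • rep i) y := by
    rw [← A.dist_smul g, smul_inv_smul]
  have h3 := dist_left_le_of_mem hy
  have h4 := hl _ _ hab
  have h5 : dist o (rep i) ≤ r := hr ⟨i, rfl⟩
  linarith

/-- A point which is moved a bounded amount by the generators lies, up to the centre of `F_n`,
in a bounded set. -/
theorem exists_central_dist_le (A : MarkedMetricGraph.{u} n) {o : A.Tree} (ho : o ∈ A.verts)
    (R : ℝ) : ∃ M : ℝ, ∀ y : A.Tree, (∀ j : Fin n, dist y (FreeGroup.of j • y) ≤ R) →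
      ∃ z : FreeGroup (Fin n), (∀ g, z * g = g * z) ∧ dist o (z • y) ≤ M := by
  obtain ⟨ρ, hρ⟩ := A.exists_dist_smul_le o
  let E : Set (FreeGroup (Fin n)) := {g | dist o (g • o) ≤ R + 2 * ρ}
  have hE : E.Finite := A.finite_setOf_dist_smul_le ho _
  have hE' : Finite E := hE
  -- Two elements that conjugate all generators in the same way differ by an element of the centre.
  -- Only finitely many tuples have entries in `E`, so up to the centre only finitely many `g`
  -- occur.
  let tup : FreeGroup (Fin n) → Fin n → FreeGroup (Fin n) :=
    fun g j => g * FreeGroup.of j * g⁻¹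
  have hT : {t : Fin n → FreeGroup (Fin n) | ∀ j, t j ∈ E}.Finite := Set.Finite.pi' fun _ => hE
  have hch : ∀ t : Fin n → FreeGroup (Fin n), ∃ k : FreeGroup (Fin n),
      (∃ g, tup g = t) → tup k = t := by
    intro t
    by_cases h : ∃ g, tup g = t
    · obtain ⟨g, hg⟩ := h
      exact ⟨g, fun _ => hg⟩
    · exact ⟨1, fun h' => absurd h' h⟩
  choose k hk using hch
  obtain ⟨M, hM⟩ := (hT.image fun t => dist o ((k t)⁻¹ • o)).bddAbove
  refine ⟨M + ρ, fun y hy => ?_⟩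
  obtain ⟨g, hg⟩ := hρ y
  -- `g • y` is within `ρ` of `o` and is moved by at most `R` under the conjugated generator, so `o`
  -- is moved by at most `R + 2 * ρ`.
  have htE : ∀ j, tup g j ∈ E := by
    intro j
    change dist o ((g * FreeGroup.of j * g⁻¹) • o) ≤ R + 2 * ρ
    have h1 := dist_triangle4 o (g • y) ((g * FreeGroup.of j * g⁻¹) • g • y)
      ((g * FreeGroup.of j * g⁻¹) • o)
    have h2 : (g * FreeGroup.of j * g⁻¹) • g • y = g • FreeGroup.of j • y := by simp [mul_smul]
    rw [A.dist_smul, h2, A.dist_smul, dist_comm (g • y) o] at h1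
    linarith [hy j]
  have h1 := hk (tup g) ⟨g, rfl⟩
  have hcomm : ∀ h, (k (tup g))⁻¹ * g * h = h * ((k (tup g))⁻¹ * g) := by
    have hgen : ((MulAut.conj ((k (tup g))⁻¹ * g)).toMonoidHom :
        FreeGroup (Fin n) →* FreeGroup (Fin n)) = MonoidHom.id _ := by
      apply FreeGroup.ext_hom
      intro j
      have h2 : k (tup g) * FreeGroup.of j * (k (tup g))⁻¹ = g * FreeGroup.of j * g⁻¹ :=
        congrFun h1 j
      change (k (tup g))⁻¹ * g * FreeGroup.of j * ((k (tup g))⁻¹ * g)⁻¹ = FreeGroup.of j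
      calc (k (tup g))⁻¹ * g * FreeGroup.of j * ((k (tup g))⁻¹ * g)⁻¹
          = (k (tup g))⁻¹ * (g * FreeGroup.of j * g⁻¹) * k (tup g) := by group
        _ = FreeGroup.of j := by rw [← h2]; group
    intro h
    have h3 : (k (tup g))⁻¹ * g * h * ((k (tup g))⁻¹ * g)⁻¹ = h := DFunLike.congr_fun hgen h
    rwa [mul_inv_eq_iff_eq_mul] at h3
  refine ⟨(k (tup g))⁻¹ * g, hcomm, ?_⟩
  have h4 : dist o ((k (tup g))⁻¹ • o) ≤ M := hM ⟨tup g, htE, rfl⟩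
  have h5 := dist_triangle o ((k (tup g))⁻¹ • o) ((k (tup g))⁻¹ • g • y)
  rw [A.dist_smul] at h5
  rw [mul_smul]
  linarith

end MarkedMetricGraph

end OuterSpace

/-! ### Existence of optimal maps. -/

namespace OuterSpace

universe u v

open MarkedMetricGraph

variable {n : ℕ} {A : MarkedMetricGraph.{u} n} {B : MarkedMetricGraph.{v} n}
  {ι : Type*} {rep : ι → A.Tree}

namespace MarkedMetricGraph

/-- The length of the image of an oriented edge, when the chosen lifts of the vertices are mapped
to the points `p i`. -/
noncomputable def imageLen (p : ι → B.Tree) (d : Dart rep) : ℝ := dist (p d.src) (d.lab • p d.tgt)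

/-- The length of an oriented edge. -/
noncomputable def Dart.len (d : Dart rep) : ℝ := dist (rep d.src) d.head

/-- The speed on an oriented edge of the PL-map given by the images `p i` of the vertices. -/
noncomputable def dartSpeed (p : ι → B.Tree) (d : Dart rep) : ℝ := imageLen p d / d.len

variable (rep) in
/-- The stretching factor of the PL-map given by the images `p i` of the vertices. -/
noncomputable def maxSpeed (p : ι → B.Tree) : ℝ := ⨆ d : Dart rep, dartSpeed p d

theorem Dart.len_pos (d : Dart rep) : 0 < d.len := d.isEdge_head.dist_pos

theorem Dart.len_rev (d : Dart rep) : d.rev.len = d.len := by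
  unfold Dart.len
  rw [Dart.rev_head, ← A.dist_smul d.lab, smul_inv_smul, dist_comm]
  rfl

theorem imageLen_rev (p : ι → B.Tree) (d : Dart rep) : imageLen p d.rev = imageLen p d := by
  unfold imageLen
  rw [← B.dist_smul d.lab, Dart.rev_lab, smul_inv_smul, dist_comm]
  rfl

theorem dartSpeed_rev (p : ι → B.Tree) (d : Dart rep) : dartSpeed p d.rev = dartSpeed p d := by
  rw [dartSpeed, imageLen_rev, Dart.len_rev, dartSpeed]

theorem dartSpeed_le_maxSpeed [Finite (Dart rep)] (p : ι → B.Tree) (d : Dart rep) :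
    dartSpeed p d ≤ maxSpeed rep p := le_ciSup (Set.finite_range (dartSpeed p)).bddAbove d

theorem IsTransversal.nonempty_dart (hrep : A.IsTransversal rep) : Nonempty (Dart rep) := by
  obtain ⟨a, b, hab⟩ := A.exists_isEdge
  obtain ⟨g, d, -, -⟩ := hrep.exists_dart' hab
  exact ⟨d⟩

theorem speed_eq_dartSpeed {f : PLMap A B} {p : ι → B.Tree} (hf : ∀ i, f.toFun (rep i) = p i)
    (d : Dart rep) : f.speed (rep d.src) d.head = dartSpeed p d := by
  unfold PLMap.speed dartSpeed imageLen Dart.len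
  rw [hf, Dart.head, f.map_smul, hf]

theorem stretch_eq_maxSpeed (hrep : A.IsTransversal rep) {f : PLMap A B} {p : ι → B.Tree}
    (hf : ∀ i, f.toFun (rep i) = p i) : f.stretch = maxSpeed rep p := by
  have := Dart.finite hrep
  have := hrep.nonempty_dart
  apply le_antisymm
  · obtain ⟨a, b, hab, hs⟩ := f.exists_isMaxEdge
    obtain ⟨g, d, rfl, rfl⟩ := hrep.exists_dart' hab
    rw [← hs, f.speed_smul, speed_eq_dartSpeed hf]
    exact dartSpeed_le_maxSpeed p d
  · refine ciSup_le fun d => ?_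
    rw [← speed_eq_dartSpeed hf]
    exact f.speed_le_stretch d.isEdge_head

/-- Only central elements commute with the labels of all edges whatever these are. For `n = 1` the
whole group is central, and minimising sequences are bounded only up to such translations. -/
theorem maxSpeed_smul (p : ι → B.Tree) {z : FreeGroup (Fin n)} (hz : ∀ g, z * g = g * z) :
    maxSpeed rep (fun i => z • p i) = maxSpeed rep p := by
  unfold maxSpeed dartSpeed imageLen
  simp only [← mul_smul, ← hz]
  simp only [mul_smul, B.dist_smul]

theorem lowerSemicontinuous_maxSpeed [Finite (Dart rep)] :
    LowerSemicontinuous (maxSpeed rep : (ι → B.Tree) → ℝ) := by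
  refine lowerSemicontinuous_ciSup (fun p => (Set.finite_range (dartSpeed p)).bddAbove)
    fun d => Continuous.lowerSemicontinuous ?_
  unfold dartSpeed imageLen
  have h : Continuous fun x : B.Tree => d.lab • x :=
    (Isometry.of_dist_eq (B.dist_smul d.lab)).continuous
  exact ((continuous_apply d.src).dist (h.comp (continuous_apply d.tgt))).div_const _

/-- The stretching factor attains its minimum. -/
theorem exists_maxSpeed_le (hrep : A.IsTransversal rep) (B : MarkedMetricGraph.{v} n) :
    ∃ p : ι → B.Tree, ∀ q : ι → B.Tree, maxSpeed rep p ≤ maxSpeed rep q := by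
  have := Dart.finite hrep
  have := hrep.finite
  obtain ⟨d₀⟩ := hrep.nonempty_dart
  have i₀ := d₀.src
  obtain ⟨o, b, hob⟩ := B.exists_isEdge
  have ho := hob.left_mem
  let C := maxSpeed rep (fun _ : ι => o)
  obtain ⟨D, hD⟩ := (Set.finite_range fun i => dist (rep i₀) (rep i)).bddAbove
  obtain ⟨E, hE⟩ := (Set.finite_range fun j : Fin n =>
    dist (rep i₀) (FreeGroup.of j • rep i₀)).bddAbove
  have hC : 0 ≤ C := by
    refine le_trans ?_ (dartSpeed_le_maxSpeed _ d₀)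
    exact div_nonneg dist_nonneg d₀.len_pos.le
  have hD0 : 0 ≤ D := dist_nonneg.trans (hD ⟨i₀, rfl⟩)
  obtain ⟨M, hM⟩ := B.exists_central_dist_le ho (C * E)
  -- The radius leaves room for the image of one vertex, which lies within `M` of `o` up to the
  -- centre, and for a further `C * D` to the images of the other vertices.
  let K : Set (ι → B.Tree) := Set.pi Set.univ fun _ => Metric.closedBall o (max M 0 + C * D)
  have hK : IsCompact K := isCompact_univ_pi fun _ => B.isCompact_closedBall ho _
  have hoK : (fun _ : ι => o) ∈ K := by
    intro i _
    rw [Metric.mem_closedBall, dist_self]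
    positivity
  obtain ⟨p, -, hp⟩ := ((lowerSemicontinuous_maxSpeed (rep := rep)).lowerSemicontinuousOn K).exists_isMinOn
    ⟨_, hoK⟩ hK
  refine ⟨p, fun q => ?_⟩
  -- A competitor no worse than the constant choice `o` is moved into `K` by a central element; a
  -- worse one is beaten by the constant choice, which belongs to `K`.
  by_cases hq : maxSpeed rep q ≤ C
  · obtain ⟨f, hf⟩ := exists_plMap hrep q
    have hS := stretch_eq_maxSpeed hrep hf
    obtain ⟨z, hz, hzM⟩ := hM (q i₀) fun j => by
      rw [← hf, ← f.map_smul]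
      refine (f.dist_le_stretch_mul _ _).trans ?_
      rw [hS]
      exact mul_le_mul hq (hE ⟨j, rfl⟩) dist_nonneg hC
    rw [← maxSpeed_smul q hz]
    refine hp fun i _ => ?_
    rw [Metric.mem_closedBall, dist_comm]
    refine (dist_triangle o (z • q i₀) _).trans (add_le_add (hzM.trans (le_max_left _ _)) ?_)
    rw [B.dist_smul, ← hf, ← hf]
    refine (f.dist_le_stretch_mul _ _).trans ?_
    rw [hS]
    exact mul_le_mul hq (hD ⟨i, rfl⟩) dist_nonneg hC
  · exact (hp hoK).trans (not_le.1 hq).le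

open Classical in
/-- The effect on the image of an edge of moving one vertex along its maximally stretched edges. -/
theorem imageLen_update_le (p : ι → B.Tree) (i : ι) (q : B.Tree) (d : Dart rep) :
    imageLen (Function.update p i q) d ≤ imageLen p d + 2 * dist (p i) q := by
  have h : ∀ j, dist (Function.update p i q j) (p j) ≤ dist (p i) q := by
    intro j
    by_cases hj : j = i
    · subst hj
      rw [Function.update_self, dist_comm]
    · rw [Function.update_of_ne hj, dist_self]
      exact dist_nonneg
  unfold imageLen
  have h1 := dist_triangle4 (Function.update p i q d.src) (p d.src) (d.lab • p d.tgt)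
    (d.lab • Function.update p i q d.tgt)
  rw [B.dist_smul, dist_comm (p d.tgt)] at h1
  linarith [h d.src, h d.tgt]

open Classical in
-- The image of the vertex moves along the image of the edge towards its other end, so the image
-- gets shorter. For a loop both ends move inwards by the same amount.
theorem imageLen_update_lt {p : ι → B.Tree} {i : ι} {q : B.Tree} {d : Dart rep}
    (hq : 0 < dist (p i) q) (hqd : dist (p i) q < imageLen p d)
    (hs : d.src = i → q ∈ geodSeg (p i) (d.lab • p d.tgt))
    (ht : d.tgt = i → q ∈ geodSeg (p i) (d.lab⁻¹ • p d.src)) (h : d.src = i ∨ d.tgt = i) :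
    imageLen (Function.update p i q) d < imageLen p d := by
  unfold imageLen at *
  have ht' : d.tgt = i → d.lab • q ∈ geodSeg (p d.src) (d.lab • p i) := by
    intro h
    have := B.smul_mem_geodSeg d.lab (ht h)
    rw [smul_inv_smul] at this
    exact mem_geodSeg_symm this
  by_cases h1 : d.src = i
  · have hs1 := hs h1
    have hs2 := mem_geodSeg.1 hs1
    -- For a loop of image length `L` and a move by `δ`, the new length is `|L - 2 δ|`, which is
    -- less than `L` exactly because `0 < δ < L`.
    by_cases h2 : d.tgt = i
    · have ht1 := ht' h2
      rw [h2] at hs1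
      rw [h1] at ht1
      have hs3 := mem_geodSeg.1 hs1
      have ht2 := mem_geodSeg.1 ht1
      rw [h1, h2] at hqd
      rw [h1, h2, Function.update_self, B.isRTree.dist_eq_abs hs1 ht1, abs_lt]
      rw [B.dist_smul, dist_comm q] at ht2
      constructor <;> linarith
    · rw [h1, Function.update_self, Function.update_of_ne h2]
      linarith
  · have h2 := h.resolve_left h1
    have ht2 := mem_geodSeg.1 (ht' h2)
    rw [h2, Function.update_self, Function.update_of_ne h1]
    rw [B.dist_smul, dist_comm q] at ht2
    linarith

/-- There is an optimal map. -/
theorem exists_isOptimal (A : MarkedMetricGraph.{u} n) (B : MarkedMetricGraph.{v} n) :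
    ∃ f : PLMap A B, f.IsOptimal := by
  classical
  obtain ⟨ι, rep, hrep⟩ := A.exists_isTransversal
  have hfin := Dart.finite hrep
  obtain ⟨p₀, hp₀⟩ := exists_maxSpeed_le hrep B
  set S := maxSpeed rep p₀ with hS
  -- Minimising the maximal speed alone does not give optimality, as other edges may keep the
  -- maximum attained; the number of maximally stretched darts is minimised as well.
  let cnt : (ι → B.Tree) → ℕ := fun p => {d : Dart rep | dartSpeed p d = S}.ncard
  obtain ⟨p, hp, hmin⟩ := exists_minimalFor_of_wellFoundedLT
    (fun p : ι → B.Tree => maxSpeed rep p = S) cnt ⟨p₀, rfl⟩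
  obtain ⟨f, hf⟩ := exists_plMap hrep p
  have hfS : f.stretch = S := (stretch_eq_maxSpeed hrep hf).trans hp
  refine ⟨f, ?_⟩
  rintro ⟨x, ⟨y, hxy⟩, z, hz, hzy⟩
  obtain ⟨g, i, rfl⟩ := hrep.exists_smul x hxy.1.left_mem
  set z' := g⁻¹ • z with hz'
  have hgz : z = g • z' := by rw [hz', smul_inv_smul]
  have hne : p i ≠ z' := by
    rintro h
    apply hz
    rw [hgz, f.map_smul, hf, h]
  have hmax : ∀ d : Dart rep, dartSpeed p d = S → d.src = i → z' ∈ geodSeg (p i) (d.lab • p d.tgt) := by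
    intro d hd hdi
    have h1 : f.IsMaxEdge (rep d.src) d.head :=
      ⟨d.isEdge_head, by rw [speed_eq_dartSpeed hf, hd, hfS]⟩
    rw [hdi] at h1
    have h2 := hzy _ (h1.smul g)
    rw [f.map_smul, f.map_smul, hgz, B.smul_mem_geodSeg_iff, Dart.head, f.map_smul, hf, hf] at h2
    exact h2
  have hSpos : 0 < S := hfS ▸ f.stretch_pos
  -- The move must stay shorter than the images of the maximal edges. Any other edge can lengthen by
  -- `2 δ`, once for each endpoint, so `δ` is kept below half its slack.
  have hδ : ∀ᶠ δ in nhdsWithin (0 : ℝ) (Set.Ioi 0), 0 < δ ∧ δ < dist (p i) z' ∧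
      ∀ d : Dart rep, δ < if dartSpeed p d = S then imageLen p d
        else (S * d.len - imageLen p d) / 2 := by
    have hsmall : ∀ c : ℝ, 0 < c → ∀ᶠ δ in nhdsWithin (0 : ℝ) (Set.Ioi 0), δ < c :=
      fun c hc => Filter.mem_of_superset (Ioo_mem_nhdsGT hc) fun _ h => h.2
    refine (eventually_mem_nhdsWithin).and ((hsmall _ (dist_pos.2 hne)).and
      (Filter.eventually_all.2 fun d => hsmall _ ?_))
    have hdl := d.len_pos
    split_ifs with h
    · rw [dartSpeed, div_eq_iff hdl.ne'] at h
      rw [h]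
      positivity
    · have h1 := lt_of_le_of_ne (hp ▸ dartSpeed_le_maxSpeed p d) h
      rw [dartSpeed, div_lt_iff₀ hdl] at h1
      linarith
  obtain ⟨δ, hδ0, hδz, hδd⟩ := hδ.exists
  obtain ⟨q, hq, hqδ⟩ := B.isRTree.exists_mem_dist_eq (p i) z' hδ0.le hδz.le
  have hlt : ∀ d : Dart rep, dartSpeed p d = S → (d.src = i ∨ d.tgt = i) →
      dartSpeed (Function.update p i q) d < S := by
    intro d hd h
    have h1 := hδd d
    rw [if_pos hd] at h1
    have hdl := d.len_pos
    rw [← hd]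
    refine div_lt_div_of_pos_right (imageLen_update_lt (by rw [hqδ]; exact hδ0)
      (by rwa [hqδ]) (fun h => mem_geodSeg_of_left (hmax d hd h) hq)
      (fun h => mem_geodSeg_of_left (hmax d.rev (by rw [dartSpeed_rev, hd]) h) hq) h) hdl
  have heq : ∀ d : Dart rep, ¬ (d.src = i ∨ d.tgt = i) →
      dartSpeed (Function.update p i q) d = dartSpeed p d := by
    intro d h
    push Not at h
    rw [dartSpeed, dartSpeed, imageLen, imageLen, Function.update_of_ne h.1,
      Function.update_of_ne h.2]
  have hlt' : ∀ d : Dart rep, dartSpeed p d ≠ S → dartSpeed (Function.update p i q) d < S := by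
    intro d hd
    have h1 := hδd d
    rw [if_neg hd] at h1
    have h2 := imageLen_update_le p i q d
    rw [hqδ] at h2
    rw [dartSpeed, div_lt_iff₀ d.len_pos]
    linarith
  have hle : ∀ d : Dart rep, dartSpeed (Function.update p i q) d ≤ S := by
    intro d
    by_cases hd : dartSpeed p d = S
    · by_cases h : d.src = i ∨ d.tgt = i
      · exact (hlt d hd h).le
      · rw [heq d h, hd]
    · exact (hlt' d hd).le
  have hnd := hrep.nonempty_dart
  -- The maximal speed cannot fall below the minimum `S`, so the moved map is again a minimiser; but
  -- it has lost the maximal dart `d` at the vertex and gained none.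
  have hS' : maxSpeed rep (Function.update p i q) = S := le_antisymm (ciSup_le hle) (hp₀ _)
  obtain ⟨d, hd, hdy⟩ := hrep.exists_dart (i := i) (b := g⁻¹ • y) (by simpa using hxy.1.smul g⁻¹)
  have hdS : dartSpeed p d = S := by
    rw [← speed_eq_dartSpeed hf, hd, hdy, ← hfS, ← hxy.2, ← f.speed_smul g, smul_inv_smul]
  have hcnt : cnt (Function.update p i q) < cnt p := by
    refine Set.ncard_lt_ncard ?_ (Set.toFinite _)
    refine ⟨fun e he => ?_, fun hsub => ?_⟩
    · by_contra h
      exact (hlt' e h).ne he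
    · exact (hlt d hdS (Or.inl hd)).ne (hsub hdS)
  exact absurd (hmin hS' hcnt.le) (not_le.2 hcnt)

/-- The first two assertions for a given transversal: finitely many candidate loops suffice. -/
theorem exists_finset_candidates (A : MarkedMetricGraph.{u} n) :
    ∃ Γ : Finset (FreeGroup (Fin n)), (∀ w ∈ Γ, w ≠ 1 ∧ A.IsCandidate w) ∧
      ∀ B : MarkedMetricGraph.{v} n,
        ∃ w ∈ Γ, A.stretchR B = ((B.len w / A.len w : ℝ) : EReal) := by
  classical
  obtain ⟨ι, rep, hrep⟩ := A.exists_isTransversal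
  have := Dart.finite hrep
  -- The set depends on `A` alone: edge paths of at most `4 * |V|` edges over a finite set of darts,
  -- which covers the two circles of a barbell and its stem traversed twice.
  have hfin : (label '' {l : List (Dart rep) | l.length ≤ 4 * Nat.card ι} ∩
      {w | w ≠ 1 ∧ A.IsCandidate w}).Finite :=
    ((List.finite_length_le (Dart rep) (4 * Nat.card ι)).image label).inter_of_left _
  refine ⟨hfin.toFinset, fun w hw => ((hfin.mem_toFinset).1 hw).2, fun B => ?_⟩
  obtain ⟨f, hf⟩ := A.exists_isOptimal B
  obtain ⟨l, h1, -, h3, h4, h5, h6, h7⟩ := hf.exists_candidate hrep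
  have h8 : B.len (label l) / A.len (label l) = f.stretch := by
    rw [h6, h7, mul_div_assoc, div_self h5.ne', mul_one]
  refine ⟨label l, (hfin.mem_toFinset).2 ⟨⟨l, h1, rfl⟩, h3, h4⟩, ?_⟩
  rw [h8]
  exact f.stretchR_eq h3 h8

end MarkedMetricGraph

theorem PLMap.IsOptimal.exists_candidate_eq {f : PLMap A B} (hf : f.IsOptimal) :
    ∃ w : FreeGroup (Fin n), w ≠ 1 ∧ A.IsCandidate w ∧
      B.len w / A.len w = f.stretch ∧ A.stretchR B = (f.stretch : EReal) := by
  obtain ⟨ι, rep, hrep⟩ := A.exists_isTransversal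
  obtain ⟨l, -, -, h3, h4, h5, h6, h7⟩ := hf.exists_candidate hrep
  have h8 : B.len (label l) / A.len (label l) = f.stretch := by
    rw [h6, h7, mul_div_assoc, div_self h5.ne', mul_one]
  exact ⟨label l, h3, h4, h8, f.stretchR_eq h3 h8⟩

end OuterSpace

/-! ### Straight-line stack programs run in linear time on Turing machines. -/

namespace OuterSpace

/-! ### Stack programs -/

namespace StackProgram

open Turing

/-- An action on a stack, depending on a letter and on the top of the stack: the top is replaced by
at most two symbols. -/
abbrev Act (L : Type) := L → Option (Option L) → Option (Option L) × Option (Option L)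

variable {K L : Type}

/-- The effect of an action. -/
def Act.apply (act : Act L) (s : List (Option L)) (a : L) : List (Option L) :=
  (act a s.head?).2.toList ++ ((act a s.head?).1.toList ++ s.tail)

/-- The action which does nothing. -/
def Act.keep : Act L := fun _ x => (x, none)

/-- The action which pushes the letter. -/
def Act.push : Act L := fun a x => (x, some (some a))

/-- The action which removes the top. -/
def Act.drop : Act L := fun _ _ => (none, none)

/-- The action which pushes the letter `g a`, unless the top is `f a`, which is then removed. -/
def Act.cancel [DecidableEq L] (f g : L → L) : Act L := fun a x =>
  if x = some (some (f a)) then (none, none) else (x, some (some (g a)))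

/-- An instruction: the stack `src` is emptied up to the first separator `none`, and for each
of its letters the actions are performed on the other stacks. -/
structure Instr (K L : Type) where
  /-- the stack to be read -/
  src : K
  /-- the actions on the other stacks -/
  act : K → Act L

/-- The letters in front of the first separator. -/
def letters : List (Option L) → List L
  | [] => []
  | none :: _ => []
  | some a :: t => a :: letters t

/-- The symbols behind the first separator. -/
def rest : List (Option L) → List (Option L)
  | [] => []
  | none :: t => t
  | some _ :: t => rest t

theorem length_letters_le (l : List (Option L)) : (letters l).length ≤ l.length := by
  induction l with
  | nil => simp [letters]
  | cons x l ih => cases x <;> simp [letters, ih]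

theorem length_rest_le (l : List (Option L)) : (rest l).length ≤ l.length := by
  induction l with
  | nil => simp [rest]
  | cons x l ih =>
    cases x
    · simp [rest]
    · simp only [rest, List.length_cons]
      omega

theorem letters_map_some (l : List L) : letters (l.map some) = l := by
  induction l with
  | nil => rfl
  | cons a l ih => simp [letters, ih]

theorem rest_map_some (l : List L) : rest (l.map some) = [] := by
  induction l with
  | nil => rfl
  | cons a l ih => simp [rest, ih]

theorem letters_append (l : List L) (t : List (Option L)) :
    letters (l.map some ++ none :: t) = l := by
  induction l with
  | nil => rfl
  | cons a l ih => simpa [letters] using ih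

theorem rest_append (l : List L) (t : List (Option L)) :
    rest (l.map some ++ none :: t) = t := by
  induction l with
  | nil => rfl
  | cons a l ih => simpa [rest] using ih

theorem Act.length_apply_le (act : Act L) (s : List (Option L)) (a : L) :
    (act.apply s a).length ≤ s.length + 2 := by
  have h : ∀ o : Option (Option L), o.toList.length ≤ 1 := by
    intro o
    cases o <;> simp
  simp only [Act.apply, List.length_append, List.length_tail]
  have h1 := h (act a s.head?).1
  have h2 := h (act a s.head?).2
  omega

theorem Act.length_foldl_apply_le (act : Act L) (l : List L) (s : List (Option L)) :
    (l.foldl act.apply s).length ≤ s.length + 2 * l.length := by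
  induction l generalizing s with
  | nil => simp
  | cons a l ih =>
    have h1 := ih (act.apply s a)
    have h2 := act.length_apply_le s a
    simp only [List.foldl_cons, List.length_cons]
    omega

theorem Act.apply_keep (s : List (Option L)) (a : L) : Act.keep.apply s a = s := by
  cases s <;> simp [Act.apply, Act.keep]

theorem Act.foldl_keep (l : List L) (s : List (Option L)) : l.foldl Act.keep.apply s = s := by
  induction l with
  | nil => rfl
  | cons a l ih => rwa [List.foldl_cons, Act.apply_keep]

theorem Act.apply_push (s : List (Option L)) (a : L) : Act.push.apply s a = some a :: s := by
  cases s <;> simp [Act.apply, Act.push]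

theorem Act.foldl_push (l : List L) (s : List (Option L)) :
    l.foldl Act.push.apply s = l.reverse.map some ++ s := by
  induction l generalizing s with
  | nil => rfl
  | cons a l ih => simp [List.foldl_cons, Act.apply_push, ih]

theorem Act.foldl_drop (l : List L) (s : List (Option L)) :
    l.foldl Act.drop.apply s = s.drop l.length := by
  induction l generalizing s with
  | nil => rfl
  | cons a l ih =>
    have : Act.drop.apply s a = s.tail := by simp [Act.apply, Act.drop]
    rw [List.foldl_cons, this, ih, List.drop_tail, List.length_cons]

/-- The total size of the stacks. -/
def size [Fintype K] (S : K → List (Option L)) : ℕ := ∑ k, (S k).length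

theorem length_le_size [Fintype K] (S : K → List (Option L)) (k : K) : (S k).length ≤ size S :=
  Finset.single_le_sum (f := fun k => (S k).length) (fun _ _ => Nat.zero_le _) (Finset.mem_univ k)

variable [DecidableEq K]

/-- The effect of an instruction. -/
def Instr.run (I : Instr K L) (S : K → List (Option L)) : K → List (Option L) := fun k =>
  if k = I.src then rest (S k) else (letters (S I.src)).foldl (I.act k).apply (S k)

/-- The effect of a program. -/
def run (p : List (Instr K L)) (S : K → List (Option L)) : K → List (Option L) :=
  p.foldl (fun S I => I.run S) S

/-- The number of steps taken by a program. -/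
def time : List (Instr K L) → (K → List (Option L)) → ℕ
  | [], _ => 0
  | I :: p, S => (S I.src).length + 1 + time p (I.run S)

/-- The alphabets: one output stack for tokens, and the work stacks. -/
@[reducible] def Alphabet (K L : Type) : Option K → Type
  | none => Bool
  | some _ => Option L

/-- The contents of all stacks. -/
def allStacks (out : List Bool) (S : K → List (Option L)) : ∀ k, List (Alphabet K L k)
  | none => out
  | some k => S k

theorem update_stacks_some (out : List Bool) (S : K → List (Option L)) (k : K)
    (l : List (Option L)) :
    Function.update (allStacks out S) (some k) l = allStacks out (Function.update S k l) := by
  funext j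
  cases j with
  | none => rfl
  | some j =>
    by_cases h : j = k
    · subst h
      simp [allStacks]
    · rw [Function.update_of_ne (by simpa using h)]
      simp [allStacks, h]

theorem update_stacks_none (out out' : List Bool) (S : K → List (Option L)) :
    Function.update (allStacks out S) none out' = allStacks out' S := by
  funext j
  cases j with
  | none => rfl
  | some j =>
    rw [Function.update_of_ne (by simp)]
    rfl

/-- The registers: the letter which has been read and the top of another stack. -/
abbrev Reg (L : Type) := Option (Option L) × Option (Option L)

/-- The replacement of the top prescribed by an action. -/
def result (act : Act L) (v : Reg L) : Option (Option L) × Option (Option L) :=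
  match v.1 with
  | some (some a) => act a v.2
  | _ => (v.2, none)

variable {Λ : Type}

/-- The statement which performs an action. -/
def actStmt (act : Act L) (k : K) (q : TM2.Stmt (Alphabet K L) Λ (Reg L)) :
    TM2.Stmt (Alphabet K L) Λ (Reg L) :=
  let q' : TM2.Stmt (Alphabet K L) Λ (Reg L) :=
    .branch (fun v => (result act v).2.isSome)
      (.push (some k) (fun v => (result act v).2.getD none) q) q
  .pop (some k) (fun v x => (v.1, x)) <|
    .branch (fun v => (result act v).1.isSome)
      (.push (some k) (fun v => (result act v).1.getD none) q') q'

/-- The statement which performs the actions on several stacks. -/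
def actsStmt (act : K → Act L) (ks : List K) (q : TM2.Stmt (Alphabet K L) Λ (Reg L)) :
    TM2.Stmt (Alphabet K L) Λ (Reg L) :=
  ks.foldr (fun k q => actStmt (act k) k q) q

theorem stepAux_actStmt (act : Act L) (k : K) (q : TM2.Stmt (Alphabet K L) Λ (Reg L)) (a : L)
    (x : Option (Option L)) (out : List Bool) (S : K → List (Option L)) :
    TM2.stepAux (actStmt act k q) (some (some a), x) (allStacks out S) =
      TM2.stepAux q (some (some a), (S k).head?)
        (allStacks out (Function.update S k (act.apply (S k) a))) := by
  have hS : allStacks out S (some k) = S k := rfl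
  simp only [actStmt, TM2.stepAux, hS, result, update_stacks_some]
  rcases h : act a (S k).head? with ⟨r, s⟩
  cases r <;> cases s <;>
    simp [h, Act.apply, allStacks, Function.update_idem]

theorem stepAux_actsStmt (act : K → Act L) (ks : List K) (hks : ks.Nodup) (l : Λ) (a : L)
    (x : Option (Option L)) (out : List Bool) (S : K → List (Option L)) :
    ∃ v, TM2.stepAux (actsStmt act ks (.goto fun _ => l)) (some (some a), x) (allStacks out S) =
      ⟨some l, v, allStacks out fun k => if k ∈ ks then (act k).apply (S k) a else S k⟩ := by
  induction ks generalizing x S with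
  | nil => exact ⟨_, by simp [actsStmt]; rfl⟩
  | cons k ks ih =>
    rw [List.nodup_cons] at hks
    obtain ⟨v, hv⟩ := ih hks.2 (S k).head? (Function.update S k ((act k).apply (S k) a))
    refine ⟨v, ?_⟩
    have : actsStmt act (k :: ks) (.goto fun _ => l) =
      actStmt (act k) k (actsStmt act ks (.goto fun _ => l)) := rfl
    rw [this, stepAux_actStmt, hv]
    congr 2
    funext j
    by_cases hj : j = k
    · subst hj
      simp [hks.1]
    · simp [hj]

/-- The statement for one step of the output of the length of the stack `k`. -/
def outStmt (k : K) (l : Λ) : TM2.Stmt (Alphabet K L) Λ (Reg L) :=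
  .pop (some k) (fun _ x => (x, none)) <|
    .branch (fun v => v.1.isSome) (.push none (fun _ => true) (.goto fun _ => l))
      (.load (fun _ => (none, none)) .halt)

theorem iterate_outStmt {M : Λ → TM2.Stmt (Alphabet K L) Λ (Reg L)} {k : K} {l : Λ}
    (hM : M l = outStmt k l) (s : List (Option L)) (S : K → List (Option L))
    (hs : S k = s) (v : Reg L) (out : List Bool) :
    (flip bind (TM2.step M))^[s.length + 1] (some ⟨some l, v, allStacks out S⟩) =
      some ⟨none, (none, none), allStacks (List.replicate s.length true ++ out)
        (Function.update S k [])⟩ := by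
  induction s generalizing S v out with
  | nil =>
    have h1 : allStacks out S (some k) = [] := hs
    simp [flip, hM, outStmt, TM2.stepAux, h1, update_stacks_some]
  | cons x t ih =>
    have h1 : allStacks out S (some k) = x :: t := hs
    have hstep : flip bind (TM2.step M) (some ⟨some l, v, allStacks out S⟩) =
        some ⟨some l, (some x, none), allStacks (true :: out) (Function.update S k t)⟩ := by
      have h2 : allStacks out S none = out := rfl
      simp [flip, hM, outStmt, TM2.stepAux, h1, update_stacks_some, update_stacks_none, h2]
    rw [List.length_cons, Function.iterate_succ_apply, hstep, ih _ (by simp)]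
    simp [List.replicate_succ', Function.update_idem]

variable [Fintype K]

/-- Each letter read adds at most two symbols to each stack, and no more letters are read than the
source stack holds. -/
theorem Instr.size_run_le (I : Instr K L) (S : K → List (Option L)) :
    size (I.run S) ≤ (1 + 2 * Fintype.card K) * size S := by
  have h : ∀ k, (I.run S k).length ≤ (S k).length + 2 * size S := by
    intro k
    unfold Instr.run
    split_ifs with hk
    · exact (length_rest_le _).trans (Nat.le_add_right _ _)
    · refine (Act.length_foldl_apply_le _ _ _).trans ?_
      have := (length_letters_le (S I.src)).trans (length_le_size S I.src)
      omega
  calc size (I.run S) ≤ ∑ k, ((S k).length + 2 * size S) := Finset.sum_le_sum fun k _ => h k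
    _ = (1 + 2 * Fintype.card K) * size S := by
      rw [Finset.sum_add_distrib, Finset.sum_const, Finset.card_univ, smul_eq_mul]
      change size S + _ = _
      ring

theorem size_run_le (p : List (Instr K L)) :
    ∃ C, ∀ S, size (run p S) ≤ C * size S := by
  induction p with
  | nil => exact ⟨1, fun S => by simp [run]⟩
  | cons I p ih =>
    obtain ⟨C, hC⟩ := ih
    refine ⟨C * (1 + 2 * Fintype.card K), fun S => (hC (I.run S)).trans ?_⟩
    rw [mul_assoc]
    exact Nat.mul_le_mul_left _ (I.size_run_le S)

/-- A program is a fixed list of instructions without jumps. Each takes a number of steps linear in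
the current size and multiplies the size by at most a constant, so the constants depend on the
program alone. -/
theorem time_le (p : List (Instr K L)) : ∃ C, ∀ S, time p S ≤ C * (size S + 1) := by
  induction p with
  | nil => exact ⟨0, fun S => by simp [time]⟩
  | cons I p ih =>
    obtain ⟨C, hC⟩ := ih
    refine ⟨1 + C * (1 + 2 * Fintype.card K), fun S => ?_⟩
    have h1 := length_le_size S I.src
    have h2 := (hC (I.run S)).trans (Nat.mul_le_mul_left C (Nat.add_le_add_right
      (I.size_run_le S) 1))
    have h3 : C * ((1 + 2 * Fintype.card K) * size S + 1) ≤
        C * (1 + 2 * Fintype.card K) * (size S + 1) := by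
      rw [mul_assoc]
      refine Nat.mul_le_mul_left C ?_
      rw [mul_add]
      omega
    simp only [time]
    rw [add_mul]
    omega

/-- The statement for one step of an instruction. -/
noncomputable def instrStmt (I : Instr K L) (l l' : Λ) : TM2.Stmt (Alphabet K L) Λ (Reg L) :=
  .pop (some I.src) (fun _ x => (x, none)) <|
    .branch (fun v => v.1.join.isSome)
      (actsStmt I.act (Finset.univ.erase I.src).toList (.goto fun _ => l))
      (.load (fun _ => (none, none)) (.goto fun _ => l'))

/-- Induction on the source stack: one machine step pops one symbol and performs the actions on all
other stacks. Reading a separator or an empty stack takes the last step and passes on to the next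
instruction. -/
theorem iterate_instrStmt {M : Λ → TM2.Stmt (Alphabet K L) Λ (Reg L)} {I : Instr K L} {l l' : Λ}
    (hM : M l = instrStmt I l l') (s : List (Option L)) (S : K → List (Option L))
    (hs : S I.src = s) (v : Reg L) (out : List Bool) :
    ∃ m ≤ s.length + 1, (flip bind (TM2.step M))^[m] (some ⟨some l, v, allStacks out S⟩) =
      some ⟨some l', (none, none), allStacks out (I.run S)⟩ := by
  induction s generalizing S v with
  | nil =>
    refine ⟨1, by simp, ?_⟩
    have h1 : allStacks out S (some I.src) = [] := hs
    have h2 : I.run S = Function.update S I.src [] := by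
      funext k
      by_cases hk : k = I.src
      · subst hk
        simp [Instr.run, hs, rest]
      · simp [Instr.run, hs, letters, hk]
    simp [flip, hM, instrStmt, TM2.stepAux, h1, update_stacks_some, h2]
  | cons x t ih =>
    have h1 : allStacks out S (some I.src) = x :: t := hs
    cases x with
    | none =>
      refine ⟨1, by simp, ?_⟩
      have h2 : I.run S = Function.update S I.src t := by
        funext k
        by_cases hk : k = I.src
        · subst hk
          simp [Instr.run, hs, rest]
        · simp [Instr.run, hs, letters, hk]
      simp [flip, hM, instrStmt, TM2.stepAux, h1, update_stacks_some, h2]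
    | some a =>
      obtain ⟨w, hw⟩ := stepAux_actsStmt I.act (Finset.univ.erase I.src).toList
        (Finset.nodup_toList _) l a none out (Function.update S I.src t)
      set S' : K → List (Option L) := fun k => if k ∈ (Finset.univ.erase I.src).toList then
        (I.act k).apply (Function.update S I.src t k) a else Function.update S I.src t k with hS'
      have hst : S' I.src = t := by simp [hS']
      obtain ⟨m, hm, hm'⟩ := ih S' hst w
      refine ⟨m + 1, by simpa using hm, ?_⟩
      have hrun : I.run S' = I.run S := by
        funext k
        by_cases hk : k = I.src
        · subst hk
          simp [Instr.run, hst, hs, rest]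
        · simp [Instr.run, hs, letters, hk, hS']
      have hstep : flip bind (TM2.step M) (some ⟨some l, v, allStacks out S⟩) =
          some ⟨some l, w, allStacks out S'⟩ := by
        rw [← hw]
        simp [flip, hM, instrStmt, TM2.stepAux, h1, update_stacks_some]
      rw [Function.iterate_succ_apply, hstep, hm', hrun]

/-- The statements of a program. -/
noncomputable def programStmt (p : List (Instr K L)) (k : K) (i : Fin (p.length + 1)) :
    TM2.Stmt (Alphabet K L) (Fin (p.length + 1)) (Reg L) :=
  if h : i.1 < p.length then instrStmt p[i.1] i ⟨i.1 + 1, by omega⟩ else outStmt k i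

theorem iterate_programStmt (p : List (Instr K L)) (k : K) (q r : List (Instr K L))
    (hp : p = r ++ q) (i : Fin (p.length + 1)) (hi : i.1 = r.length) (S : K → List (Option L))
    (v : Reg L) (out : List Bool) :
    ∃ m ≤ time q S, ∃ v', (flip bind (TM2.step (programStmt p k)))^[m]
      (some ⟨some i, v, allStacks out S⟩) =
        some ⟨some (Fin.last p.length), v', allStacks out (run q S)⟩ := by
  induction q generalizing r i S v with
  | nil =>
    refine ⟨0, le_rfl, v, ?_⟩
    have : i = Fin.last p.length := by
      ext
      simp [hi, hp]
    rw [this]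
    rfl
  | cons I q ih =>
    have hlen : i.1 < p.length := by
      rw [hi, hp]
      simp
    have hI : p[i.1] = I := by
      simp [hp, hi]
    obtain ⟨m, hm, hm'⟩ := iterate_instrStmt (M := programStmt p k) (I := I) (l := i)
      (l' := ⟨i.1 + 1, by omega⟩) (by rw [programStmt, dif_pos hlen, hI]) _ S rfl v out
    obtain ⟨m', hm2, v', hm2'⟩ := ih (r ++ [I]) (by simp [hp]) ⟨i.1 + 1, by omega⟩ (by simp [hi])
      (I.run S) (none, none)
    refine ⟨m' + m, ?_, v', ?_⟩
    · simp only [time]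
      omega
    · rw [Function.iterate_add_apply, hm', hm2']
      rfl

/-- The machine which runs a program and outputs the length of the stack `k`. -/
noncomputable def machine [Fintype L] (p : List (Instr K L)) (k₀ k : K) : FinTM2 where
  K := Option K
  k₀ := some k₀
  k₁ := none
  Γ := Alphabet K L
  Λ := Fin (p.length + 1)
  main := 0
  σ := Reg L
  initialState := (none, none)
  Γk₀Fin := inferInstanceAs (Fintype (Option L))
  m := programStmt p k

theorem unaryEncodeNat_eq (m : ℕ) : Computability.unaryEncodeNat m = List.replicate m true := by
  induction m with
  | zero => rfl
  | succ m ih => rw [Computability.unaryEncodeNat, ih, List.replicate_succ]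

/-- A function which is computed by a stack program is computed in linear time by a Turing
machine. -/
theorem linearTime_of_run [Fintype L] {α : Type} (ea : α → List (Option L)) (F : α → ℕ)
    (p : List (Instr K L)) (k₀ k : K)
    (h : ∀ a, ∃ s : List (Option L), s.length = F a ∧
      run p (Function.update (fun _ => []) k₀ (ea a)) = Function.update (fun _ => []) k s) :
    LinearTime ea Computability.unaryEncodeNat F := by
  obtain ⟨C, hC⟩ := time_le p
  obtain ⟨C', hC'⟩ := size_run_le p
  -- `C` accounts for the program, and `C'` for emptying the final stack onto the output, one token
  -- for each symbol; the extra one covers the halting step.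
  let T : ℕ → ℕ := fun m => (C + C' + 1) * (m + 1)
  have key : ∀ a, Nonempty (TM2OutputsInTime (machine p k₀ k) (List.map id (ea a))
      (some (List.map id (Computability.unaryEncodeNat (F a)))) (T (ea a).length)) := by
    intro a
    set S : K → List (Option L) := Function.update (fun _ => []) k₀ (ea a) with hS
    obtain ⟨s, hs, hrun⟩ := h a
    obtain ⟨m, hm, v, hm'⟩ := iterate_programStmt p k p [] rfl 0 rfl S (none, none) []
    have hout := iterate_outStmt (M := programStmt p k) (k := k) (l := Fin.last p.length)
      (by simp [programStmt]) s (run p S) (by rw [hrun]; simp) v []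
    have hsize : size S = (ea a).length := by
      unfold size
      rw [Finset.sum_eq_single k₀]
      · simp [hS]
      · intro j _ hj
        simp [hS, hj]
      · simp
    refine ⟨⟨⟨s.length + 1 + m, ?_⟩, ?_⟩⟩
    · have hinit : initList (machine p k₀ k) (List.map id (ea a)) =
          (⟨some (0 : Fin (p.length + 1)), (none, none), allStacks [] S⟩ :
            TM2.Cfg (Alphabet K L) (Fin (p.length + 1)) (Reg L)) := by
        unfold initList
        congr 1
        funext j
        cases j with
        | none => rfl
        | some j =>
          by_cases hj : j = k₀
          · subst hj
            rw [hS]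
            simp only [allStacks, Function.update_self]
            refine (dif_pos rfl).trans ?_
            exact List.map_id _
          · have : ¬ (some j = (machine p k₀ k).k₀) := fun h => hj (Option.some.inj h)
            simp only [allStacks, hS, Function.update_of_ne hj]
            exact dif_neg this
      have hhalt : haltList (machine p k₀ k) (List.map id (Computability.unaryEncodeNat (F a))) =
          (⟨none, (none, none), allStacks (List.replicate s.length true ++ [])
            (Function.update (run p S) k [])⟩ :
            TM2.Cfg (Alphabet K L) (Fin (p.length + 1)) (Reg L)) := by
        unfold haltList
        congr 1
        funext j
        cases j with
        | none =>
          simp only [allStacks, unaryEncodeNat_eq, hs, List.append_nil]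
          refine (dif_pos rfl).trans ?_
          exact List.map_id _
        | some j =>
          have : ¬ (some j = (machine p k₀ k).k₁) := fun h => by cases h
          refine (dif_neg this).trans ?_
          change _ = Function.update (run p S) k [] j
          rw [hrun, Function.update_idem, Function.update_eq_self k (fun _ => [])]
          rfl
      change (flip bind (TM2.step (programStmt p k)))^[s.length + 1 + m]
        (some (initList (machine p k₀ k) (List.map id (ea a)))) =
          some (haltList (machine p k₀ k) (List.map id (Computability.unaryEncodeNat (F a))))
      rw [hinit, hhalt, Function.iterate_add_apply, hm', hout]
      rfl
    · have h1 := hC S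
      have h2 := (length_le_size (run p S) k).trans (hC' S)
      rw [hrun, Function.update_self] at h2
      rw [hsize] at h1 h2
      change s.length + 1 + m ≤ (C + C' + 1) * ((ea a).length + 1)
      nlinarith
  refine ⟨⟨⟨machine p k₀ k, Equiv.refl _, Equiv.refl _⟩, T, fun a => (key a).some⟩,
    C + C' + 1, fun m => le_rfl⟩

end StackProgram

end OuterSpace

/-! ### Stack programs for products and cyclic lengths in the free group. -/

namespace OuterSpace

namespace StackProgram

open FreeGroup

section General

variable {K L : Type} [DecidableEq K]

theorem run_nil (S : K → List (Option L)) : run [] S = S := rfl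

theorem run_cons (I : Instr K L) (p : List (Instr K L)) (S : K → List (Option L)) :
    run (I :: p) S = run p (I.run S) := rfl

theorem run_append (p q : List (Instr K L)) (S : K → List (Option L)) :
    run (p ++ q) S = run q (run p S) := List.foldl_append

theorem Instr.run_eq {I : Instr K L} {S S' : K → List (Option L)} (u : List L)
    (hu : S I.src = u.map some) (h₁ : S' I.src = [])
    (h₂ : ∀ k, k ≠ I.src → S' k = u.foldl (I.act k).apply (S k)) : I.run S = S' := by
  funext k
  by_cases hk : k = I.src
  · rw [Instr.run, if_pos hk, hk, hu, rest_map_some, h₁]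
  · rw [Instr.run, if_neg hk, hu, letters_map_some, h₂ k hk]

end General

section FreeGroup

variable {n : ℕ}

/-- The inverse letter. -/
def flip (a : Fin n × Bool) : Fin n × Bool := (a.1, !a.2)

theorem flip_flip (a : Fin n × Bool) : flip (flip a) = a := by simp [flip]

/-- The action which multiplies a reduced word, whose last letter is on top, by the letter
`g a`. -/
def mulAct (g : Fin n × Bool → Fin n × Bool) : Act (Fin n × Bool) :=
  Act.cancel (fun a => flip (g a)) g

/-- The reversed word of `x` is the word of its inverse with all letters flipped. Multiplication on
the right thus becomes prepending a letter to a reduced word, which cancels at most the top. -/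
theorem reverse_toWord_mul_mk (x : FreeGroup (Fin n)) (a : Fin n × Bool) :
    (toWord (x * mk [a])).reverse =
      if (toWord x).reverse.head? = some (flip a) then (toWord x).reverse.tail
      else a :: (toWord x).reverse := by
  have h : ∀ y : FreeGroup (Fin n), (toWord y).reverse = (toWord y⁻¹).map flip := by
    intro y
    rw [toWord_inv, invRev, List.map_reverse, List.map_map]
    have : (flip ∘ fun g : Fin n × Bool => (g.1, !g.2)) = id := by
      funext b
      exact flip_flip b
    rw [this, List.map_id]
  have h2 : (x * mk [a])⁻¹ = mk (flip a :: toWord x⁻¹) := by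
    rw [mul_inv_rev, inv_mk]
    conv_lhs => rw [← mk_toWord (x := x⁻¹), mul_mk]
    rfl
  rw [h, h x, h2, toWord_mk, reduce.cons, reduce_toWord]
  cases hw : toWord x⁻¹ with
  | nil => simp [flip_flip]
  | cons b t =>
    have h3 : ((flip a).1 = b.1 ∧ (flip a).2 = !b.2) ↔ flip b = flip a := by
      rw [Prod.ext_iff]
      exact ⟨fun h => ⟨h.1.symm, h.2.symm⟩, fun h => ⟨h.1.symm, h.2.symm⟩⟩
    by_cases hb : flip b = flip a
    · simp [h3, hb]
    · simp [h3, hb, flip_flip]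

theorem foldl_mulAct (g : Fin n × Bool → Fin n × Bool) (u : List (Fin n × Bool))
    (x : FreeGroup (Fin n)) :
    u.foldl (mulAct g).apply ((toWord x).reverse.map some) =
      (toWord (x * mk (u.map g))).reverse.map some := by
  induction u generalizing x with
  | nil => simp [← FreeGroup.one_eq_mk]
  | cons a u ih =>
    have h : (mulAct g).apply ((toWord x).reverse.map some) a =
        (toWord (x * mk [g a])).reverse.map some := by
      rw [reverse_toWord_mul_mk]
      cases hw : (toWord x).reverse with
      | nil => simp [Act.apply, mulAct, Act.cancel]
      | cons b t =>
        by_cases hb : b = flip (g a)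
        · simp [Act.apply, mulAct, Act.cancel, hb]
        · simp [Act.apply, mulAct, Act.cancel, hb]
    rw [List.foldl_cons, h, ih, mul_assoc, mul_mk]
    rfl

/-- The reading stack, the words of the generators, and the work stacks. -/
abbrev Index (n : ℕ) := Fin n ⊕ Fin 6

/-- The contents of the stacks. -/
def cfg (inp : List (Option (Fin n × Bool))) (W : Fin n → List (Fin n × Bool))
    (V X Z T M : List (Fin n × Bool)) : Index n → List (Option (Fin n × Bool)) :=
  Sum.elim (fun i => (W i).map some)
    ![inp, V.map some, X.map some, Z.map some, T.map some, M.map some]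

/-- The actions which act on at most one of the words of the generators. -/
def acts (i : Fin n) (a v x z t m : Act (Fin n × Bool)) : Index n → Act (Fin n × Bool) :=
  Sum.elim (Function.update (fun _ => Act.keep) i a) ![Act.keep, v, x, z, t, m]

open Act in
theorem run_word (i : Fin n) (v x z t m : Act (Fin n × Bool)) (W : Fin n → List (Fin n × Bool))
    {V X Z T M V' X' Z' T' M' : List (Fin n × Bool)}
    (hV : (W i).foldl v.apply (V.map some) = V'.map some)
    (hX : (W i).foldl x.apply (X.map some) = X'.map some)
    (hZ : (W i).foldl z.apply (Z.map some) = Z'.map some)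
    (hT : (W i).foldl t.apply (T.map some) = T'.map some)
    (hM : (W i).foldl m.apply (M.map some) = M'.map some) :
    (Instr.mk (.inl i) (acts i keep v x z t m)).run (cfg [] W V X Z T M) =
      cfg [] (Function.update W i []) V' X' Z' T' M' := by
  refine Instr.run_eq (W i) rfl (by simp [cfg]) ?_
  rintro (j | k) hk
  · have hj : j ≠ i := fun h => hk (congrArg _ h)
    simp [cfg, acts, hj, foldl_keep]
  · fin_cases k
    · exact (foldl_keep _ _).symm
    · exact hV.symm
    · exact hX.symm
    · exact hZ.symm
    · exact hT.symm
    · exact hM.symm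

theorem run_work (r : Fin 6) (i : Fin n) (a v x z t m : Act (Fin n × Bool)) (u : List (Fin n × Bool))
    {W : Fin n → List (Fin n × Bool)}
    {V X Z T M V' X' Z' T' M' w : List (Fin n × Bool)}
    (hu : cfg [] W V X Z T M (.inr r) = u.map some)
    (hu' : cfg [] (Function.update W i w) V' X' Z' T' M' (.inr r) = [])
    (hW : u.foldl a.apply ((W i).map some) = w.map some)
    (hV : 1 ≠ r → u.foldl v.apply (V.map some) = V'.map some)
    (hX : 2 ≠ r → u.foldl x.apply (X.map some) = X'.map some)
    (hZ : 3 ≠ r → u.foldl z.apply (Z.map some) = Z'.map some)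
    (hT : 4 ≠ r → u.foldl t.apply (T.map some) = T'.map some)
    (hM : 5 ≠ r → u.foldl m.apply (M.map some) = M'.map some) :
    (Instr.mk (.inr r) (acts i a v x z t m)).run (cfg [] W V X Z T M) =
      cfg [] (Function.update W i w) V' X' Z' T' M' := by
  refine Instr.run_eq u hu hu' ?_
  rintro (j | k) hk
  · by_cases hj : j = i
    · subst hj
      simpa [cfg, acts] using hW.symm
    · simp [cfg, acts, hj, Act.foldl_keep]
  · have hk' : k ≠ r := fun h => hk (congrArg _ h)
    fin_cases k
    · exact (Act.foldl_keep _ _).symm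
    · exact (hV hk').symm
    · exact (hX hk').symm
    · exact (hZ hk').symm
    · exact (hT hk').symm
    · exact (hM hk').symm

open Act in
/-- The program which computes the product of the `i`-th word with the `j`-th word or with its
inverse. -/
def mulProgram (i j : Fin n) : Bool → List (Instr (Index n) (Fin n × Bool))
  -- Words are stored with the last letter on top, and each pass reverses them. Passing through
  -- stack `1` restores the word and delivers the letters of the `j`-th word in their proper order.
  | true => [⟨.inl i, acts i keep push keep keep keep keep⟩,
      ⟨.inr 1, acts i push keep push keep keep keep⟩,
      ⟨.inl j, acts j keep push keep keep keep keep⟩,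
      ⟨.inr 1, acts j push keep (mulAct id) keep keep keep⟩]
  -- Reading the `j`-th word from its last letter and flipping the letters already gives its
  -- inverse, so the multiplication takes place in the first pass over it.
  | false => [⟨.inl i, acts i keep push keep keep keep keep⟩,
      ⟨.inr 1, acts i push keep push keep keep keep⟩,
      ⟨.inl j, acts j keep push (mulAct flip) keep keep keep⟩,
      ⟨.inr 1, acts j push keep keep keep keep keep⟩]

open Act in
/-- The program which replaces the word `w` by the reduction of `w * w`, without its first letters,
and extends the last stack to its length. -/
def squareProgram (i : Fin n) : List (Instr (Index n) (Fin n × Bool)) :=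
  -- `w` on stack `2` is copied to the work stacks, multiplied by its copy on stack `4`, and loses
  -- as many symbols as its copy on stack `3` has. The remainder then removes as many symbols as it
  -- has from the last stack, if available, and is pushed there itself.
  [⟨.inr 2, acts i keep push keep keep push keep⟩,
    ⟨.inr 1, acts i keep keep push push keep keep⟩,
    ⟨.inr 4, acts i keep keep (mulAct id) keep keep keep⟩,
    ⟨.inr 3, acts i keep keep drop keep keep keep⟩,
    ⟨.inr 2, acts i keep keep keep keep push drop⟩,
    ⟨.inr 4, acts i keep keep keep keep keep push⟩]

/-- The product of `x` with `y` or with its inverse. -/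
def signedMul {G : Type*} [Group G] (x y : G) : Bool → G
  | true => x * y
  | false => x * y⁻¹

/-- The cyclically reduced length. -/
def cycLength (w : FreeGroup (Fin n)) : ℕ := (toWord (w * w)).length - (toWord w).length

theorem map_id_toWord (x : FreeGroup (Fin n)) : mk ((toWord x).map id) = x := by
  rw [List.map_id, mk_toWord]

theorem run_mulProgram (x : Fin n → FreeGroup (Fin n)) (i j : Fin n) (s : Bool)
    (M : List (Fin n × Bool)) :
    run (mulProgram i j s) (cfg [] (fun i => (toWord (x i)).reverse) [] [] [] [] M) =
      cfg [] (fun i => (toWord (x i)).reverse) [] (toWord (signedMul (x i) (x j) s)).reverse [] []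
        M := by
  set W : Fin n → List (Fin n × Bool) := fun i => (toWord (x i)).reverse with hW
  have hWi : ∀ i, Function.update (Function.update W i []) i (W i) = W := by
    intro i
    rw [Function.update_idem, Function.update_eq_self]
  have h1 : (Instr.mk (.inl i) (acts i .keep .push .keep .keep .keep .keep)).run
      (cfg [] W [] [] [] [] M) = cfg [] (Function.update W i []) (toWord (x i)) [] [] [] M :=
    run_word i _ _ _ _ _ W (by simp [-List.foldl_reverse, Act.foldl_push, hW]) (Act.foldl_keep _ _)
      (Act.foldl_keep _ _) (Act.foldl_keep _ _) (Act.foldl_keep _ _)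
  have h2 : (Instr.mk (.inr 1) (acts i .push .keep .push .keep .keep .keep)).run
      (cfg [] (Function.update W i []) (toWord (x i)) [] [] [] M) =
        cfg [] W [] (W i) [] [] M := by
    rw [run_work 1 i _ _ _ _ _ _ (toWord (x i)) (w := W i) (V' := []) rfl rfl
      (by simp [-List.foldl_reverse, Act.foldl_push, hW]) (fun h => absurd rfl h) (X' := W i)
      (fun _ => by simp [-List.foldl_reverse, Act.foldl_push, hW]) (fun _ => Act.foldl_keep _ _)
      (fun _ => Act.foldl_keep _ _) (fun _ => Act.foldl_keep _ _), hWi]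
  cases s with
  | true =>
    have h3 : (Instr.mk (.inl j) (acts j .keep .push .keep .keep .keep .keep)).run
        (cfg [] W [] (W i) [] [] M) =
          cfg [] (Function.update W j []) (toWord (x j)) (W i) [] [] M :=
      run_word j _ _ _ _ _ W (by simp [-List.foldl_reverse, Act.foldl_push, hW]) (Act.foldl_keep _ _)
        (Act.foldl_keep _ _) (Act.foldl_keep _ _) (Act.foldl_keep _ _)
    have h4 : (Instr.mk (.inr 1) (acts j .push .keep (mulAct id) .keep .keep .keep)).run
        (cfg [] (Function.update W j []) (toWord (x j)) (W i) [] [] M) =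
          cfg [] W [] (toWord (x i * x j)).reverse [] [] M := by
      rw [run_work 1 j _ _ _ _ _ _ (toWord (x j)) (w := W j) (V' := []) rfl rfl
        (by simp [-List.foldl_reverse, Act.foldl_push, hW]) (fun h => absurd rfl h)
        (X' := (toWord (x i * x j)).reverse)
        (fun _ => by rw [hW, foldl_mulAct, map_id_toWord]) (fun _ => Act.foldl_keep _ _)
        (fun _ => Act.foldl_keep _ _) (fun _ => Act.foldl_keep _ _), hWi]
    rw [mulProgram, run_cons, h1, run_cons, h2, run_cons, h3, run_cons, h4]
    rfl
  | false =>
    have h3 : (Instr.mk (.inl j) (acts j .keep .push (mulAct flip) .keep .keep .keep)).run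
        (cfg [] W [] (W i) [] [] M) =
          cfg [] (Function.update W j []) (toWord (x j)) (toWord (x i * (x j)⁻¹)).reverse [] []
            M := by
      refine run_word j _ _ _ _ _ W (by simp [-List.foldl_reverse, Act.foldl_push, hW]) ?_
        (Act.foldl_keep _ _) (Act.foldl_keep _ _) (Act.foldl_keep _ _)
      have : mk ((toWord (x j)).reverse.map flip) = (x j)⁻¹ := by
        conv_rhs => rw [← mk_toWord (x := x j), inv_mk, invRev, ← List.map_reverse]
        rfl
      rw [hW, foldl_mulAct, this]
    have h4 : (Instr.mk (.inr 1) (acts j .push .keep .keep .keep .keep .keep)).run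
        (cfg [] (Function.update W j []) (toWord (x j)) (toWord (x i * (x j)⁻¹)).reverse [] [] M) =
          cfg [] W [] (toWord (x i * (x j)⁻¹)).reverse [] [] M := by
      rw [run_work 1 j _ _ _ _ _ _ (toWord (x j)) (w := W j) (V' := []) rfl rfl
        (by simp [-List.foldl_reverse, Act.foldl_push, hW]) (fun h => absurd rfl h)
        (fun _ => Act.foldl_keep _ _) (fun _ => Act.foldl_keep _ _)
        (fun _ => Act.foldl_keep _ _) (fun _ => Act.foldl_keep _ _), hWi]
    rw [mulProgram, run_cons, h1, run_cons, h2, run_cons, h3, run_cons, h4]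
    rfl

/-- With `y` the length of the remainder and `m` that of the last stack, the new length is `y + (m -
y)` with truncated subtraction, which is `max m y`. -/
theorem run_squareProgram (W : Fin n → List (Fin n × Bool)) (i : Fin n) (w : FreeGroup (Fin n))
    (M : List (Fin n × Bool)) :
    ∃ M', M'.length = max M.length (cycLength w) ∧
      run (squareProgram i) (cfg [] W [] (toWord w).reverse [] [] M) =
        cfg [] W [] [] [] [] M' := by
  obtain ⟨Y, hY⟩ : ∃ Y, Y = (toWord (w * w)).reverse.drop (toWord w).length := ⟨_, rfl⟩
  have hW : Function.update W i (W i) = W := Function.update_eq_self i W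
  have keep := Act.foldl_keep (L := Fin n × Bool)
  have h1 : (Instr.mk (.inr 2) (acts i .keep .push .keep .keep .push .keep)).run
      (cfg [] W [] (toWord w).reverse [] [] M) =
        cfg [] W (toWord w) [] [] (toWord w) M := by
    have := run_work 2 i .keep .push .keep .keep .push .keep (toWord w).reverse (W := W) (w := W i)
      (V := []) (V' := toWord w) (X := (toWord w).reverse) (X' := []) (Z := []) (Z' := [])
      (T := []) (T' := toWord w) (M := M) (M' := M) rfl rfl
      (keep _ _) (fun _ => by simp [-List.foldl_reverse, Act.foldl_push]) (fun h => absurd rfl h)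
      (fun _ => keep _ _) (fun _ => by simp [-List.foldl_reverse, Act.foldl_push]) (fun _ => keep _ _)
    rwa [hW] at this
  have h2 : (Instr.mk (.inr 1) (acts i .keep .keep .push .push .keep .keep)).run
      (cfg [] W (toWord w) [] [] (toWord w) M) =
        cfg [] W [] (toWord w).reverse (toWord w).reverse (toWord w) M := by
    have := run_work 1 i .keep .keep .push .push .keep .keep (toWord w) (W := W) (w := W i)
      (V := toWord w) (V' := []) (X := []) (X' := (toWord w).reverse) (Z := [])
      (Z' := (toWord w).reverse) (T := toWord w) (T' := toWord w) (M := M) (M' := M) rfl rfl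
      (keep _ _) (fun h => absurd rfl h) (fun _ => by simp [-List.foldl_reverse, Act.foldl_push])
      (fun _ => by simp [-List.foldl_reverse, Act.foldl_push]) (fun _ => keep _ _) (fun _ => keep _ _)
    rwa [hW] at this
  have h3 : (Instr.mk (.inr 4) (acts i .keep .keep (mulAct id) .keep .keep .keep)).run
      (cfg [] W [] (toWord w).reverse (toWord w).reverse (toWord w) M) =
        cfg [] W [] (toWord (w * w)).reverse (toWord w).reverse [] M := by
    have := run_work 4 i .keep .keep (mulAct id) .keep .keep .keep (toWord w) (W := W) (w := W i)
      (V := []) (V' := []) (X := (toWord w).reverse) (X' := (toWord (w * w)).reverse)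
      (Z := (toWord w).reverse) (Z' := (toWord w).reverse) (T := toWord w) (T' := [])
      (M := M) (M' := M) rfl rfl
      (keep _ _) (fun _ => keep _ _) (fun _ => by rw [foldl_mulAct, map_id_toWord])
      (fun _ => keep _ _) (fun h => absurd rfl h) (fun _ => keep _ _)
    rwa [hW] at this
  have h4 : (Instr.mk (.inr 3) (acts i .keep .keep .drop .keep .keep .keep)).run
      (cfg [] W [] (toWord (w * w)).reverse (toWord w).reverse [] M) =
        cfg [] W [] Y [] [] M := by
    have := run_work 3 i .keep .keep .drop .keep .keep .keep (toWord w).reverse (W := W) (w := W i)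
      (V := []) (V' := []) (X := (toWord (w * w)).reverse) (X' := Y)
      (Z := (toWord w).reverse) (Z' := []) (T := []) (T' := [])
      (M := M) (M' := M) rfl rfl
      (keep _ _) (fun _ => keep _ _) (fun _ => by simp [-List.foldl_reverse, Act.foldl_drop, hY, List.map_drop])
      (fun h => absurd rfl h) (fun _ => keep _ _) (fun _ => keep _ _)
    rwa [hW] at this
  have h5 : (Instr.mk (.inr 2) (acts i .keep .keep .keep .keep .push .drop)).run
      (cfg [] W [] Y [] [] M) = cfg [] W [] [] [] Y.reverse (M.drop Y.length) := by
    have := run_work 2 i .keep .keep .keep .keep .push .drop Y (W := W) (w := W i)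
      (V := []) (V' := []) (X := Y) (X' := []) (Z := []) (Z' := []) (T := []) (T' := Y.reverse)
      (M := M) (M' := M.drop Y.length) rfl rfl
      (keep _ _) (fun _ => keep _ _) (fun h => absurd rfl h) (fun _ => keep _ _)
      (fun _ => by simp [-List.foldl_reverse, Act.foldl_push]) (fun _ => by simp [-List.foldl_reverse, Act.foldl_drop, List.map_drop])
    rwa [hW] at this
  have h6 : (Instr.mk (.inr 4) (acts i .keep .keep .keep .keep .keep .push)).run
      (cfg [] W [] [] [] Y.reverse (M.drop Y.length)) =
        cfg [] W [] [] [] [] (Y ++ M.drop Y.length) := by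
    have := run_work 4 i .keep .keep .keep .keep .keep .push Y.reverse (W := W) (w := W i)
      (V := []) (V' := []) (X := []) (X' := []) (Z := []) (Z' := []) (T := Y.reverse) (T' := [])
      (M := M.drop Y.length) (M' := Y ++ M.drop Y.length) rfl rfl
      (keep _ _) (fun _ => keep _ _) (fun _ => keep _ _) (fun _ => keep _ _)
      (fun h => absurd rfl h) (fun _ => by simp [-List.foldl_reverse, Act.foldl_push])
    rwa [hW] at this
  refine ⟨Y ++ M.drop Y.length, ?_, ?_⟩
  · have : Y.length = cycLength w := by simp [hY, cycLength]
    rw [List.length_append, List.length_drop, this]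
    omega
  · rw [squareProgram, run_cons, h1, run_cons, h2, run_cons, h3, run_cons, h4, run_cons, h5,
      run_cons, h6, run_nil]

/-- The program which computes the maximum of the cyclically reduced lengths of products. -/
def maxProgram (l : List (Fin n × Fin n × Bool)) : List (Instr (Index n) (Fin n × Bool)) :=
  l.flatMap fun t => mulProgram t.1 t.2.1 t.2.2 ++ squareProgram t.1

theorem run_maxProgram (x : Fin n → FreeGroup (Fin n)) (l : List (Fin n × Fin n × Bool))
    (M : List (Fin n × Bool)) :
    ∃ M', M'.length = max M.length
        (l.toFinset.sup fun t => cycLength (signedMul (x t.1) (x t.2.1) t.2.2)) ∧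
      run (maxProgram l) (cfg [] (fun i => (toWord (x i)).reverse) [] [] [] [] M) =
        cfg [] (fun i => (toWord (x i)).reverse) [] [] [] [] M' := by
  induction l generalizing M with
  | nil => exact ⟨M, by simp, rfl⟩
  | cons t l ih =>
    obtain ⟨M₁, h1, h1'⟩ := run_squareProgram (fun i => (toWord (x i)).reverse) t.1
      (signedMul (x t.1) (x t.2.1) t.2.2) M
    obtain ⟨M₂, h2, h2'⟩ := ih M₁
    refine ⟨M₂, ?_, ?_⟩
    · rw [h2, h1, List.toFinset_cons, Finset.sup_insert, max_assoc]
    · rw [maxProgram, List.flatMap_cons, run_append, run_append, run_mulProgram, h1']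
      exact h2'

open Act in
/-- The program which reads the input. -/
def readProgram (l : List (Fin n)) : List (Instr (Index n) (Fin n × Bool)) :=
  l.map fun i => ⟨.inr 0, acts i push keep keep keep keep keep⟩

theorem run_readProgram (u : Fin n → List (Fin n × Bool)) (l : List (Fin n)) (hl : l.Nodup)
    (W : Fin n → List (Fin n × Bool)) :
    run (readProgram l) (cfg (l.flatMap fun i => (u i).map some ++ [none]) W [] [] [] [] []) =
      cfg [] (fun i => if i ∈ l then (u i).reverse ++ W i else W i) [] [] [] [] [] := by
  induction l generalizing W with
  | nil => simp [readProgram, run]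
  | cons i l ih =>
    rw [List.nodup_cons] at hl
    have h : (Instr.mk (.inr 0) (acts i .push .keep .keep .keep .keep .keep)).run
        (cfg ((i :: l).flatMap fun i => (u i).map some ++ [none]) W [] [] [] [] []) =
          cfg (l.flatMap fun i => (u i).map some ++ [none])
            (Function.update W i ((u i).reverse ++ W i)) [] [] [] [] [] := by
      have hsrc : cfg ((i :: l).flatMap fun i => (u i).map some ++ [none]) W [] [] [] [] []
          (.inr 0) = (u i).map some ++ none :: l.flatMap fun i => (u i).map some ++ [none] := by
        simp [cfg]
      funext k
      unfold Instr.run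
      rcases k with j | k
      · rw [if_neg (by simp)]
        simp only [hsrc, letters_append]
        by_cases hj : j = i
        · subst hj
          simp [cfg, acts, Act.foldl_push]
        · simp [cfg, acts, hj, Act.foldl_keep]
      · by_cases hk : k = 0
        · subst hk
          rw [if_pos rfl, hsrc, rest_append]
          rfl
        · rw [if_neg (by simpa using hk)]
          fin_cases k
          · exact absurd rfl hk
          all_goals exact Act.foldl_keep _ _
    rw [readProgram, List.map_cons, run_cons, h]
    refine (ih hl.2 _).trans ?_
    congr 1
    funext j
    by_cases hj : j = i
    · subst hj
      simp [hl.1]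
    · simp [hj]

open Act in
/-- The program which erases the words of the generators. -/
def clearProgram (l : List (Fin n)) : List (Instr (Index n) (Fin n × Bool)) :=
  l.map fun i => ⟨.inl i, acts i keep keep keep keep keep keep⟩

theorem run_clearProgram (l : List (Fin n)) (W : Fin n → List (Fin n × Bool))
    (M : List (Fin n × Bool)) :
    run (clearProgram l) (cfg [] W [] [] [] [] M) =
      cfg [] (fun i => if i ∈ l then [] else W i) [] [] [] [] M := by
  induction l generalizing W with
  | nil => simp [clearProgram, run]
  | cons i l ih =>
    have keep := Act.foldl_keep (L := Fin n × Bool)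
    rw [clearProgram, List.map_cons, run_cons, run_word i _ _ _ _ _ W (keep _ _) (keep _ _)
      (keep _ _) (keep _ _) (keep _ _)]
    refine (ih _).trans ?_
    congr 1
    funext j
    by_cases hj : j = i
    · subst hj
      simp
    · simp [hj]

/-- The maximum of the cyclically reduced lengths of the products of the images of two generators
and of their inverses. -/
def maxCycLength (φ : FreeGroup (Fin n) ≃* FreeGroup (Fin n)) : ℕ :=
  Finset.univ.sup fun t : Fin n × Fin n × Bool =>
    cycLength (signedMul (φ (of t.1)) (φ (of t.2.1)) t.2.2)

theorem linearTime_maxCycLength (n : ℕ) :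
    LinearTime (encodeAut n) Computability.unaryEncodeNat (maxCycLength (n := n)) := by
  refine linearTime_of_run (encodeAut n) maxCycLength (readProgram (List.finRange n) ++
    (maxProgram (Finset.univ : Finset (Fin n × Fin n × Bool)).toList ++
      clearProgram (List.finRange n))) (.inr 0 : Index n) (.inr 5) fun φ => ?_
  obtain ⟨M, hM, hM'⟩ := run_maxProgram (fun i => φ (of i))
    (Finset.univ : Finset (Fin n × Fin n × Bool)).toList []
  refine ⟨M.map some, by simpa [maxCycLength] using hM, ?_⟩
  have h0 : (Function.update (fun _ => []) (.inr 0 : Index n) (encodeAut n φ) :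
      Index n → List (Option (Fin n × Bool))) =
        cfg ((List.finRange n).flatMap fun i => (toWord (φ (of i))).map some ++ [none])
          (fun _ => []) [] [] [] [] [] := by
    funext k
    rcases k with j | k
    · simp [cfg]
    · fin_cases k <;> simp [cfg, encodeAut]
  have h1 : (cfg [] (fun _ => []) [] [] [] [] M : Index n → List (Option (Fin n × Bool))) =
      Function.update (fun _ => []) (.inr 5 : Index n) (M.map some) := by
    funext k
    rcases k with j | k
    · simp [cfg]
    · fin_cases k <;> simp [cfg]
  rw [h0, run_append, run_readProgram _ _ (List.nodup_finRange n), run_append]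
  simp only [List.mem_finRange, if_true, List.append_nil]
  rw [hM', run_clearProgram]
  simpa using h1

end FreeGroup

end StackProgram

end OuterSpace

/-! ### The unit rose: lengths as word lengths, and the value of `Λ_R`. -/

namespace OuterSpace

universe u v

open FreeGroup StackProgram

namespace MarkedMetricGraph

variable {n : ℕ} (A : MarkedMetricGraph.{u} n)

theorem len_conj (g w : FreeGroup (Fin n)) : A.len (g * w * g⁻¹) = A.len w := by
  unfold len
  refine (Equiv.iInf_congr (MulAction.toPerm g) fun x => ?_).symm
  rw [MulAction.toPerm_apply, ← mul_smul, inv_mul_cancel_right, mul_smul, A.dist_smul]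

theorem len_inv (w : FreeGroup (Fin n)) : A.len w⁻¹ = A.len w := by
  unfold len
  refine iInf_congr fun x => ?_
  rw [← A.dist_smul w x (w⁻¹ • x), smul_inv_smul, dist_comm]

theorem len_mul_comm (g w : FreeGroup (Fin n)) : A.len (g * w) = A.len (w * g) := by
  rw [← A.len_conj g (w * g)]
  congr 1
  group

theorem len_twist (φ : FreeGroup (Fin n) ≃* FreeGroup (Fin n)) (w : FreeGroup (Fin n)) :
    (A.twist φ).len w = A.len (φ w) := rfl

end MarkedMetricGraph

section Words

open reduceCyclically

variable {n : ℕ}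

/-- Writing `w = a c a⁻¹` with `c` cyclically reduced, the word `a c ⋯ c a⁻¹` for the power is
reduced. The case `m = 0` is excluded since then `a a⁻¹` cancels. -/
theorem length_toWord_pow (w : FreeGroup (Fin n)) {m : ℕ} (hm : m ≠ 0) :
    (toWord (w ^ m)).length =
      2 * (conjugator (toWord w)).length + m * (reduceCyclically (toWord w)).length := by
  rw [toWord_pow, reduce_flatten_replicate isReduced_toWord, if_neg hm]
  simp
  ring

theorem cycLength_eq (w : FreeGroup (Fin n)) :
    cycLength w = (reduceCyclically (toWord w)).length := by
  have h1 := length_toWord_pow w one_ne_zero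
  have h2 := length_toWord_pow w two_ne_zero
  rw [pow_one] at h1
  rw [pow_two] at h2
  unfold cycLength
  omega

theorem cycLength_mul_self (w : FreeGroup (Fin n)) : cycLength (w * w) = 2 * cycLength w := by
  have h2 := length_toWord_pow w two_ne_zero
  have h4 := length_toWord_pow w four_ne_zero
  have h : w ^ 4 = (w * w) * (w * w) := by
    rw [← pow_two, ← pow_two, ← pow_mul]
  rw [h] at h4
  rw [pow_two] at h2
  rw [cycLength_eq w, cycLength]
  omega

theorem norm_signedMul_of_le (i j : Fin n) (s : Bool) :
    (toWord (signedMul (of i) (of j) s)).length ≤ 2 := by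
  have h : ∀ x y : FreeGroup (Fin n), (toWord (x * y)).length ≤
      (toWord x).length + (toWord y).length := norm_mul_le
  cases s
  · simpa [signedMul] using h (of i) (of j)⁻¹
  · simpa [signedMul] using h (of i) (of j)

theorem map_signedMul {G H : Type*} [Group G] [Group H] (φ : G ≃* H) (x y : G) (s : Bool) :
    φ (signedMul x y s) = signedMul (φ x) (φ y) s := by
  cases s <;> simp [signedMul]

end Words

namespace MarkedMetricGraph

variable {n : ℕ} (A : MarkedMetricGraph.{u} n)

/-- `o` is a vertex of the universal cover of the unit rose. -/
structure IsRoseVertex (o : A.Tree) : Prop where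
  verts_eq : A.verts = MulAction.orbit (FreeGroup (Fin n)) o
  isEdge_iff : ∀ y, A.IsEdge o y ↔ ∃ i : Fin n, y = of i • o ∨ y = (of i)⁻¹ • o
  dist_eq : ∀ i : Fin n, dist o (of i • o) = 1

namespace IsRoseVertex

variable {A} {o : A.Tree} (ho : A.IsRoseVertex o)
include ho

theorem isEdge_mk (c : Fin n × Bool) : A.IsEdge o (FreeGroup.mk [c] • o) := by
  rw [ho.isEdge_iff]
  obtain ⟨i, b⟩ := c
  refine ⟨i, ?_⟩
  cases b
  · exact Or.inr rfl
  · exact Or.inl rfl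

theorem dist_of_isEdge {y : A.Tree} (h : A.IsEdge o y) : dist o y = 1 := by
  obtain ⟨i, rfl | rfl⟩ := (ho.isEdge_iff y).1 h
  · exact ho.dist_eq i
  · rw [← A.dist_smul (of i), smul_inv_smul, dist_comm]
    exact ho.dist_eq i

/-- In a reduced word consecutive letters do not cancel, so consecutive edges of the path from `o`
are different and form a geodesic. The second conjunct supplies the overlap needed to join the first
edge to the geodesic of the tail. -/
theorem dist_mk : ∀ L : List (Fin n × Bool), IsReduced L → dist o (FreeGroup.mk L • o) = L.length ∧
    ∀ c t, L = c :: t → FreeGroup.mk [c] • o ∈ geodSeg o (FreeGroup.mk L • o)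
  | [], _ => ⟨by simp [← FreeGroup.one_eq_mk], fun c t h => by cases h⟩
  | [c], _ => ⟨by simpa using ho.dist_of_isEdge (ho.isEdge_mk c), fun c' t h => by
      cases h
      exact right_mem_geodSeg _ _⟩
  | c :: d :: t, h => by
    obtain ⟨h1, h2⟩ := dist_mk (d :: t) (List.isChain_of_isChain_cons h)
    have e1 : FreeGroup.mk (c :: d :: t) • o = FreeGroup.mk [c] • FreeGroup.mk (d :: t) • o := by
      rw [← mul_smul, mul_mk]
      rfl
    have m1 : FreeGroup.mk [c] • o ∈ geodSeg o (FreeGroup.mk [c] • FreeGroup.mk [d] • o) := by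
      refine A.mem_geodSeg_of_isEdge (ho.isEdge_mk c).symm ((ho.isEdge_mk d).smul _) fun e => ?_
      rw [← mul_smul, mul_mk] at e
      have h3 := congrArg toWord (A.free _ _ e.symm)
      have h4 : IsReduced [c, d] := h.infix ⟨[], t, by simp⟩
      rw [toWord_mk, List.singleton_append, h4.reduce_eq, toWord_one] at h3
      cases h3
    have m2 : FreeGroup.mk [c] • FreeGroup.mk [d] • o ∈ geodSeg (FreeGroup.mk [c] • o) (FreeGroup.mk (c :: d :: t) • o) := by
      rw [e1]
      exact A.smul_mem_geodSeg _ (h2 d t rfl)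
    have m3 := IsRTree.mem_of_overlap A.isRTree m1 m2 ((ho.isEdge_mk d).smul _).ne
    refine ⟨?_, fun c' t' h' => ?_⟩
    · rw [← mem_geodSeg.1 m3, e1, A.dist_smul, h1, ho.dist_of_isEdge (ho.isEdge_mk c)]
      simp only [List.length_cons]
      push_cast
      ring
    · obtain ⟨rfl, rfl⟩ := List.cons.inj h'
      exact m3

theorem dist_smul_eq (w : FreeGroup (Fin n)) : dist o (w • o) = (toWord w).length := by
  have := (ho.dist_mk (toWord w) isReduced_toWord).1
  rwa [mk_toWord] at this

/-- A conjugate of `w` is the cyclically reduced word `c`, which moves `o` by `|c|`. Conversely `w ^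
m` has word length at least `m * |c|`, so no point is moved by less than `|c|`. -/
theorem len_eq (w : FreeGroup (Fin n)) : A.len w = cycLength w := by
  rw [cycLength_eq]
  set a := reduceCyclically.conjugator (toWord w)
  set c := reduceCyclically (toWord w) with hc
  refine le_antisymm ?_ (A.le_len_of_le_dist_pow o fun m => ?_)
  · have h1 : w = FreeGroup.mk a * FreeGroup.mk c * (FreeGroup.mk a)⁻¹ := by
      conv_lhs => rw [← mk_toWord (x := w),
        ← reduceCyclically.conj_conjugator_reduceCyclically (toWord w)]
      rw [inv_mk, mul_mk, mul_mk]
    rw [h1, A.len_conj, ← (ho.dist_mk c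
      (reduceCyclically.isCyclicallyReduced isReduced_toWord).isReduced).1]
    exact A.len_le_dist _ o
  · rw [ho.dist_smul_eq]
    rcases eq_or_ne m 0 with rfl | hm
    · simp
    · rw [length_toWord_pow w hm]
      push_cast
      linarith [(Nat.cast_nonneg a.length : (0 : ℝ) ≤ _)]

theorem len_le_length (w : FreeGroup (Fin n)) : A.len w ≤ (toWord w).length :=
  (A.len_le_dist w o).trans_eq (ho.dist_smul_eq w)

theorem isTransversal : A.IsTransversal fun _ : Unit => o where
  mem_verts _ := by
    rw [ho.verts_eq]
    exact MulAction.mem_orbit_self o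
  exists_smul x hx := by
    rw [ho.verts_eq] at hx
    obtain ⟨g, rfl⟩ := hx
    exact ⟨g, (), rfl⟩
  inj _ _ _ _ := rfl

theorem pathLen_eq (l : List (Dart fun _ : Unit => o)) : pathLen l = l.length := by
  induction l with
  | nil => simp [pathLen]
  | cons d l ih =>
    have h := ho.dist_of_isEdge d.isEdge_head
    simp only [pathLen, List.map_cons, List.sum_cons, List.length_cons] at ih ⊢
    rw [ih]
    push_cast
    linarith

theorem lab_eq (d : Dart fun _ : Unit => o) : ∃ i, d.lab = of i ∨ d.lab = (of i)⁻¹ := by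
  obtain ⟨i, h | h⟩ := (ho.isEdge_iff _).1 d.isEdge
  · exact ⟨i, Or.inl (A.eq_of_smul_eq_smul h)⟩
  · exact ⟨i, Or.inr (A.eq_of_smul_eq_smul h)⟩

theorem len_signedMul_le (φ : FreeGroup (Fin n) ≃* FreeGroup (Fin n)) (i j : Fin n) (s : Bool) :
    A.len (signedMul (φ (of i)) (φ (of j)) s) ≤ maxCycLength φ := by
  rw [ho.len_eq, Nat.cast_le]
  exact Finset.le_sup (f := fun t : Fin n × Fin n × Bool =>
    cycLength (signedMul (φ (of t.1)) (φ (of t.2.1)) t.2.2)) (Finset.mem_univ (i, j, s))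

/-- Products of two generators or inverses have length at most two in `A`, which bounds the maximum
by `2 Λ_R`; the candidate for an optimal map has at most two edges, which gives the converse. -/
theorem stretchR_twist (φ : FreeGroup (Fin n) ≃* FreeGroup (Fin n)) :
    A.stretchR (A.twist φ) = (((maxCycLength φ : ℝ) / 2 : ℝ) : EReal) := by
  obtain ⟨f, hf⟩ := A.exists_isOptimal (A.twist φ)
  obtain ⟨w, -, -, -, hw⟩ := hf.exists_candidate_eq
  rw [hw, EReal.coe_eq_coe_iff]
  have hlower : (maxCycLength φ : ℝ) ≤ f.stretch * 2 := by
    have h0 : 0 ≤ f.stretch * 2 := by linarith [f.stretch_pos]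
    -- The supremum is taken in `ℕ`, so each term is compared with the floor of `2 * S_f`.
    refine (Nat.cast_le.2 (Finset.sup_le fun t _ => Nat.le_floor ?_)).trans (Nat.floor_le h0)
    rw [← ho.len_eq, ← map_signedMul, ← A.len_twist]
    refine (f.len_le _).trans (mul_le_mul_of_nonneg_left ?_ f.stretch_pos.le)
    exact (ho.len_le_length _).trans (by exact_mod_cast norm_signedMul_of_le t.1 t.2.1 t.2.2)
  have hupper : f.stretch * 2 ≤ maxCycLength φ := by
    obtain ⟨l, -, hl, h1, -, h3, h4, h5⟩ := hf.exists_candidate ho.isTransversal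
    rw [ho.pathLen_eq, A.len_twist] at h5
    match l, hl inferInstance, h1, h5 with
    | [], _, h1, _ => exact absurd rfl h1
    -- A single petal is accounted for by the pair `i = j`, because squaring doubles the cyclic
    -- length.
    | [d], _, _, h5 =>
      obtain ⟨i, hi⟩ := ho.lab_eq d
      have h6 : A.len (φ (label [d])) = A.len (φ (of i)) := by
        rcases hi with hi | hi
        · simp [label, hi]
        · simp [label, hi, A.len_inv]
      have h7 := ho.len_signedMul_le φ i i true
      rw [signedMul, ho.len_eq, cycLength_mul_self] at h7
      rw [h6, ho.len_eq] at h5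
      push_cast at h7 h5
      simp only [List.length_singleton, Nat.cast_one, mul_one] at h5
      linarith
    | [d, e], _, _, h5 =>
      obtain ⟨i, hi⟩ := ho.lab_eq d
      obtain ⟨j, hj⟩ := ho.lab_eq e
      have h6 : A.len (φ (label [d, e])) ≤ maxCycLength φ := by
        have hlab : label [d, e] = d.lab * e.lab := by simp [label]
        rw [hlab, _root_.map_mul]
        -- Length is invariant under cyclic permutation and inversion, so of the four sign patterns
        -- only `x_i x_j` and `x_i x_j⁻¹` need to be tested.
        rcases hi with hi | hi <;> rcases hj with hj | hj <;> rw [hi, hj]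
        · exact ho.len_signedMul_le φ i j true
        · rw [_root_.map_inv]
          exact ho.len_signedMul_le φ i j false
        · rw [_root_.map_inv, A.len_mul_comm]
          exact ho.len_signedMul_le φ j i false
        · rw [_root_.map_inv, _root_.map_inv, ← mul_inv_rev, A.len_inv]
          exact ho.len_signedMul_le φ j i true
      rw [h5] at h6
      simpa using h6
    | _ :: _ :: _ :: _, hl, _, _ => simp at hl
  linarith

end IsRoseVertex

end MarkedMetricGraph

end OuterSpace

theorem mainTheorem1 (n : ℕ) :
    -- an optimal map: a loop of one of the three shapes realises `S_f = Λ_R(A, B)`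
    (∀ (A : OuterSpace.MarkedMetricGraph.{0} n) (B : OuterSpace.MarkedMetricGraph.{0} n)
        (f : OuterSpace.PLMap A B), f.IsOptimal →
      ∃ w : FreeGroup (Fin n), w ≠ 1 ∧ A.IsCandidate w ∧
        B.len w / A.len w = f.stretch ∧ A.stretchR B = (f.stretch : EReal)) ∧
    -- finitely many candidate loops in `A`, chosen independently of `B`, suffice
    (∀ A : OuterSpace.MarkedMetricGraph.{0} n,
      ∃ Γ : Finset (FreeGroup (Fin n)), (∀ w ∈ Γ, w ≠ 1 ∧ A.IsCandidate w) ∧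
        ∀ B : OuterSpace.MarkedMetricGraph.{0} n,
          ∃ w ∈ Γ, A.stretchR B = ((B.len w / A.len w : ℝ) : EReal)) ∧
    -- for the rose and its image under an automorphism, `2 Λ_R` is computed in linear time
    (∃ N : (FreeGroup (Fin n) ≃* FreeGroup (Fin n)) → ℕ,
      OuterSpace.LinearTime (OuterSpace.encodeAut n) Computability.unaryEncodeNat N ∧
      ∀ A : OuterSpace.MarkedMetricGraph.{0} n, A.IsUnitRose →
        ∀ φ : FreeGroup (Fin n) ≃* FreeGroup (Fin n),
          A.stretchR (A.twist φ) = (((N φ : ℝ) / 2 : ℝ) : EReal)) := by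
  refine ⟨fun A B f hf => hf.exists_candidate_eq, fun A => A.exists_finset_candidates, ?_⟩
  refine ⟨_, OuterSpace.StackProgram.linearTime_maxCycLength n, ?_⟩
  rintro A ⟨o, h₁, h₂, h₃⟩ φ
  exact (OuterSpace.MarkedMetricGraph.IsRoseVertex.mk h₁ h₂ h₃).stretchR_twist φ
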